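/- Let $S$ be a smooth projective surface over $\mathbf C$ with canonical bundle $K_S$, let $\pi\colon X=\mathrm{Tot}(K_S)\to S$ be the total space of $K_S$, and let $\tau\in\Gamma(X,\pi^*K_S)$ be the tautological section. Let $E$ be a locally free sheaf of finite rank on $S$ with a Higgs field $\phi\colon E\to E\otimes K_S$, and let $\mathcal E_\phi$ be its spectral sheaf, that is, the quasi-coherent sheaf on $X$ with an isomorphism $\pi_*\mathcal E_\phi\cong E$ under which $\pi_*(\tau\cdot\mathrm{id})\colon \pi_*\mathcal E_\phi\to\pi_*(\mathcal E_\phi\otimes\pi^*K_S)\cong \pi_*\mathcal E_\phi\otimes K_S$ becomes $\phi$. Put $\mathcal E_\phi^D:=\mathcal{E}xt^1(\mathcal E_\phi,\pi^*K_S^{-1})$. Then: 1. $\mathbf R\mathcal{H}om(\mathcal E_\phi,\pi^*K_S^{-1})[1]$ is quasi-isomorphic to the sheaf $\mathcal E_\phi^D$ placed in degree $0$. 2. There is a unique transpose $\phi^*\colon E^*\to E^*\otimes K_S$ of $\phi$, i.e. a map such that for all local sections $e$ of $E$ and $\lambda$ of $E^*=\mathcal{H}om(E,\mathcal O_S)$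 one has $\langle\lambda,\phi(e)\rangle=\langle\phi^*(\lambda),e\rangle$ in $K_S$, and $$\mathcal E_\phi^D\;\cong\;\mathrm{coker}\bigl(\pi^*\phi^*-\tau\cdot\mathrm{id}\colon\ \pi^*E^*\to\pi^*E^*\otimes\pi^*K_S\bigr)\otimes\pi^*K_S^{-1}.$$ -/

import Mathlib

open CategoryTheory Limits AlgebraicGeometry Opposite
universe u
namespace Higgs
noncomputable section

/-- The sheaves `j_! 𝒪_U` generate the category of `𝒪_X`-modules. -/
theorem modules_isSeparating (X : Scheme.{u}) :
    (ObjectProperty.ofObj (fun U : X.Opens => ((PresheafOfModules.sheafification (𝟙 X.ringCatSheaf.obj)).obj ((PresheafOfModules.free _).obj (yoneda.obj U)) : X.Modules))).IsSeparating := by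
  intro M N f g h
  apply (SheafOfModules.forget X.ringCatSheaf ⋙ PresheafOfModules.restrictScalars (𝟙 X.ringCatSheaf.obj)).map_injective
  refine PresheafOfModules.freeYoneda.isSeparating _ _ _ ?_
  rintro _ ⟨U⟩ k
  apply ((PresheafOfModules.sheafificationAdjunction (𝟙 X.ringCatSheaf.obj)).homEquiv _ _).symm.injective
  have := h _ (ObjectProperty.ofObj_apply _ U) (((PresheafOfModules.sheafificationAdjunction (𝟙 X.ringCatSheaf.obj)).homEquiv _ _).symm k)
  simp only [← Adjunction.homEquiv_naturality_right_symm] at this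
  exact this

instance (X : Scheme.{u}) : HasSeparator X.Modules where
  hasSeparator := ⟨_, (modules_isSeparating X).isSeparator_coproduct⟩

/-- The category of `𝒪_X`-modules is a Grothendieck abelian category; in particular it has enough
injectives, so that derived functors of left exact functors are available. -/
instance (X : Scheme.{u}) : IsGrothendieckAbelian.{u} X.Modules where
  hasFilteredColimitsOfSize := inferInstance
  ab5OfSize := ⟨fun J _ _ => by
    have : HasExactColimitsOfShape J X.PresheafOfModules := 
       HasExactColimitsOfShape.domain_of_functor J (PresheafOfModules.toPresheaf X.ringCatSheaf.obj)
    exact (PresheafOfModules.sheafificationAdjunction (𝟙 X.ringCatSheaf.obj)).hasExactColimitsOfShape J⟩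

variable {X : Scheme.{u}}

/-- An `𝒪_X`-bilinear map of sheaves `M × N → P`. -/
structure BilinHom (M N P : X.Modules) where
  app (U : X.Opens) : Γ(M, U) →ₗ[Γ(X, U)] Γ(N, U) →ₗ[Γ(X, U)] Γ(P, U)
  naturality {U V : X.Opens} (i : V ⟶ U) (m : Γ(M, U)) (n : Γ(N, U)) :
    P.presheaf.map i.op (app U m n) = app V (M.presheaf.map i.op m) (N.presheaf.map i.op n)

/-- The presheaf `U ↦ M(U) ⊗_{𝒪(U)} N(U)`. -/
def presheafTensor (M N : X.Modules) : X.PresheafOfModules :=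
  PresheafOfModules.Monoidal.tensorObj (R := X.presheaf) M.val N.val

variable (X) in
/-- Sheafification of presheaves of `𝒪_X`-modules. -/
def sheafification : X.PresheafOfModules ⥤ X.Modules :=
  PresheafOfModules.sheafification (𝟙 X.ringCatSheaf.obj)

variable (X) in
/-- Sheafification is left adjoint to the forgetful functor. -/
def sheafificationAdj : sheafification X ⊣ Scheme.Modules.toPresheafOfModules X :=
  PresheafOfModules.sheafificationAdjunction (𝟙 X.ringCatSheaf.obj)

/-- The tensor product `M ⊗ N` of `𝒪_X`-modules. -/
def tensor (M N : X.Modules) : X.Modules :=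
  (sheafification X).obj (presheafTensor M N)

/-- The sheafification map of the presheaf tensor product. -/
def toTensor (M N : X.Modules) : presheafTensor M N ⟶ (tensor M N).val := 
  (sheafificationAdj X).unit.app (presheafTensor M N)


@[ext]
theorem BilinHom.ext' {M N P : X.Modules} {b c : BilinHom M N P}
    (h : ∀ U m n, b.app U m n = c.app U m n) : b = c := by
  cases b; cases c; congr; ext U m n; exact h U m n

open scoped TensorProduct in
/-- The universal bilinear map `(m, n) ↦ m ⊗ n`. -/
def tensorMk (M N : X.Modules) : BilinHom M N (tensor M N) where
  app U := 
    letI T : (Γ(M, U) ⊗[Γ(X, U)] Γ(N, U)) →ₗ[Γ(X, U)] Γ(tensor M N, U) := ((toTensor M N).app (op U)).hom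
    LinearMap.mk₂ Γ(X, U) (fun m n => T (m ⊗ₜ n)) (fun m m' n => by rw [TensorProduct.add_tmul, map_add])
      (fun c m n => by rw [← map_smul]; rfl) (fun m n n' => by rw [TensorProduct.tmul_add, map_add])
      (fun c m n => by rw [TensorProduct.tmul_smul, ← map_smul])
  naturality {U V} i m n := (PresheafOfModules.naturality_apply (toTensor M N) i.op (m ⊗ₜ[Γ(X, U)] n)).symm

/-- The map out of the presheaf tensor product given by a bilinear map. -/
def presheafTensorDesc {M N P : X.Modules} (b : BilinHom M N P) : presheafTensor M N ⟶ P.val where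
  app U := ModuleCat.MonoidalCategory.tensorLift (R := Γ(X, U.unop)) (fun m n => b.app U.unop m n)
    (fun m m' n => (b.app U.unop).map_add₂ m m' n) (fun c m n => (b.app U.unop).map_smul₂ c m n)
    (fun m n n' => map_add (b.app U.unop m) n n') (fun c m n => map_smul (b.app U.unop m) c n)
  naturality {U V} f := ModuleCat.MonoidalCategory.tensor_ext (fun m n => (b.naturality f.unop m n).symm)

/-- The map `M ⊗ N ⟶ P` given by a bilinear map `M × N → P`. -/
def tensorDesc {M N P : X.Modules} (b : BilinHom M N P) : tensor M N ⟶ P :=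
  ((sheafificationAdj X).homEquiv (presheafTensor M N) P).symm
    (presheafTensorDesc b)

theorem tensorDesc_mk {M N P : X.Modules} (b : BilinHom M N P) (U : X.Opens) (m : Γ(M, U)) (n : Γ(N, U)) :
    (tensorDesc b).app U ((tensorMk M N).app U m n) = b.app U m n := by
  have := ((sheafificationAdj X).homEquiv (presheafTensor M N) P).apply_symm_apply
    (presheafTensorDesc b)
  rw [Adjunction.homEquiv_unit] at this
  have := congr(($this).app (op U) (m ⊗ₜ[Γ(X,U)] n))
  exact this
theorem tensor_hom_ext {M N P : X.Modules} {f g : tensor M N ⟶ P} (h : ∀ U m n, f.app U ((tensorMk M N).app U m n) = g.app U ((tensorMk M N).app U m n)) : f = g := by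
  apply ((sheafificationAdj X).homEquiv (presheafTensor M N) P).injective
  refine ((sheafificationAdj X).homEquiv_unit ..).trans (.trans ?_ ((sheafificationAdj X).homEquiv_unit ..).symm)
  ext1 U
  exact ModuleCat.MonoidalCategory.tensor_ext (fun m n => h U.unop m n)

/-- A morphism of `𝒪_X`-modules on sections, as a linear map. -/
def appₗ {M N : X.Modules} (f : M ⟶ N) (U : X.Opens) : Γ(M, U) →ₗ[Γ(X, U)] Γ(N, U) :=
  (f.val.app (op U)).hom

@[simp] theorem appₗ_apply {M N : X.Modules} (f : M ⟶ N) (U : X.Opens) (m : Γ(M, U)) : appₗ f U m = f.app U m := rfl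

theorem app_map {M N : X.Modules} (f : M ⟶ N) {U V : X.Opens} (i : V ⟶ U) (m : Γ(M, U)) :
    f.app V (M.presheaf.map i.op m) = N.presheaf.map i.op (f.app U m) :=
  PresheafOfModules.naturality_apply f.val i.op m

/-- A morphism of `𝒪_X`-modules from its linear maps on sections. -/
def homMk {M N : X.Modules} (f : ∀ U : X.Opens, Γ(M, U) →ₗ[Γ(X, U)] Γ(N, U))
    (hf : ∀ {U V : X.Opens} (i : V ⟶ U) (m : Γ(M, U)),
      N.presheaf.map i.op (f U m) = f V (M.presheaf.map i.op m)) : M ⟶ N where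
  val := 
   { app U := ModuleCat.ofHom (f U.unop)
     naturality {U V} i := by
       ext m
       exact (hf i.unop m).symm }

theorem homMk_app {M N : X.Modules} (f : ∀ U : X.Opens, Γ(M, U) →ₗ[Γ(X, U)] Γ(N, U)) (hf) (U : X.Opens) (m : Γ(M, U)) :
   (homMk f hf).app U m = f U m := rfl

/-- The bilinear map `(m, n) ↦ b(f m, g n)`. -/
def BilinHom.precomp {M N P M' N' : X.Modules} (b : BilinHom M N P) (f : M' ⟶ M) (g : N' ⟶ N) : BilinHom M' N' P where
  app U := (b.app U).compl₁₂ (appₗ f U) (appₗ g U)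
  naturality i m n := by
    simp [b.naturality, app_map]

/-- The map `f ⊗ g`. -/
def tensorMap {M N M' N' : X.Modules} (f : M ⟶ M') (g : N ⟶ N') : tensor M N ⟶ tensor M' N' :=
  tensorDesc ((tensorMk M' N').precomp f g)

/-- The map `M ⟶ M ⊗ N`, `m ↦ m ⊗ s`, for a global section `s` of `N` (multiplication by `s`). -/
def tensorSection (M : X.Modules) {N : X.Modules} (s : Γ(N, ⊤)) : M ⟶ tensor M N :=
  homMk (fun U => ((tensorMk M N).app U).flip (N.presheaf.map (homOfLE le_top).op s))
    (fun {U V} i m => by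
      simp only [LinearMap.flip_apply, BilinHom.naturality]
      rw [← ConcreteCategory.comp_apply, ← Functor.map_comp]
      rfl)

section
variable {S : Scheme.{u}} (f : X ⟶ S)

/-- The pushforward of a bilinear map. -/
def BilinHom.pushforward {M N P : X.Modules} (b : BilinHom M N P) :
    BilinHom ((Scheme.Modules.pushforward f).obj M) ((Scheme.Modules.pushforward f).obj N) ((Scheme.Modules.pushforward f).obj P) where
  app U := LinearMap.mk₂ _ (fun m n => b.app (f ⁻¹ᵁ U) m n) 
    (fun m m' n => (b.app _).map_add₂ m m' n) (fun c m n => (b.app _).map_smul₂ (f.app U c) m n)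
    (fun m n n' => map_add (b.app _ m) n n')
    (fun c m n => (b.app (f ⁻¹ᵁ U) m).map_smul (f.app U c) (show Γ(N, f ⁻¹ᵁ U) from n))
  naturality i m n := b.naturality ((TopologicalSpace.Opens.map f.base).map i) m n

/-- The adjunction unit `M ⟶ f_* f^* M`. -/
def pullbackUnit (M : S.Modules) : M ⟶ (Scheme.Modules.pushforward f).obj ((Scheme.Modules.pullback f).obj M) :=
  (Scheme.Modules.pullbackPushforwardAdjunction f).unit.app M

/-- The pullback `f^* s` of a global section. -/
def pullbackSection {M : S.Modules} (s : Γ(M, ⊤)) : Γ((Scheme.Modules.pullback f).obj M, ⊤) :=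
  (pullbackUnit f M).app ⊤ s

/-- The canonical map `f_* M ⊗ N ⟶ f_* (M ⊗ f^* N)` of the projection formula. -/
def projectionMap (M : X.Modules) (N : S.Modules) :
   tensor ((Scheme.Modules.pushforward f).obj M) N ⟶ (Scheme.Modules.pushforward f).obj (tensor M ((Scheme.Modules.pullback f).obj N)) :=
  tensorDesc (((tensorMk M ((Scheme.Modules.pullback f).obj N)).pushforward f).precomp (𝟙 _) (pullbackUnit f N))

/-- The canonical map `f^* (M ⊗ N) ⟶ f^* M ⊗ f^* N`. -/
def pullbackTensor (M N : S.Modules) : (Scheme.Modules.pullback f).obj (tensor M N) ⟶ tensor ((Scheme.Modules.pullback f).obj M) ((Scheme.Modules.pullback f).obj N) :=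
  ((Scheme.Modules.pullbackPushforwardAdjunction f).homEquiv _ _).symm
    (tensorDesc (((tensorMk _ _).pushforward f).precomp (pullbackUnit f M) (pullbackUnit f N)))
end

/-- Restriction of sections. -/
abbrev res (M : X.Modules) {U V : X.Opens} (h : V ≤ U) : Γ(M, U) ⟶ Γ(M, V) := M.presheaf.map (homOfLE h).op

/-- The group of `𝒪_U`-linear morphisms `M|_U ⟶ N|_U`: families of linear maps
`M(V) → N(V)`, `V ⊆ U`, compatible with restriction. -/
def localHom (M N : X.Modules) (U : X.Opens) :
    AddSubgroup (∀ V : {V : X.Opens // V ≤ U}, Γ(M, V.1) →ₗ[Γ(X, V.1)] Γ(N, V.1)) where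
  carrier := {f | ∀ (V W : {V : X.Opens // V ≤ U}) (h : W.1 ≤ V.1) (m : Γ(M, V.1)), res N h (f V m) = f W (res M h m)}
  add_mem' hf hg V W h m := by simp [hf V W h m, hg V W h m]
  zero_mem' V W h m := by simp
  neg_mem' hf V W h m := by simp [hf V W h m]

instance (M N : X.Modules) (U : X.Opens) : Module Γ(X, U) (localHom M N U) where
  smul r f := ⟨fun V => X.presheaf.map (homOfLE V.2).op r • f.1 V, fun V W h m => by
    simp only [LinearMap.smul_apply, Scheme.Modules.map_smul, f.2 V W h m]
    rw [← ConcreteCategory.comp_apply, ← Functor.map_comp]; rfl⟩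
  one_smul f := by ext V m; exact (congrArg (· • f.1 V m) (map_one _)).trans (one_smul _ _)
  mul_smul r s f := by ext V m; exact (congrArg (· • f.1 V m) (map_mul _ r s)).trans (mul_smul _ _ _)
  smul_zero r := by ext V m; exact smul_zero _
  smul_add r f g := by ext V m; exact smul_add _ _ _
  add_smul r s f := by ext V m; exact (congrArg (· • f.1 V m) (map_add _ r s)).trans (add_smul _ _ _)
  zero_smul f := by ext V m; exact (congrArg (· • f.1 V m) (map_zero _)).trans (zero_smul _ _)

/-- Restriction of morphisms to a smaller open set. -/
def localHomRes (M N : X.Modules) {U V : X.Opens} (h : V ≤ U) : localHom M N U →+ localHom M N V where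
  toFun f := ⟨fun W => f.1 ⟨W.1, W.2.trans h⟩, fun W W' h' m => f.2 ⟨W.1, W.2.trans h⟩ ⟨W'.1, W'.2.trans h⟩ h' m⟩
  map_zero' := rfl
  map_add' _ _ := rfl

/-- The presheaf `U ↦ Hom(M|_U, N|_U)`. -/
def localHomPresheaf (M N : X.Modules) : TopCat.Presheaf Ab.{u} X where
  obj U := AddCommGrpCat.of (localHom M N U.unop)
  map i := AddCommGrpCat.ofHom (localHomRes M N (leOfHom i.unop))
  map_id _ := rfl
  map_comp _ _ := rfl

theorem exists_glue (N : X.Modules) {ι : Type u} (U : ι → X.Opens) (V : X.Opens) (hV : ∀ i, U i ≤ V) (hV' : V ≤ iSup U) (s : ∀ i, Γ(N, U i))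
    (hs : ∀ i j, res N inf_le_left (s i) = res N (inf_le_right : U i ⊓ U j ≤ U j) (s j)) :
    ∃! t : Γ(N, V), ∀ i, res N (hV i) t = s i := by
  obtain rfl : V = iSup U := le_antisymm hV' (iSup_le hV)
  exact (TopCat.Presheaf.isSheaf_iff_isSheafUniqueGluing N.presheaf).1 N.isSheaf U s hs

theorem res_res (M : X.Modules) {U V W : X.Opens} (h : V ≤ U) (h' : W ≤ V) (m : Γ(M, U)) :
    res M h' (res M h m) = res M (h'.trans h) m := by
  rw [← ConcreteCategory.comp_apply, ← Functor.map_comp]; rfl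

theorem localHomPresheaf_isSheaf (M N : X.Modules) : (localHomPresheaf M N).IsSheaf := by
  rw [TopCat.Presheaf.isSheaf_iff_isSheafUniqueGluing]
  intro ι U f hf
  let F (i : ι) : localHom M N (U i) := f i
  have hF (i j : ι) (W : X.Opens) (hi : W ≤ U i) (hj : W ≤ U j) : (F i).1 ⟨W, hi⟩ = (F j).1 ⟨W, hj⟩ :=
    congrArg (fun g : localHom M N (U i ⊓ U j) => g.1 ⟨W, le_inf hi hj⟩) (hf i j)
  have key (V : {V : X.Opens // V ≤ iSup U}) (m : Γ(M, V.1)) : ∃! t : Γ(N, V.1), ∀ i,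
      res N (inf_le_left : V.1 ⊓ U i ≤ V.1) t = (F i).1 ⟨V.1 ⊓ U i, inf_le_right⟩ (res M inf_le_left m) := by
    refine exists_glue N (fun i => V.1 ⊓ U i) V.1 (fun i => inf_le_left) ?_ _ ?_
    · rw [← inf_iSup_eq]; exact le_inf le_rfl V.2
    · intro i j
      rw [(F i).2 ⟨V.1 ⊓ U i, inf_le_right⟩ ⟨(V.1 ⊓ U i) ⊓ (V.1 ⊓ U j), inf_le_left.trans inf_le_right⟩ inf_le_left,
        (F j).2 ⟨V.1 ⊓ U j, inf_le_right⟩ ⟨(V.1 ⊓ U i) ⊓ (V.1 ⊓ U j), inf_le_right.trans inf_le_right⟩ inf_le_right,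
        res_res, res_res, hF i j]
  choose g hg hg' using key
  have uniq (V : {V : X.Opens // V ≤ iSup U}) (t t' : Γ(N, V.1))
      (h : ∀ i, res N (inf_le_left : V.1 ⊓ U i ≤ V.1) t = res N inf_le_left t') : t = t' := by
    refine (exists_glue N (fun i => V.1 ⊓ U i) V.1 (fun i => inf_le_left) ?_ (fun i => res N inf_le_left t') ?_).unique h (fun i => rfl)
    · rw [← inf_iSup_eq]; exact le_inf le_rfl V.2
    · intro i j
      rw [res_res, res_res]
  let G : localHom M N (iSup U) := ⟨fun V =>
    { toFun := g V
      map_add' m m' := uniq _ _ _ fun i => by simp [hg]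
      map_smul' c m := uniq _ _ _ fun i => by
        rw [hg, RingHom.id_apply, Scheme.Modules.map_smul, Scheme.Modules.map_smul, hg, map_smul] }, fun V W h m => 
      uniq _ _ _ fun i => by
        have h1 : W.1 ⊓ U i ≤ V.1 ⊓ U i := inf_le_inf_right _ h
        change _ = res N _ (g W _)
        rw [hg, res_res, res_res, ← res_res N inf_le_left h1]
        change res N h1 (res N _ (g V m)) = _
        rw [hg, (F i).2 ⟨V.1 ⊓ U i, inf_le_right⟩ ⟨W.1 ⊓ U i, inf_le_right⟩ h1, res_res]⟩
  refine ⟨G, fun i => ?_, fun G' hG' => ?_⟩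
  · refine Subtype.ext (funext fun V => LinearMap.ext fun m => ?_)
    change g ⟨V.1, V.2.trans (le_iSup U i)⟩ m = (F i).1 V m
    refine uniq ⟨V.1, V.2.trans (le_iSup U i)⟩ _ _ fun j => ?_
    rw [hg, (F i).2 V ⟨V.1 ⊓ U j, inf_le_left.trans V.2⟩ inf_le_left, hF j i]
  · refine Subtype.ext (funext fun V => LinearMap.ext fun m => ?_)
    refine hg' V m _ fun i => ?_
    have h1 : (F i) = localHomRes M N (le_iSup U i) G' := (hG' i).symm
    rw [h1]
    exact G'.2 V ⟨V.1 ⊓ U i, inf_le_left.trans V.2⟩ inf_le_left m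

theorem localHom_smul_apply {M N : X.Modules} {U : X.Opens} (r : Γ(X, U)) (f : localHom M N U)
    (V : {V : X.Opens // V ≤ U}) (m : Γ(M, V.1)) :
    (r • f).1 V m = X.presheaf.map (homOfLE V.2).op r • f.1 V m := rfl

theorem localHomRes_smul (M N : X.Modules) {U V : X.Opens} (h : V ≤ U) (r : Γ(X, U)) (f : localHom M N U) :
    localHomRes M N h (r • f) = X.presheaf.map (homOfLE h).op r • localHomRes M N h f := by
  refine Subtype.ext (funext fun W => LinearMap.ext fun m => ?_)
  rw [localHom_smul_apply, ← ConcreteCategory.comp_apply, ← Functor.map_comp]; rfl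

/-- The internal hom sheaf `𝓗om(M, N)`, with sections `Hom(M|_U, N|_U)` over `U`. -/
def sheafHom (M N : X.Modules) : X.Modules where
  val := 
    letI (U : X.Opensᵒᵖ) : Module (X.ringCatSheaf.obj.obj U) ((localHomPresheaf M N).obj U) := 
      inferInstanceAs (Module Γ(X, U.unop) (localHom M N U.unop))
    PresheafOfModules.ofPresheaf (localHomPresheaf M N) (fun U V i r f => localHomRes_smul M N (leOfHom i.unop) r f)
  isSheaf := localHomPresheaf_isSheaf M N

/-- Sections of `𝓗om(M, N)` over `U` are the morphisms `M|_U ⟶ N|_U`. -/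
def toLocalHom {M N : X.Modules} {U : X.Opens} : Γ(sheafHom M N, U) ≃ₗ[Γ(X, U)] localHom M N U where
  toFun f := f
  invFun f := f
  map_add' _ _ := rfl
  map_smul' _ _ := rfl
  left_inv _ := rfl
  right_inv _ := rfl

/-- The evaluation pairing `𝓗om(M, N) × M → N`. -/
def evalHom (M N : X.Modules) : BilinHom (sheafHom M N) M N where
  app U := LinearMap.mk₂ _ (fun f m => (toLocalHom f).1 ⟨U, le_rfl⟩ m) (fun f g m => rfl) 
   (fun r f m => congrArg (· • (toLocalHom f).1 ⟨U, le_rfl⟩ m) (by 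
      exact ConcreteCategory.congr_hom (X.presheaf.map_id (op U)) r)) (fun f m m' => map_add _ _ _)
   (fun r f m => map_smul ((toLocalHom f).1 _) _ _)
  naturality {U V} i f m := (toLocalHom f).2 ⟨U, le_rfl⟩ ⟨V, leOfHom i⟩ (leOfHom i) m

variable (X) in
/-- The sheaf `𝒪_X` as a module over itself. -/
def structureSheaf : X.Modules := SheafOfModules.unit X.ringCatSheaf

/-- The dual `M^* = 𝓗om(M, 𝒪_X)`. -/
def dual (M : X.Modules) : X.Modules := sheafHom M (structureSheaf X)

/-- Functoriality of `𝓗om(M, -)`. -/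
def sheafHomMap (M : X.Modules) {N N' : X.Modules} (g : N ⟶ N') : sheafHom M N ⟶ sheafHom M N' :=
  homMk (fun U => 
   { toFun f := toLocalHom.symm ⟨fun V => (appₗ g V.1).comp ((toLocalHom f).1 V), fun V W h m => by
      have := (toLocalHom f).2 V W h m
      simp only [LinearMap.comp_apply, appₗ_apply, ← app_map, this]⟩ 
     map_add' f f' := Subtype.ext (funext fun V => LinearMap.ext fun m => by exact map_add (appₗ g V.1) _ _)
     map_smul' r f := Subtype.ext (funext fun V => LinearMap.ext fun m => by exact map_smul (appₗ g V.1) _ _) })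
   (fun {U V} i m => rfl)

/-- The functor `𝓗om(M, -)`. -/
def sheafHomFunctor (M : X.Modules) : X.Modules ⥤ X.Modules where
  obj N := sheafHom M N
  map g := sheafHomMap M g
  map_id N := rfl
  map_comp f g := rfl

instance (M : X.Modules) : (sheafHomFunctor M).Additive where
  map_add {N N'} f g := rfl


/-- A bilinear map with its arguments exchanged. -/
def BilinHom.flip {M N P : X.Modules} (b : BilinHom M N P) : BilinHom N M P where
  app U := (b.app U).flip
  naturality i m n := b.naturality i n m

/-- The value of an `𝒪_X`-valued pairing, as a function on `U`. -/
def BilinHom.pair {A B : X.Modules} (b : BilinHom A B (structureSheaf X)) (U : X.Opens) :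
    Γ(A, U) →ₗ[Γ(X, U)] Γ(B, U) →ₗ[Γ(X, U)] Γ(X, U) :=
  b.app U

theorem BilinHom.pair_naturality {A B : X.Modules} (b : BilinHom A B (structureSheaf X))
    {U V : X.Opens} (i : V ⟶ U) (a : Γ(A, U)) (x : Γ(B, U)) :
    X.presheaf.map i.op (b.pair U a x) =
      b.pair V (A.presheaf.map i.op a) (B.presheaf.map i.op x) :=
  b.naturality i a x

/-- A pairing `b : A × B → 𝒪_X` induces `A ⊗ K ⟶ 𝓗om(B, K)`, `a ⊗ k ↦ (x ↦ b(a, x) k)`. -/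
def BilinHom.contract {A B : X.Modules} (b : BilinHom A B (structureSheaf X)) (K : X.Modules) :
    tensor A K ⟶ sheafHom B K :=
  tensorDesc
   { app U := LinearMap.mk₂ _
       (fun a k => toLocalHom.symm ⟨fun V =>
          (b.pair V.1 (res A V.2 a)).smulRight (res K V.2 k), fun V W h x => by
           rw [LinearMap.smulRight_apply, LinearMap.smulRight_apply, Scheme.Modules.map_smul,
             b.pair_naturality, res_res, res_res]⟩)
       (fun a a' k => Subtype.ext (funext fun V => LinearMap.ext fun x => by
         change b.pair V.1 (res A V.2 (a + a')) x • res K V.2 k =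
           b.pair V.1 (res A V.2 a) x • res K V.2 k + b.pair V.1 (res A V.2 a') x • res K V.2 k
         rw [map_add, map_add, LinearMap.add_apply, add_smul]))
       (fun r a k => Subtype.ext (funext fun V => LinearMap.ext fun x => by
         change b.pair V.1 (res A V.2 (r • a)) x • res K V.2 k =
           X.presheaf.map (homOfLE V.2).op r • (b.pair V.1 (res A V.2 a) x • res K V.2 k)
         rw [Scheme.Modules.map_smul, map_smul, LinearMap.smul_apply, smul_eq_mul, mul_smul]))
       (fun a k k' => Subtype.ext (funext fun V => LinearMap.ext fun x => by
         change b.pair V.1 (res A V.2 a) x • res K V.2 (k + k') =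
           b.pair V.1 (res A V.2 a) x • res K V.2 k + b.pair V.1 (res A V.2 a) x • res K V.2 k'
         rw [map_add, smul_add]))
       (fun r a k => Subtype.ext (funext fun V => LinearMap.ext fun x => by
         change b.pair V.1 (res A V.2 a) x • res K V.2 (r • k) =
           X.presheaf.map (homOfLE V.2).op r • (b.pair V.1 (res A V.2 a) x • res K V.2 k)
         rw [Scheme.Modules.map_smul, smul_comm]))
     naturality {U V} i a k := Subtype.ext (funext fun W => LinearMap.ext fun x => by
       change b.pair W.1 (res A (W.2.trans (leOfHom i)) a) x • res K (W.2.trans (leOfHom i)) k =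
         b.pair W.1 (res A W.2 (res A (leOfHom i) a)) x • res K W.2 (res K (leOfHom i) k)
       rw [res_res, res_res]) }

/-- `ψ : E^* ⟶ E^* ⊗ K` is the transpose `φ^*` of `φ : E ⟶ E ⊗ K`: for local sections `e` of `E` and `l`
of `E^*`, contracting `φ(e)` with `l` and contracting `ψ(l)` with `e` gives the same section of `K`. -/
def IsTranspose {E K : X.Modules} (φ : E ⟶ tensor E K) (ψ : dual E ⟶ tensor (dual E) K) : Prop :=
  ∀ (U : X.Opens) (e : Γ(E, U)) (l : Γ(dual E, U)),
    (evalHom (dual E) K).app U (((evalHom E (structureSheaf X)).flip.contract K).app U (φ.app U e)) l =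
    (evalHom E K).app U (((evalHom E (structureSheaf X)).contract K).app U (ψ.app U l)) e

section
universe v w
variable {C : Type v} [Category.{w} C] {R : Cᵒᵖ ⥤ CommRingCat.{u}}
  (M : PresheafOfModules.{u} (R ⋙ forget₂ CommRingCat RingCat)) (n : ℕ)

/-- The map of `n`-th exterior powers over a restriction map of a presheaf of modules. -/
def extMap {U V : Cᵒᵖ} (i : U ⟶ V) : (ModuleCat.of (R.obj U) (M.obj U)).exteriorPower n ⟶
    (ModuleCat.restrictScalars (R.map i).hom).obj ((ModuleCat.of (R.obj V) (M.obj V)).exteriorPower n) :=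
  ModuleCat.exteriorPower.desc
   (N := (ModuleCat.restrictScalars (R.map i).hom).obj ((ModuleCat.of (R.obj V) (M.obj V)).exteriorPower n))
   ({ toFun m := exteriorPower.ιMulti (R.obj V) n (M := M.obj V) (fun k => M.map i (m k))
      map_update_add' {inst} m k x y := by
        obtain rfl : inst = instDecidableEqFin n := Subsingleton.elim _ _
        have h (z : M.obj U) : (fun j => M.map i (Function.update m k z j)) = Function.update (fun j => M.map i (m j)) k (M.map i z) := by
          ext j; by_cases hj : j = k
          · subst hj; simp
          · simp [hj]
        rw [h, h, h, map_add]
        exact (exteriorPower.ιMulti (R.obj V) n (M := M.obj V)).map_update_add _ _ _ _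
      map_update_smul' {inst} m k c x := by
        obtain rfl : inst = instDecidableEqFin n := Subsingleton.elim _ _
        have h (z : M.obj U) : (fun j => M.map i (Function.update m k z j)) = Function.update (fun j => M.map i (m j)) k (M.map i z) := by
          ext j; by_cases hj : j = k
          · subst hj; simp
          · simp [hj]
        rw [h, h]
        refine (congrArg (fun z => exteriorPower.ιMulti (R.obj V) n (M := M.obj V) (Function.update _ k z)) (M.map_smul i c x)).trans ?_
        exact (exteriorPower.ιMulti (R.obj V) n (M := M.obj V)).map_update_smul _ _ _ _
      map_eq_zero_of_eq' m j k h hjk :=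
        (exteriorPower.ιMulti (R.obj V) n (M := M.obj V)).map_eq_zero_of_eq _ (congrArg (M.map i) h) hjk } : 
      (M.obj U) [⋀^(Fin n)]→ₗ[R.obj U] ((ModuleCat.restrictScalars (R.map i).hom).obj ((ModuleCat.of (R.obj V) (M.obj V)).exteriorPower n)))

theorem extMap_mk {U V : Cᵒᵖ} (i : U ⟶ V) (m : Fin n → M.obj U) : 
   extMap M n i (exteriorPower.ιMulti (R.obj U) n m) = exteriorPower.ιMulti (R.obj V) n (M := M.obj V) (fun k => M.map i (m k)) := 
  exteriorPower.alternatingMapLinearEquiv_apply_ιMulti _ _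

/-- The exterior power `U ↦ ⋀ⁿ M(U)` of a presheaf of modules. -/
def extPower : PresheafOfModules.{u} (R ⋙ forget₂ CommRingCat RingCat) where
  obj U := (ModuleCat.of (R.obj U) (M.obj U)).exteriorPower n
  map i := extMap M n i
  map_id U := by
    refine ModuleCat.exteriorPower.hom_ext (ModuleCat.AlternatingMap.ext fun m => (extMap_mk M n _ m).trans ?_)
    refine congrArg (exteriorPower.ιMulti (R.obj U) n) (funext fun k => ?_)
    exact congr($(M.map_id U) (m k))
  map_comp {U V W} i j := by
    refine ModuleCat.exteriorPower.hom_ext (ModuleCat.AlternatingMap.ext fun m => (extMap_mk M n _ m).trans ?_)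
    refine .trans ?_ (((congrArg (extMap M n j) (extMap_mk M n i m))).trans (extMap_mk M n j _)).symm
    refine congrArg (exteriorPower.ιMulti (R.obj W) n) (funext fun k => ?_)
    exact M.map_comp_apply i j (m k)
end
section
variable {A : CommRingCat.{u}} (f : X ⟶ Spec A)

/-- The `A`-algebra structure of `𝒪_X` for a scheme `X` over `A`. -/
def constToPresheaf : (Functor.const X.Opensᵒᵖ).obj A ⟶ X.presheaf where
  app U := (Scheme.ΓSpecIso A).inv ≫ f.appTop ≫ X.presheaf.map (homOfLE le_top).op
  naturality U V i := by
    simp only [Functor.const_obj_map, Category.assoc, ← Functor.map_comp]; rfl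

/-- The presheaf of Kähler differentials `U ↦ Ω_{𝒪(U)/A}`. -/
def differentials : X.PresheafOfModules := PresheafOfModules.DifferentialsConstruction.relativeDifferentials' (constToPresheaf f)

/-- The sheaf `Ωⁿ_{X/A}` of differential `n`-forms, i.e. the sheaf associated with
`U ↦ ⋀ⁿ Ω_{𝒪(U)/A}`; for `X` smooth of relative dimension `n` this is the canonical bundle. -/
def canonicalSheaf (n : ℕ) : X.Modules := (sheafification X).obj (extPower (R := X.presheaf) (differentials f) n)
end

attribute [local instance] MvPolynomial.gradedAlgebra in
/-- Projective space `ℙⁿ_A = Proj A[x_0, …, x_n]`. -/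
def projectiveSpace (n : ℕ) (A : CommRingCat.{u}) : Scheme.{u} :=
  Proj (MvPolynomial.homogeneousSubmodule (Fin (n + 1)) A)

attribute [local instance] MvPolynomial.gradedAlgebra in
/-- The structure map `ℙⁿ_A ⟶ Spec A`. -/
def projectiveSpaceToSpec (n : ℕ) (A : CommRingCat.{u}) : projectiveSpace n A ⟶ Spec A :=
  Proj.toSpecZero (MvPolynomial.homogeneousSubmodule (Fin (n + 1)) A) ≫ Spec.map (CommRingCat.ofHom (algebraMap A (MvPolynomial.homogeneousSubmodule (Fin (n + 1)) A 0)))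

/-- `X` is projective over `A`: a closed subscheme of some `ℙⁿ_A`. -/
def IsProjective {A : CommRingCat.{u}} (f : X ⟶ Spec A) : Prop :=
  ∃ (n : ℕ) (i : X ⟶ projectiveSpace n A), IsClosedImmersion i ∧ i ≫ projectiveSpaceToSpec n A = f

section
variable {S : Scheme.{u}} (L : S.Modules) (π : X ⟶ S) (τ : Γ((Scheme.Modules.pullback π).obj L, ⊤))

/-- `π : X ⟶ S` with `τ ∈ Γ(X, π^* L)` is the total space `Tot(L)` of the line bundle `L` with its
tautological section: morphisms `g : T ⟶ X` correspond, via `g ↦ (π ∘ g, g^* τ)`, to pairs of a morphism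
`f : T ⟶ S` and a global section of `f^* L`. -/
def IsTotalSpace : Prop := ∀ T : Scheme.{u}, Function.Bijective (fun g : T ⟶ X => 
  (⟨g ≫ π, ((Scheme.Modules.pullbackComp g π).hom.app L).app ⊤ (pullbackSection g τ)⟩ : 
    Σ f : T ⟶ S, Γ((Scheme.Modules.pullback f).obj L, ⊤)))

variable {L}
/-- `F` on `X`, with `e : π_* F ≅ E`, is the spectral sheaf of `(E, φ)`: under `e`, the map
`π_* (τ · id) : π_* F ⟶ π_* (F ⊗ π^* L)` is `φ` (followed by the projection formula
`π_* F ⊗ L ⟶ π_* (F ⊗ π^* L)`). -/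
def IsSpectral {E : S.Modules} (φ : E ⟶ tensor E L) {F : X.Modules} (e : (Scheme.Modules.pushforward π).obj F ≅ E) : Prop :=
  (Scheme.Modules.pushforward π).map (tensorSection F τ) = e.hom ≫ φ ≫ tensorMap e.inv (𝟙 L) ≫ projectionMap π F L

/-- The pullback `π^* φ : π^* E ⟶ π^* E ⊗ π^* L` of `φ : E ⟶ E ⊗ L`. -/
def pullbackHiggs {E : S.Modules} (φ : E ⟶ tensor E L) : (Scheme.Modules.pullback π).obj E ⟶ tensor ((Scheme.Modules.pullback π).obj E) ((Scheme.Modules.pullback π).obj L) :=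
  (Scheme.Modules.pullback π).map φ ≫ pullbackTensor π E L 
end

/-- The map `π^* φ - τ · id : π^* E ⟶ π^* E ⊗ π^* L`. -/
def higgsDiff {S : Scheme.{u}} {L : S.Modules} (π : X ⟶ S) (τ : Γ((Scheme.Modules.pullback π).obj L, ⊤)) {E : S.Modules}
    (φ : E ⟶ tensor E L) : (Scheme.Modules.pullback π).obj E ⟶ tensor ((Scheme.Modules.pullback π).obj E) ((Scheme.Modules.pullback π).obj L) :=
  pullbackHiggs π φ - tensorSection ((Scheme.Modules.pullback π).obj E) τ

section 
universe w
variable [HasDerivedCategory.{w} X.Modules]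
/-- `R𝓗om(F, G)`: the value at `G` of the total right derived functor of `𝓗om(F, -)`. -/
def sheafRHom (F G : X.Modules) : DerivedCategory.Plus X.Modules :=
  (sheafHomFunctor F).rightDerivedFunctorPlus.obj ((DerivedCategory.Plus.singleFunctor X.Modules 0).obj G)
/-- `𝓔xtⁿ(F, G)`, the `n`-th cohomology sheaf of `R𝓗om(F, G)`. -/
def sheafExt (n : ℤ) (F G : X.Modules) : X.Modules :=
  (DerivedCategory.Plus.homologyFunctor X.Modules n).obj (sheafRHom F G)
end
end
end Higgs

/-! ### Local criteria for isomorphisms, epimorphisms and exactness of sheaves of modules -/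

namespace Higgs
noncomputable section
variable {X : Scheme.{u}}

/-! Near a point of `S` choose an affine open `U`, a basis of `E` and a generator `k` of `K_S`, and
write `φ` as a matrix `A` over `R = Γ(S, U)`. The universal property of the total space makes `π⁻¹U`
the spectrum of `R[t]`, with `τ = t k` (`IsTotalSpace.isAffineOpen_preimage`). The sections of the
spectral sheaf `F` over `π⁻¹U` are `Rⁿ` with `t` acting through `A`, so all their relations over
`R[t]` are generated by the rows of `P = A - t` (`exists_transpose_mulVec_of_sum_smul_eq_zero`). Up
to sign `det P` is the characteristic polynomial of `A`; it is monic, hence a nonzerodivisor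
(`det_sub_mul_eq_zero`).

Dualizing, every `𝒪_X`-module `N` sits in an exact sequence `0 → 𝓗om(F, N) → π^*E^* ⊗ N → (π^*E^* ⊗
π^*K_S) ⊗ N`, natural in `N`, whose last map is `(π^*φ^* - τ) ⊗ N`. Both tensor functors are exact
because `E^*` and `K_S` are locally free. If `N` is injective, the last map is an epimorphism: `det
P` acts surjectively on sections of `N` (`exists_smul_eq_of_injective`), and the adjugate of `P`
does the rest. If `N` is the line bundle `G = π^*K_S^{-1}`, the last map is a monomorphism, since
`det P` is regular on `G`.

Applying the sequence to an injective resolution of `G` gives a short exact sequence of complexes,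
and its long exact sequence leaves only `H¹ R𝓗om(F, G)`, equal to the cokernel of the last map at `N
= G` (`homology_of_resolution`). As tensoring with `G` is exact, this is `coker(π^*φ^* - τ) ⊗ G`; a
complex with a single cohomology sheaf is a shift of that sheaf. The transpose exists and is unique
because `E^* ⊗ K_S → 𝓗om(E, K_S)` is an isomorphism.

Sheaf theory is done with sections over small open sets instead of stalks. A section over `U` is a
morphism from `j_! 𝒪_U`, and a morphism defined only over `V` is a global morphism into `j_* j^* N`
(`openPush`), so that categorical facts about modules on all of `X` apply to both. -/

theorem res_self (M : X.Modules) {U : X.Opens} (h : U ≤ U) (m : Γ(M, U)) : res M h m = m :=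
  ConcreteCategory.congr_hom (M.presheaf.map_id (op U)) m

theorem app_res {M N : X.Modules} (f : M ⟶ N) {U V : X.Opens} (h : V ≤ U) (m : Γ(M, U)) :
    f.app V (res M h m) = res N h (f.app U m) :=
  app_map f (homOfLE h) m

/-- Restriction of functions. -/
abbrev ores {U V : X.Opens} (h : V ≤ U) : Γ(X, U) →+* Γ(X, V) := (X.presheaf.map (homOfLE h).op).hom

theorem res_smul (M : X.Modules) {U V : X.Opens} (h : V ≤ U) (r : Γ(X, U)) (m : Γ(M, U)) :
    res M h (r • m) = ores h r • res M h m :=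
  Scheme.Modules.map_smul ..

theorem ores_ores {U V W : X.Opens} (h : V ≤ U) (h' : W ≤ V) (r : Γ(X, U)) :
    ores h' (ores h r) = ores (h'.trans h) r := by
  change (X.presheaf.map _ ≫ X.presheaf.map _).hom r = _
  rw [← Functor.map_comp]; rfl

theorem ores_self {U : X.Opens} (h : U ≤ U) (r : Γ(X, U)) : ores h r = r :=
  ConcreteCategory.congr_hom (X.presheaf.map_id (op U)) r

/-- Two sections that agree locally are equal. -/
theorem section_ext (N : X.Modules) {U : X.Opens} (x y : Γ(N, U))
    (h : ∀ p ∈ U, ∃ (V : X.Opens) (hV : V ≤ U), p ∈ V ∧ res N hV x = res N hV y) : x = y := by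
  choose V hV hp hxy using fun p : U => h p.1 p.2
  refine (exists_glue N V U hV ?_ (fun i => res N (hV i) y) ?_).unique hxy (fun i => rfl)
  · exact fun p hp' => TopologicalSpace.Opens.mem_iSup.2 ⟨⟨p, hp'⟩, hp _⟩
  · intro i j; rw [res_res, res_res]

/-- Sections that exist locally and are locally uniquely determined glue. -/
theorem section_glue (N : X.Modules) {U : X.Opens} (P : ∀ V : X.Opens, V ≤ U → Γ(N, V) → Prop)
    (hP : ∀ V hV W (h : W ≤ V) x, P V hV x → P W (h.trans hV) (res N h x))
    (hu : ∀ V hV x y, P V hV x → P V hV y → x = y)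
    (he : ∀ p ∈ U, ∃ (V : X.Opens) (hV : V ≤ U), p ∈ V ∧ ∃ x, P V hV x) :
    ∃ t : Γ(N, U), ∀ p ∈ U, ∃ (V : X.Opens) (hV : V ≤ U), p ∈ V ∧ P V hV (res N hV t) := by
  choose V hV hp x hx using fun p : U => he p.1 p.2
  obtain ⟨t, ht, -⟩ := exists_glue N V U hV (fun p hp' => TopologicalSpace.Opens.mem_iSup.2 ⟨⟨p, hp'⟩, hp _⟩) x
    (fun i j => hu _ (inf_le_left.trans (hV i)) _ _ (hP _ _ _ _ _ (hx i)) (hP _ _ _ _ _ (hx j)))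
  exact ⟨t, fun p hp' => ⟨V ⟨p, hp'⟩, hV _, hp _, by rw [ht]; exact hx _⟩⟩

/-- Injectivity over the smaller open sets makes local preimages unique, so they agree on overlaps
and glue. -/
theorem exists_preimage_of_locally {M N : X.Modules} (f : M ⟶ N) {U : X.Opens}
    (hf : ∀ V ≤ U, Function.Injective (f.app V)) (y : Γ(N, U))
    (h : ∀ p ∈ U, ∃ (V : X.Opens) (hV : V ≤ U), p ∈ V ∧ ∃ x, f.app V x = res N hV y) :
    ∃ x, f.app U x = y := by
  obtain ⟨t, ht⟩ := section_glue M (U := U) (fun V hV x => f.app V x = res N hV y)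
    (fun V hV W h x hx => by rw [app_res, hx, res_res]) (fun V hV x y hx hy => hf V hV (hx.trans hy.symm)) h
  refine ⟨t, section_ext _ _ _ fun p hp => ?_⟩
  obtain ⟨V, hV, hpV, h1⟩ := ht p hp
  exact ⟨V, hV, hpV, by rw [← h1, app_res]⟩

theorem isIso_of_bijective {M N : X.Modules} (f : M ⟶ N) (h : ∀ U, Function.Bijective (f.app U)) : IsIso f := by
  rw [Scheme.Modules.Hom.isIso_iff_isIso_app]
  intro U
  rw [ConcreteCategory.isIso_iff_bijective]
  exact h U

/-- A morphism that is locally bijective on sections is an isomorphism. -/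
theorem isIso_of_locally {M N : X.Modules} (f : M ⟶ N)
    (h : ∀ p : X, ∃ U : X.Opens, p ∈ U ∧ ∀ V ≤ U, Function.Bijective (f.app V)) : IsIso f := by
  have inj (U : X.Opens) : Function.Injective (f.app U) := by
    intro x y hxy
    refine section_ext _ _ _ fun p hp => ?_
    obtain ⟨V, hpV, hV⟩ := h p
    refine ⟨U ⊓ V, inf_le_left, ⟨hp, hpV⟩, (hV _ inf_le_right).1 ?_⟩
    rw [app_res, app_res, hxy]
  refine isIso_of_bijective f fun U => ⟨inj U, fun y => ?_⟩
  refine exists_preimage_of_locally f (fun V _ => inj V) y fun p hp => ?_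
  obtain ⟨V, hpV, hV⟩ := h p
  exact ⟨U ⊓ V, inf_le_left, ⟨hp, hpV⟩, (hV _ inf_le_right).2 _⟩

/-- Together with local injectivity of the unit, this replaces the comparison of stalks of a
presheaf and its sheafification. -/
theorem sheafification_unit_locally_surjective (P : X.PresheafOfModules) {U : X.Opens} (y : Γ((sheafification X).obj P, U))
    (p : X) (hp : p ∈ U) : ∃ (V : X.Opens) (hV : V ≤ U), p ∈ V ∧
      ∃ x : P.obj (op V), ((sheafificationAdj X).unit.app P).app (op V) x = res _ hV y := by
  have h := Presheaf.isLocallySurjective_toSheafify' (Opens.grothendieckTopology X) P.presheaf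
  obtain ⟨V, i, ⟨x, hx⟩, hp⟩ := h.imageSieve_mem y p hp
  exact ⟨V, leOfHom i, hp, x, hx⟩

theorem sheafification_unit_locally_injective (P : X.PresheafOfModules) {U : X.Opens} (x : P.obj (op U))
    (hx : ((sheafificationAdj X).unit.app P).app (op U) x = 0)
    (p : X) (hp : p ∈ U) : ∃ (V : X.Opens) (hV : V ≤ U), p ∈ V ∧ P.map (homOfLE hV).op x = 0 := by
  have h := Presheaf.isLocallyInjective_toSheafify' (Opens.grothendieckTopology X) P.presheaf
  obtain ⟨V, i, hi, hp⟩ := h.equalizerSieve_mem (X := op U) x 0 (hx.trans (map_zero (((sheafificationAdj X).unit.app P).app (op U)).hom).symm) p hp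
  exact ⟨V, leOfHom i, hp, hi.trans (map_zero (P.map i.op).hom)⟩

/-- The map from `N` to the sheafified presheaf cokernel vanishes because `f` is epi. So the class
of `y` in the presheaf cokernel dies locally, and that cokernel is computed sectionwise. -/
theorem locally_surjective_of_epi {M N : X.Modules} (f : M ⟶ N) [Epi f] {U : X.Opens} (y : Γ(N, U))
    (p : X) (hp : p ∈ U) : ∃ (V : X.Opens) (hV : V ≤ U), p ∈ V ∧ ∃ x, f.app V x = res N hV y := by
  let C := cokernel f.val
  let g : N ⟶ (sheafification X).obj C := ⟨cokernel.π f.val ≫ (sheafificationAdj X).unit.app C⟩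
  have hg : g = 0 := by
    rw [← cancel_epi f, comp_zero]
    apply SheafOfModules.hom_ext
    change f.val ≫ cokernel.π f.val ≫ (sheafificationAdj X).unit.app C = 0
    rw [cokernel.condition_assoc, zero_comp]
  have hy : ((sheafificationAdj X).unit.app C).app (op U) ((cokernel.π f.val).app (op U) y) = 0 :=
    congrArg (fun h : N ⟶ (sheafification X).obj C => h.app U y) hg
  obtain ⟨V, hV, hp, h⟩ := sheafification_unit_locally_injective C _ hy p hp
  refine ⟨V, hV, hp, ?_⟩
  have h' : (cokernel.π f.val).app (op V) (res N hV y) = 0 :=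
    (PresheafOfModules.naturality_apply (cokernel.π f.val) (homOfLE hV).op y).trans h
  have ex : (ShortComplex.mk _ _ (cokernel.condition f.val)).Exact :=
    ShortComplex.exact_of_g_is_cokernel _ (cokernelIsCokernel f.val)
  have ex' := ex.map (PresheafOfModules.evaluation _ (op V))
  exact (ShortComplex.moduleCat_exact_iff _).1 ex' _ h'

theorem epi_of_locally_surjective {M N : X.Modules} (f : M ⟶ N)
    (h : ∀ (U : X.Opens) (y : Γ(N, U)), ∀ p ∈ U, ∃ (V : X.Opens) (hV : V ≤ U), p ∈ V ∧ ∃ x, f.app V x = res N hV y) :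
    Epi f where
  left_cancellation {P} g g' e := by
    ext U y
    refine section_ext _ _ _ fun p hp => ?_
    obtain ⟨V, hV, hp, x, hx⟩ := h U y p hp
    refine ⟨V, hV, hp, ?_⟩
    rw [← app_res, ← app_res, ← hx]
    exact congrArg (fun h : M ⟶ P => h.app V x) e

/-- The sheaf `j_! 𝒪_U`. -/
def extByZero (U : X.Opens) : X.Modules :=
  (sheafification X).obj ((PresheafOfModules.free _).obj (yoneda.obj U))

/-- `Hom(j_! 𝒪_U, M) = M(U)`. -/
def extByZeroEquiv (U : X.Opens) (M : X.Modules) : (extByZero U ⟶ M) ≃ Γ(M, U) :=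
  ((sheafificationAdj X).homEquiv _ _).trans PresheafOfModules.freeYonedaEquiv

theorem extByZeroEquiv_comp {U : X.Opens} {M N : X.Modules} (m : extByZero U ⟶ M) (f : M ⟶ N) :
    extByZeroEquiv U N (m ≫ f) = f.app U (extByZeroEquiv U M m) := by
  exact congrArg PresheafOfModules.freeYonedaEquiv ((sheafificationAdj X).homEquiv_naturality_right m f)

/-- Sections over `U` are morphisms out of `j_! 𝒪_U`, naturally in the sheaf, and a monomorphism can
be cancelled there. -/
theorem injective_of_mono {M N : X.Modules} (f : M ⟶ N) [Mono f] (U : X.Opens) : Function.Injective (f.app U) := by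
  intro x y h
  obtain ⟨x, rfl⟩ := (extByZeroEquiv U M).surjective x
  obtain ⟨y, rfl⟩ := (extByZeroEquiv U M).surjective y
  rw [← extByZeroEquiv_comp, ← extByZeroEquiv_comp] at h
  rw [(cancel_mono f).1 ((extByZeroEquiv U N).injective h)]

theorem mono_of_injective {M N : X.Modules} (f : M ⟶ N) (h : ∀ U, Function.Injective (f.app U)) : Mono f where
  right_cancellation g g' e := by
    ext U y
    exact h U (congrArg (fun h => Scheme.Modules.Hom.app h U y) e)

/-- Viewed as a morphism from `j_! 𝒪_U`, the section factors through the kernel. -/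
theorem exists_kernel_section {M N : X.Modules} (f : M ⟶ N) {U : X.Opens} (x : Γ(M, U)) (hx : f.app U x = 0) :
    ∃ y, (kernel.ι f).app U y = x := by
  obtain ⟨x, rfl⟩ := (extByZeroEquiv U M).surjective x
  rw [← extByZeroEquiv_comp] at hx
  have h : x ≫ f = 0 := (extByZeroEquiv U N).injective (hx.trans (by
    have := extByZeroEquiv_comp (0 : extByZero U ⟶ M) (0 : M ⟶ N)
    rw [comp_zero] at this
    rw [this]; rfl))
  exact ⟨extByZeroEquiv U _ (kernel.lift f x h), by rw [← extByZeroEquiv_comp, kernel.lift_ι]⟩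

theorem kernel_ι_app {M N : X.Modules} (f : M ⟶ N) {U : X.Opens} (y : Γ(kernel f, U)) :
    f.app U ((kernel.ι f).app U y) = 0 :=
  congrArg (fun h => Scheme.Modules.Hom.app h U y) (kernel.condition f)

/-- A sequence of sheaves is exact if sections of the kernel lift locally. -/
theorem exact_of_locally (S : ShortComplex X.Modules)
    (h : ∀ (U : X.Opens) (y : Γ(S.X₂, U)), S.g.app U y = 0 →
      ∀ p ∈ U, ∃ (V : X.Opens) (hV : V ≤ U), p ∈ V ∧ ∃ x, S.f.app V x = res S.X₂ hV y) : S.Exact := by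
  rw [S.exact_iff_epi_kernel_lift]
  apply epi_of_locally_surjective
  intro U y p hp
  obtain ⟨V, hV, hp, x, hx⟩ := h U ((kernel.ι S.g).app U y) (kernel_ι_app _ _) p hp
  refine ⟨V, hV, hp, x, injective_of_mono (kernel.ι S.g) V ?_⟩
  rw [app_res, ← hx]
  exact congrArg (fun h => Scheme.Modules.Hom.app h V x) (kernel.lift_ι S.g S.f S.zero)

theorem locally_of_exact {S : ShortComplex X.Modules} (hS : S.Exact) {U : X.Opens} (y : Γ(S.X₂, U)) (hy : S.g.app U y = 0)
    (p : X) (hp : p ∈ U) : ∃ (V : X.Opens) (hV : V ≤ U), p ∈ V ∧ ∃ x, S.f.app V x = res S.X₂ hV y := by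
  have := S.exact_iff_epi_kernel_lift.1 hS
  obtain ⟨y, rfl⟩ := exists_kernel_section _ _ hy
  obtain ⟨V, hV, hp, x, hx⟩ := locally_surjective_of_epi (kernel.lift S.g S.f S.zero) y p hp
  refine ⟨V, hV, hp, x, ?_⟩
  rw [← app_res, ← hx]
  exact congrArg (fun h => Scheme.Modules.Hom.app h V x) (kernel.lift_ι S.g S.f S.zero).symm

end
end Higgs
-- Morphisms over an open set and local bases
namespace Higgs
noncomputable section
variable {X : Scheme.{u}}

theorem localHom_apply_res {M N : X.Modules} {U : X.Opens} (f : localHom M N U) {V W : X.Opens} (hV : V ≤ U) (h : W ≤ V) (m : Γ(M, V)) :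
    f.1 ⟨W, h.trans hV⟩ (res M h m) = res N h (f.1 ⟨V, hV⟩ m) :=
  (f.2 ⟨V, hV⟩ ⟨W, h.trans hV⟩ h m).symm

theorem localHom_ext {M N : X.Modules} {U : X.Opens} {f g : localHom M N U}
    (h : ∀ V (hV : V ≤ U) m, f.1 ⟨V, hV⟩ m = g.1 ⟨V, hV⟩ m) : f = g :=
  Subtype.ext (funext fun V => LinearMap.ext fun m => h V.1 V.2 m)

/-- The presheaf `U ↦ N(U ∩ V)`. -/
def openPushPresheaf (N : X.Modules) (V : X.Opens) : TopCat.Presheaf Ab.{u} X where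
  obj U := Γ(N, U.unop ⊓ V)
  map i := res N (inf_le_inf_right V (leOfHom i.unop))
  map_id U := N.presheaf.map_id _
  map_comp f g := by rw [← Functor.map_comp]; rfl

theorem openPushPresheaf_isSheaf (N : X.Modules) (V : X.Opens) : (openPushPresheaf N V).IsSheaf := by
  rw [TopCat.Presheaf.isSheaf_iff_isSheafUniqueGluing]
  intro ι U s hs
  refine exists_glue N (fun i => U i ⊓ V) (iSup U ⊓ V) (fun i => inf_le_inf_right V (le_iSup U i)) (by rw [iSup_inf_eq]) s fun i j => ?_
  have h := congrArg (res N (show (U i ⊓ V) ⊓ (U j ⊓ V) ≤ (U i ⊓ U j) ⊓ V from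
    le_inf (inf_le_inf inf_le_left inf_le_left) (inf_le_left.trans inf_le_right))) (hs i j)
  refine (res_res N _ _ _).symm.trans (h.trans (res_res N _ _ _))

/-- `j_* j^* N` for the inclusion `j` of an open subset `V`, with sections `N(U ∩ V)` over `U`. -/
def openPush (N : X.Modules) (V : X.Opens) : X.Modules where
  val :=
    letI (U : X.Opensᵒᵖ) : Module (X.ringCatSheaf.obj.obj U) ((openPushPresheaf N V).obj U) :=
      Module.compHom (Γ(N, U.unop ⊓ V)) (ores (inf_le_left : U.unop ⊓ V ≤ U.unop))
    PresheafOfModules.ofPresheaf (openPushPresheaf N V) (fun U W i r f => by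
      refine (res_smul N (inf_le_inf_right V (leOfHom i.unop)) (ores inf_le_left r) f).trans ?_
      refine congrArg (· • res N (inf_le_inf_right V (leOfHom i.unop)) f) ?_
      exact (ores_ores inf_le_left (inf_le_inf_right V (leOfHom i.unop)) r).trans
        (ores_ores (leOfHom i.unop) inf_le_left r).symm)
  isSheaf := openPushPresheaf_isSheaf N V

theorem openPush_smul {N : X.Modules} {V U : X.Opens} (r : Γ(X, U)) (x : Γ(openPush N V, U)) :
    (r • x : Γ(openPush N V, U)) = (ores (inf_le_left : U ⊓ V ≤ U) r • (show Γ(N, U ⊓ V) from x) : Γ(N, U ⊓ V)) := rfl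

theorem openPush_res {N : X.Modules} {V U W : X.Opens} (h : W ≤ U) (x : Γ(openPush N V, U)) :
    res (openPush N V) h x = res N (inf_le_inf_right V h) (show Γ(N, U ⊓ V) from x) := rfl

/-- The morphism `M ⟶ j_* j^* N` given by a morphism `M|_V ⟶ N|_V`. -/
def homOpenPush {M N : X.Modules} {V : X.Opens} (f : localHom M N V) : M ⟶ openPush N V :=
  homMk (N := openPush N V) (fun U =>
    { toFun m := (f.1 ⟨U ⊓ V, inf_le_right⟩ (res M inf_le_left m) : Γ(N, U ⊓ V))
      map_add' m m' := by rw [map_add, map_add]; rfl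
      map_smul' r m := by rw [res_smul, map_smul]; rfl })
    (fun {U W} i m => by
      refine (localHom_apply_res f inf_le_right (inf_le_inf_right V (leOfHom i)) _).symm.trans ?_
      exact congrArg (f.1 ⟨W ⊓ V, inf_le_right⟩) ((res_res _ _ _ _).trans (res_res M (leOfHom i) inf_le_left m).symm))

theorem homOpenPush_app {M N : X.Modules} {V : X.Opens} (f : localHom M N V) (U : X.Opens) (m : Γ(M, U)) :
    (homOpenPush f).app U m = (f.1 ⟨U ⊓ V, inf_le_right⟩ (res M inf_le_left m) : Γ(N, U ⊓ V)) := rfl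

/-- Sections of `j_* j^* N` over `W ⊆ V` are sections of `N` over `W`. -/
def openPushEval (N : X.Modules) {V W : X.Opens} (h : W ≤ V) : Γ(openPush N V, W) →ₗ[Γ(X, W)] Γ(N, W) where
  toFun x := res N (le_inf le_rfl h) (show Γ(N, W ⊓ V) from x)
  map_add' x y := map_add (res N (le_inf le_rfl h)).hom _ _
  map_smul' r x := by
    rw [openPush_smul, res_smul, ores_ores, ores_self]; rfl

/-- The morphism `M|_V ⟶ N|_V` given by a morphism `M ⟶ j_* j^* N`. -/
def localHomOfOpenPush {M N : X.Modules} {V : X.Opens} (g : M ⟶ openPush N V) : localHom M N V :=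
  ⟨fun W => (openPushEval N W.2).comp (appₗ g W.1), fun W W' h m => by
    change res N h (openPushEval N W.2 (g.app W.1 m)) = openPushEval N W'.2 (g.app W'.1 (res M h m))
    rw [app_res, openPush_res]
    exact (res_res N _ _ _).trans (res_res N _ _ _).symm⟩

theorem localHomOfOpenPush_apply {M N : X.Modules} {V : X.Opens} (g : M ⟶ openPush N V) (W : X.Opens) (h : W ≤ V) (m : Γ(M, W)) :
    (localHomOfOpenPush g).1 ⟨W, h⟩ m = openPushEval N h (g.app W m) := rfl

theorem localHomOfOpenPush_homOpenPush {M N : X.Modules} {V : X.Opens} (f : localHom M N V) :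
    localHomOfOpenPush (homOpenPush f) = f := by
  refine localHom_ext fun W hW m => ?_
  change res N _ (f.1 ⟨W ⊓ V, inf_le_right⟩ (res M _ m)) = _
  rw [← localHom_apply_res f inf_le_right, res_res, res_self]

theorem homOpenPush_localHomOfOpenPush {M N : X.Modules} {V : X.Opens} (g : M ⟶ openPush N V) :
    homOpenPush (localHomOfOpenPush g) = g := by
  ext U m
  rw [homOpenPush_app, localHomOfOpenPush_apply, app_res]
  exact (res_res N _ _ _).trans (res_self N _ _)

/-- Morphisms `M|_V ⟶ N|_V` are morphisms `M ⟶ j_* j^* N`. -/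
def localHomEquiv (M N : X.Modules) (V : X.Opens) : localHom M N V ≃ (M ⟶ openPush N V) where
  toFun := homOpenPush
  invFun := localHomOfOpenPush
  left_inv := localHomOfOpenPush_homOpenPush
  right_inv := homOpenPush_localHomOfOpenPush

/-- `b` is a basis of `M|_U`. -/
def IsBasisOn {ι : Type*} [Fintype ι] (M : X.Modules) (U : X.Opens) (b : ι → Γ(M, U)) : Prop :=
  ∀ (V : X.Opens) (h : V ≤ U), Function.Bijective (fun c : ι → Γ(X, V) => ∑ i, c i • res M h (b i))

section
variable {ι : Type*} [Fintype ι] {M : X.Modules} {U : X.Opens} {b : ι → Γ(M, U)}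

theorem IsBasisOn.mono (hb : IsBasisOn M U b) {V : X.Opens} (h : V ≤ U) : IsBasisOn M V (fun i => res M h (b i)) := by
  intro W hW
  simpa only [res_res] using hb W (hW.trans h)

theorem IsBasisOn.reindex {κ : Type*} [Fintype κ] (hb : IsBasisOn M U b) (e : κ ≃ ι) : IsBasisOn M U (fun i => b (e i)) := by
  intro V hV
  have : (fun c : κ → Γ(X, V) => ∑ i, c i • res M hV (b (e i))) = (fun c : ι → Γ(X, V) => ∑ i, c i • res M hV (b i)) ∘ (Equiv.arrowCongr e (Equiv.refl _)) := by
    ext c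
    simp only [Function.comp, Equiv.arrowCongr_apply, Equiv.coe_refl, id]
    exact Fintype.sum_equiv e _ _ (by simp)
  rw [this]
  exact (hb V hV).comp (Equiv.bijective _)

/-- The basis of sections over `V ⊆ U`. -/
def IsBasisOn.basis (hb : IsBasisOn M U b) {V : X.Opens} (h : V ≤ U) : Module.Basis ι Γ(X, V) Γ(M, V) :=
  Module.Basis.ofEquivFun (LinearEquiv.ofBijective
    (Fintype.linearCombination Γ(X, V) (fun i => res M h (b i))) (hb V h)).symm

theorem IsBasisOn.basis_apply (hb : IsBasisOn M U b) {V : X.Opens} (h : V ≤ U) (i : ι) : hb.basis h i = res M h (b i) := by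
  classical
  simp only [IsBasisOn.basis, Module.Basis.coe_ofEquivFun, LinearEquiv.symm_symm]
  exact (Fintype.linearCombination_apply_single Γ(X, V) _ i 1).trans (one_smul _ _)

/-- The coordinates of sections over `V ⊆ U`. -/
def IsBasisOn.coord (hb : IsBasisOn M U b) {V : X.Opens} (h : V ≤ U) (i : ι) : Γ(M, V) →ₗ[Γ(X, V)] Γ(X, V) :=
  (hb.basis h).coord i

theorem IsBasisOn.sum_coord (hb : IsBasisOn M U b) {V : X.Opens} (h : V ≤ U) (m : Γ(M, V)) :
    ∑ i, hb.coord h i m • res M h (b i) = m := by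
  simp only [← hb.basis_apply h]
  exact (hb.basis h).sum_repr m

theorem IsBasisOn.coord_sum (hb : IsBasisOn M U b) {V : X.Opens} (h : V ≤ U) (c : ι → Γ(X, V)) (i : ι) :
    hb.coord h i (∑ i, c i • res M h (b i)) = c i := by
  classical
  simp only [← hb.basis_apply h]
  simp [IsBasisOn.coord, Finsupp.single_apply]

theorem IsBasisOn.coord_self [DecidableEq ι] (hb : IsBasisOn M U b) {V : X.Opens} (h : V ≤ U) (i j : ι) :
    hb.coord h i (res M h (b j)) = if j = i then 1 else 0 := by
  rw [← hb.basis_apply h]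
  simp [IsBasisOn.coord, Finsupp.single_apply]

theorem IsBasisOn.coord_res (hb : IsBasisOn M U b) {V W : X.Opens} (h : V ≤ U) (h' : W ≤ V) (i : ι) (m : Γ(M, V)) :
    hb.coord (h'.trans h) i (res M h' m) = ores h' (hb.coord h i m) := by
  conv_lhs => rw [← hb.sum_coord h m, map_sum]
  simp only [res_smul, res_res]
  rw [hb.coord_sum (h'.trans h) (fun i => ores h' (hb.coord h i m))]

/-- The morphism on `M|_U` with prescribed values on a basis. -/
def IsBasisOn.lift (hb : IsBasisOn M U b) {N : X.Modules} (x : ι → Γ(N, U)) : localHom M N U :=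
  ⟨fun V => ∑ i, (hb.coord V.2 i).smulRight (res N V.2 (x i)), fun V W h m => by
    simp only [LinearMap.sum_apply, LinearMap.smulRight_apply, map_sum, res_smul, res_res]
    exact Finset.sum_congr rfl fun i _ => by rw [← hb.coord_res V.2 h]⟩

theorem IsBasisOn.lift_apply (hb : IsBasisOn M U b) {N : X.Modules} (x : ι → Γ(N, U)) {V : X.Opens} (h : V ≤ U) (m : Γ(M, V)) :
    (hb.lift x).1 ⟨V, h⟩ m = ∑ i, hb.coord h i m • res N h (x i) := by
  simp [IsBasisOn.lift, LinearMap.sum_apply]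

theorem IsBasisOn.lift_self (hb : IsBasisOn M U b) {N : X.Modules} (x : ι → Γ(N, U)) (i : ι) :
    (hb.lift x).1 ⟨U, le_rfl⟩ (b i) = x i := by
  classical
  rw [hb.lift_apply, Finset.sum_eq_single i]
  · rw [← res_self M le_rfl (b i), hb.coord_self, if_pos rfl, one_smul, res_self]
  · intro j _ hj
    rw [← res_self M le_rfl (b i), hb.coord_self, if_neg (Ne.symm hj), zero_smul]
  · simp

theorem localHom_apply_sum {N : X.Modules} (f : localHom M N U) (b : ι → Γ(M, U)) {V : X.Opens} (h : V ≤ U) (c : ι → Γ(X, V)) :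
    f.1 ⟨V, h⟩ (∑ i, c i • res M h (b i)) = ∑ i, c i • res N h (f.1 ⟨U, le_rfl⟩ (b i)) := by
  simp only [map_sum, map_smul, ← localHom_apply_res f le_rfl h]

theorem IsBasisOn.localHom_ext (hb : IsBasisOn M U b) {N : X.Modules} {f g : localHom M N U}
    (h : ∀ i, f.1 ⟨U, le_rfl⟩ (b i) = g.1 ⟨U, le_rfl⟩ (b i)) : f = g := by
  refine Higgs.localHom_ext fun V hV m => ?_
  rw [← hb.sum_coord hV m, localHom_apply_sum, localHom_apply_sum]
  simp only [h]

/-- Multiplication of a section of `M` by functions. -/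
def smulHom (f : localHom M (structureSheaf X) U) {N : X.Modules} (x : Γ(N, U)) : localHom M N U :=
  ⟨fun V => LinearMap.smulRight (M₁ := Γ(M, V.1)) (show Γ(M, V.1) →ₗ[Γ(X, V.1)] Γ(X, V.1) from f.1 V) (res N V.2 x), fun V W h m => by
    rw [LinearMap.smulRight_apply, LinearMap.smulRight_apply, res_smul, res_res]
    exact congrArg (· • res N _ x) (f.2 V W h m)⟩

/-- A family of sections with the universal property of a basis is a basis. -/
theorem isBasisOn_of_universal
    (hex : ∀ (N : X.Modules) (x : ι → Γ(N, U)), ∃ f : localHom M N U, ∀ i, f.1 ⟨U, le_rfl⟩ (b i) = x i)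
    (hun : ∀ (f g : localHom M M U), (∀ i, f.1 ⟨U, le_rfl⟩ (b i) = g.1 ⟨U, le_rfl⟩ (b i)) → f = g) :
    IsBasisOn M U b := by
  classical
  -- The existence half of the universal property, with target `𝒪`, yields coordinate functions dual
  -- to `b`.
  choose φ hφ using fun i => hex (structureSheaf X) (fun j => (if j = i then 1 else 0 : Γ(X, U)))
  have hφ' (i j : ι) (V : X.Opens) (h : V ≤ U) : (φ i).1 ⟨V, h⟩ (res M h (b j)) = (if j = i then 1 else 0 : Γ(X, V)) := by
    rw [localHom_apply_res (φ i) le_rfl h, hφ]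
    exact (apply_ite (ores h) _ _ _).trans (by simp)
  let θ : localHom M M U := ∑ i, smulHom (φ i) (b i)
  have θ_apply (V : X.Opens) (h : V ≤ U) (m : Γ(M, V)) :
      θ.1 ⟨V, h⟩ m = ∑ i, (show Γ(X, V) from (φ i).1 ⟨V, h⟩ m) • res M h (b i) := by
    simp only [θ, AddSubgroup.val_finsetSum, Finset.sum_apply, LinearMap.sum_apply]
    rfl
  let one : localHom M M U := ⟨fun V => LinearMap.id, fun V W h m => rfl⟩
  -- `θ = ∑ φ i · b i` fixes every `b i`, so the uniqueness half makes it the identity. This gives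
  -- spanning; independence follows from duality of `φ` and `b`.
  have hθ : θ = one := hun _ _ fun i => by
    rw [θ_apply, Finset.sum_eq_single i]
    · simp only [hφ, if_true]
      rw [res_self]
      exact one_smul _ _
    · intro j _ hj
      simp only [hφ, if_neg (Ne.symm hj)]
      exact zero_smul _ _
    · simp
  intro V h
  refine ⟨fun c c' e => funext fun i => ?_, fun m => ?_⟩
  · have key (c : ι → Γ(X, V)) : (show Γ(X, V) from (φ i).1 ⟨V, h⟩ (∑ j, c j • res M h (b j))) = c i := by
      rw [map_sum, Finset.sum_eq_single i]
      · refine (map_smul ((φ i).1 ⟨V, h⟩) _ _).trans ?_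
        rw [hφ', if_pos rfl]
        exact mul_one (c i)
      · intro j _ hj
        refine (map_smul ((φ i).1 ⟨V, h⟩) _ _).trans ?_
        rw [hφ', if_neg hj]
        exact mul_zero (c j)
      · simp
    rw [← key c, ← key c']
    exact congrArg ((φ i).1 ⟨V, h⟩) e
  · refine ⟨fun i => (φ i).1 ⟨V, h⟩ m, ?_⟩
    change ∑ i, (show Γ(X, V) from (φ i).1 ⟨V, h⟩ m) • res M h (b i) = m
    rw [← θ_apply, hθ]
    rfl

end

end
end Higgs
-- Pullbacks of local bases; tensor products and duals in local bases
namespace Higgs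
noncomputable section
variable {X : Scheme.{u}}

section pullback
variable {S : Scheme.{u}} (π : X ⟶ S)

theorem ores_app {U V : S.Opens} (h : V ≤ U) (h' : π ⁻¹ᵁ V ≤ π ⁻¹ᵁ U) (r : Γ(S, U)) :
    ores h' (π.app U r) = π.app V (ores h r) :=
  (ConcreteCategory.congr_hom (π.naturality (homOfLE h).op) r).symm

theorem pushforward_smul (N : X.Modules) {U : S.Opens} (r : Γ(S, U)) (x : Γ((Scheme.Modules.pushforward π).obj N, U)) :
    r • x = (π.app U r • (show Γ(N, π ⁻¹ᵁ U) from x) : Γ(N, π ⁻¹ᵁ U)) := rfl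

/-- `m ↦ π^* m`. -/
def unitₗ (M : S.Modules) (U : S.Opens) :
    Γ(M, U) →ₗ[Γ(S, U)] Γ((Scheme.Modules.pushforward π).obj ((Scheme.Modules.pullback π).obj M), U) :=
  appₗ (pullbackUnit π M) U

/-- The pullback `π^* m` of a section over `U`. -/
def pullSec {M : S.Modules} {U : S.Opens} (m : Γ(M, U)) : Γ((Scheme.Modules.pullback π).obj M, π ⁻¹ᵁ U) :=
  (pullbackUnit π M).app U m

theorem pullSec_res {M : S.Modules} {U V : S.Opens} (h : V ≤ U) (h' : π ⁻¹ᵁ V ≤ π ⁻¹ᵁ U) (m : Γ(M, U)) :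
    pullSec π (res M h m) = res _ h' (pullSec π m) :=
  app_res (pullbackUnit π M) h m

theorem pullSec_add {M : S.Modules} {U : S.Opens} (m m' : Γ(M, U)) : pullSec π (m + m') = pullSec π m + pullSec π m' :=
  map_add (unitₗ π M U) m m'

theorem pullSec_smul {M : S.Modules} {U : S.Opens} (r : Γ(S, U)) (m : Γ(M, U)) : pullSec π (r • m) = π.app U r • pullSec π m :=
  map_smul (unitₗ π M U) r m

/-- The adjoint `M|_U ⟶ π_* N|_U` of a morphism `π^* M|_{π⁻¹ U} ⟶ N|_{π⁻¹ U}`. -/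
def localHomPush {M : S.Modules} {N : X.Modules} {U : S.Opens}
    (f : localHom ((Scheme.Modules.pullback π).obj M) N (π ⁻¹ᵁ U)) :
    localHom M ((Scheme.Modules.pushforward π).obj N) U :=
  ⟨fun V =>
    { toFun m := f.1 ⟨π ⁻¹ᵁ V.1, π.preimage_mono V.2⟩ (pullSec π m)
      map_add' m m' := by rw [pullSec_add, map_add]; rfl
      map_smul' r m := by rw [pullSec_smul, map_smul]; rfl }, fun V W h m => by
    refine (localHom_apply_res f (π.preimage_mono V.2) (π.preimage_mono h) _).symm.trans ?_
    exact congrArg _ (pullSec_res π h _ m).symm⟩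

theorem localHomPush_apply {M : S.Modules} {N : X.Modules} {U : S.Opens}
    (f : localHom ((Scheme.Modules.pullback π).obj M) N (π ⁻¹ᵁ U)) {V : S.Opens} (h : V ≤ U) (m : Γ(M, V)) :
    (localHomPush π f).1 ⟨V, h⟩ m = f.1 ⟨π ⁻¹ᵁ V, π.preimage_mono h⟩ (pullSec π m) := rfl

/-- Morphisms over `π⁻¹U` into `N` are global morphisms into `j_* j^* N`, so the
pullback-pushforward adjunction on all of `X` yields its version over `U`. -/
theorem localHomPush_injective {M : S.Modules} {N : X.Modules} {U : S.Opens} :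
    Function.Injective (localHomPush π (M := M) (N := N) (U := U)) := by
  intro f g h
  apply (localHomEquiv _ _ _).injective
  apply ((Scheme.Modules.pullbackPushforwardAdjunction π).homEquiv _ _).injective
  rw [Adjunction.homEquiv_unit, Adjunction.homEquiv_unit]
  ext W m
  have key (f : localHom ((Scheme.Modules.pullback π).obj M) N (π ⁻¹ᵁ U)) :
      (homOpenPush f).app (π ⁻¹ᵁ W) (pullSec π m) = (localHomPush π f).1 ⟨W ⊓ U, inf_le_right⟩ (res M inf_le_left m) := by
    rw [localHomPush_apply, homOpenPush_app, pullSec_res π _ (π.preimage_mono inf_le_left)]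
    rfl
  exact (key f).trans ((by rw [h] : _ = _).trans (key g).symm)

theorem localHomPush_surjective {M : S.Modules} {N : X.Modules} {U : S.Opens} :
    Function.Surjective (localHomPush π (M := M) (N := N) (U := U)) := by
  intro x
  -- The sections of `π_* j_* j^* N` over `W` are those of `N` over `π⁻¹W ⊓ π⁻¹U`, so `x` defines a
  -- global morphism into it. Its adjoint is the required preimage.
  let g : M ⟶ (Scheme.Modules.pushforward π).obj (openPush N (π ⁻¹ᵁ U)) :=
    homMk (N := (Scheme.Modules.pushforward π).obj (openPush N (π ⁻¹ᵁ U)))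
     (fun W =>
       { toFun m := (x.1 ⟨W ⊓ U, inf_le_right⟩ (res M inf_le_left m) : Γ(N, π ⁻¹ᵁ W ⊓ π ⁻¹ᵁ U))
         map_add' m m' := by rw [map_add, map_add]; rfl
         map_smul' r m := by
           rw [res_smul, map_smul, pushforward_smul, ← ores_app π inf_le_left (π.preimage_mono inf_le_left)]
           rfl })
     (fun {W W'} i m => by
      refine (localHom_apply_res x inf_le_right (inf_le_inf_right U (leOfHom i)) _).symm.trans ?_
      exact congrArg (x.1 ⟨W' ⊓ U, inf_le_right⟩) ((res_res _ _ _ _).trans (res_res M (leOfHom i) inf_le_left m).symm))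
  have hg (W : S.Opens) (m : Γ(M, W)) : g.app W m = (x.1 ⟨W ⊓ U, inf_le_right⟩ (res M inf_le_left m) : Γ(N, π ⁻¹ᵁ W ⊓ π ⁻¹ᵁ U)) := rfl
  let G := ((Scheme.Modules.pullbackPushforwardAdjunction π).homEquiv _ _).symm g
  have hG : pullbackUnit π M ≫ (Scheme.Modules.pushforward π).map G = g := by
    rw [pullbackUnit, ← Adjunction.homEquiv_unit, Equiv.apply_symm_apply]
  refine ⟨localHomOfOpenPush G, localHom_ext fun V hV m => ?_⟩
  rw [localHomPush_apply, localHomOfOpenPush_apply]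
  have h1 : G.app (π ⁻¹ᵁ V) (pullSec π m) = g.app V m := congrArg (fun h => Scheme.Modules.Hom.app h V m) hG
  rw [h1, hg, localHom_apply_res x hV]
  exact (res_res N (π.preimage_mono inf_le_left) _ _).trans (res_self N _ _)

/-- The pullback of a basis is a basis. -/
theorem IsBasisOn.pullback {ι : Type*} [Fintype ι] {M : S.Modules} {U : S.Opens} {b : ι → Γ(M, U)} (hb : IsBasisOn M U b) :
    IsBasisOn ((Scheme.Modules.pullback π).obj M) (π ⁻¹ᵁ U) (fun i => pullSec π (b i)) := by
  -- A basis is recognised by its universal property, which the local adjunction carries from `M` to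
  -- its pullback. Sections of the pullback never have to be computed.
  refine isBasisOn_of_universal (fun N x => ?_) (fun f g h => ?_)
  · obtain ⟨f, hf⟩ := localHomPush_surjective π (hb.lift (N := (Scheme.Modules.pushforward π).obj N) x)
    exact ⟨f, fun i => by rw [← hb.lift_self (N := (Scheme.Modules.pushforward π).obj N) x i, ← hf]; rfl⟩
  · exact localHomPush_injective π (hb.localHom_ext h)
end pullback

/-- The section `m ⊗ n`. -/
def tmul {M N : X.Modules} {U : X.Opens} (m : Γ(M, U)) (n : Γ(N, U)) : Γ(tensor M N, U) := (tensorMk M N).app U m n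

section tensor
variable {M N P : X.Modules} {U V : X.Opens}

theorem tmul_add (m : Γ(M, U)) (n n' : Γ(N, U)) : tmul m (n + n') = tmul m n + tmul m n' := map_add _ _ _
theorem tmul_smul (r : Γ(X, U)) (m : Γ(M, U)) (n : Γ(N, U)) : tmul m (r • n) = r • tmul m n := map_smul _ _ _
theorem smul_tmul (r : Γ(X, U)) (m : Γ(M, U)) (n : Γ(N, U)) : tmul (r • m) n = r • tmul m n := LinearMap.map_smul₂ _ _ _ _
theorem tmul_sum {ι : Type*} (s : Finset ι) (m : Γ(M, U)) (n : ι → Γ(N, U)) : tmul m (∑ i ∈ s, n i) = ∑ i ∈ s, tmul m (n i) := map_sum _ _ _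
theorem sum_tmul {ι : Type*} (s : Finset ι) (m : ι → Γ(M, U)) (n : Γ(N, U)) : tmul (∑ i ∈ s, m i) n = ∑ i ∈ s, tmul (m i) n :=
  LinearMap.map_sum₂ _ _ _ _

theorem res_tmul (h : V ≤ U) (m : Γ(M, U)) (n : Γ(N, U)) : res (tensor M N) h (tmul m n) = tmul (res M h m) (res N h n) :=
  (tensorMk M N).naturality (homOfLE h) m n

theorem tensorDesc_tmul (b : BilinHom M N P) (m : Γ(M, U)) (n : Γ(N, U)) : (tensorDesc b).app U (tmul m n) = b.app U m n :=
  tensorDesc_mk b U m n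

theorem tensorMap_tmul {M' N' : X.Modules} (f : M ⟶ M') (g : N ⟶ N') (m : Γ(M, U)) (n : Γ(N, U)) :
    (tensorMap f g).app U (tmul m n) = tmul (f.app U m) (g.app U n) :=
  tensorDesc_mk _ U m n

theorem tensorSection_app {N : X.Modules} (s : Γ(N, ⊤)) (m : Γ(M, U)) : (tensorSection M s).app U m = tmul m (res N le_top s) := rfl

/-- The symmetry `M ⊗ N ⟶ N ⊗ M`. -/
def tensorSwap (M N : X.Modules) : tensor M N ⟶ tensor N M := tensorDesc (tensorMk N M).flip

theorem tensorSwap_tmul (m : Γ(M, U)) (n : Γ(N, U)) : (tensorSwap M N).app U (tmul m n) = tmul n m := tensorDesc_mk _ U m n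

theorem tensorSwap_swap (M N : X.Modules) : tensorSwap M N ≫ tensorSwap N M = 𝟙 _ :=
  tensor_hom_ext fun U m n => by
    rw [Scheme.Modules.Hom.comp_app]
    exact (congrArg ((tensorSwap N M).app U) (tensorSwap_tmul m n)).trans (tensorSwap_tmul n m)

theorem tensorSwap_bijective (M N : X.Modules) (U : X.Opens) : Function.Bijective ((tensorSwap M N).app U) :=
  Function.bijective_iff_has_inverse.2 ⟨(tensorSwap N M).app U,
    fun x => congrArg (fun h => Scheme.Modules.Hom.app h U x) (tensorSwap_swap M N),
    fun x => congrArg (fun h => Scheme.Modules.Hom.app h U x) (tensorSwap_swap N M)⟩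

variable {ι : Type*} [Fintype ι] {b : ι → Γ(M, U)}

/-- The bilinear map `(m, n) ↦ mᵢ n` for the `i`-th coordinate function. -/
def IsBasisOn.coordBilin (hb : IsBasisOn M U b) (N : X.Modules) (i : ι) : BilinHom M N (openPush N U) where
  app V := LinearMap.mk₂ Γ(X, V) (fun m n => ((hb.coord (V := V ⊓ U) inf_le_right i (res M inf_le_left m) : Γ(X, V ⊓ U)) • res N (inf_le_left : V ⊓ U ≤ V) n : Γ(N, V ⊓ U)))
    (fun m m' n => by rw [map_add, map_add, add_smul]; rfl)
    (fun r m n => by rw [res_smul, map_smul, smul_assoc]; rfl)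
    (fun m n n' => by rw [map_add, smul_add]; rfl)
    (fun r m n => by rw [res_smul, smul_comm]; rfl)
  naturality {V W} j m n := by
    refine (res_smul N (inf_le_inf_right U (leOfHom j)) _ _).trans ?_
    rw [← hb.coord_res, res_res, res_res]
    have h1 := res_res M (leOfHom j) (inf_le_left : W ⊓ U ≤ W) m
    have h2 := res_res N (leOfHom j) (inf_le_left : W ⊓ U ≤ W) n
    exact congrArg₂ (fun (x : Γ(M, W ⊓ U)) (y : Γ(N, W ⊓ U)) => (hb.coord inf_le_right i x • y : Γ(N, W ⊓ U))) h1.symm h2.symm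

theorem IsBasisOn.eval_coordBilin (hb : IsBasisOn M U b) (N : X.Modules) (i : ι) {V : X.Opens} (h : V ≤ U) (m : Γ(M, V)) (n : Γ(N, V)) :
    openPushEval N h ((hb.coordBilin N i).app V m n) = hb.coord h i m • n := by
  refine (res_smul N (le_inf le_rfl h) _ _).trans ?_
  rw [← hb.coord_res, res_res, res_res, res_self, res_self]

/-- The coordinate functionals of `b`, extended to `M ⊗ N`, invert the map: one composite is
computed by duality with `b`, the other on pure tensors. -/
theorem IsBasisOn.tensor_bijective (hb : IsBasisOn M U b) (N : X.Modules) :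
    Function.Bijective (fun n : ι → Γ(N, U) => ∑ i, tmul (b i) (n i)) := by
  classical
  let θ (i : ι) : localHom (tensor M N) N U := localHomOfOpenPush (tensorDesc (hb.coordBilin N i))
  have hθ (i : ι) {V : X.Opens} (h : V ≤ U) (m : Γ(M, V)) (n : Γ(N, V)) : (θ i).1 ⟨V, h⟩ (tmul m n) = hb.coord h i m • n := by
    rw [localHomOfOpenPush_apply, tensorDesc_tmul, hb.eval_coordBilin]
  have θ_tmul (i : ι) (m : Γ(M, U)) (n : Γ(N, U)) : (θ i).1 ⟨U, le_rfl⟩ (tmul m n) = hb.coord le_rfl i m • n := hθ i le_rfl m n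
  refine ⟨fun n n' h => funext fun i => ?_, fun x => ?_⟩
  · have key (n : ι → Γ(N, U)) : (θ i).1 ⟨U, le_rfl⟩ (∑ j, tmul (b j) (n j)) = n i := by
      rw [map_sum, Finset.sum_eq_single i]
      · rw [θ_tmul]; rw [← res_self M le_rfl (b i), hb.coord_self, if_pos rfl, one_smul]
      · intro j _ hj
        rw [θ_tmul]; rw [← res_self M le_rfl (b j), hb.coord_self, if_neg hj, zero_smul]
      · simp
    rw [← key n, ← key n']
    exact congrArg _ h
  · refine ⟨fun i => (θ i).1 ⟨U, le_rfl⟩ x, ?_⟩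
    let Θ : localHom (tensor M N) (tensor M N) U := ⟨fun V => ∑ i,
      ((tensorMk M N).app V.1 (res M V.2 (b i))).comp ((θ i).1 V), fun V W h y => by
        simp only [LinearMap.sum_apply, LinearMap.comp_apply, map_sum]
        exact Finset.sum_congr rfl fun i _ => by
          refine (res_tmul h _ _).trans ?_
          rw [res_res, ← localHom_apply_res]; rfl⟩
    have Θ_apply (V) (h : V ≤ U) (y) : Θ.1 ⟨V, h⟩ y = ∑ i, tmul (res M h (b i)) ((θ i).1 ⟨V, h⟩ y) :=
      LinearMap.sum_apply _ _ _
    let one : localHom (tensor M N) (tensor M N) U := ⟨fun V => LinearMap.id, fun V W h m => rfl⟩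
    -- Pure tensors test morphisms defined on the whole of `X`, so both sides are first turned into
    -- global morphisms into `j_* j^*` of the tensor product.
    have e : Θ = one := by
      apply (localHomEquiv _ _ _).injective
      refine tensor_hom_ext fun V m n => ?_
      change (homOpenPush Θ).app V (tmul m n) = (homOpenPush one).app V (tmul m n)
      rw [homOpenPush_app, homOpenPush_app, Θ_apply]
      change _ = res _ _ (tmul m n)
      rw [res_tmul]
      have h1 (i : ι) : (θ i).1 ⟨V ⊓ U, inf_le_right⟩ (tmul (res M inf_le_left m) (res N inf_le_left n)) =
          hb.coord inf_le_right i (res M inf_le_left m) • res N inf_le_left n := hθ i _ _ _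
      conv_rhs => rw [← hb.sum_coord inf_le_right (res M inf_le_left m), sum_tmul]
      refine Finset.sum_congr rfl fun i _ => ?_
      rw [h1, smul_tmul, tmul_smul]
    have := Θ_apply U le_rfl x
    simp only [res_self] at this
    refine this.symm.trans ?_
    rw [e]; rfl

theorem IsBasisOn.tensor_bijective_right {c : ι → Γ(N, U)} (hc : IsBasisOn N U c) (M : X.Modules) :
    Function.Bijective (fun m : ι → Γ(M, U) => ∑ i, tmul (m i) (c i)) := by
  have := (tensorSwap_bijective N M U).comp (hc.tensor_bijective M)
  convert this using 2 with m
  simp only [Function.comp, map_sum, tensorSwap_tmul]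

/-- If `k` generates the invertible sheaf `K` on `U`, then `m ↦ m ⊗ k` is bijective on `U`. -/
theorem IsBasisOn.tmul_bijective {K : X.Modules} {k : Γ(K, U)} (hk : IsBasisOn K U (fun _ : Unit => k)) (M : X.Modules) :
    Function.Bijective (fun m : Γ(M, U) => tmul m k) := by
  have := (hk.tensor_bijective_right M).comp (Equiv.funUnique Unit Γ(M, U)).symm.bijective
  convert this using 2 with m
  simp

theorem IsBasisOn.tensor {K : X.Modules} {k : Γ(K, U)} (hk : IsBasisOn K U (fun _ : Unit => k)) (hb : IsBasisOn M U b) :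
    IsBasisOn (Higgs.tensor M K) U (fun i => tmul (b i) k) := by
  intro V hV
  have := ((hk.mono hV).tmul_bijective M).comp (hb V hV)
  convert this using 2 with c
  simp only [Function.comp, sum_tmul, res_tmul, smul_tmul]

theorem localHom_bijective (hb : IsBasisOn M U b) (N : X.Modules) :
    Function.Bijective (fun f : localHom M N U => fun i => f.1 ⟨U, le_rfl⟩ (b i)) :=
  ⟨fun _ _ h => hb.localHom_ext (congrFun h), fun x => ⟨hb.lift x, funext fun i => hb.lift_self x i⟩⟩

/-- The dual basis. -/
def IsBasisOn.dualBasis (hb : IsBasisOn M U b) (i : ι) : Γ(dual M, U) :=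
  letI := Classical.decEq ι
  toLocalHom.symm (hb.lift (N := structureSheaf X) (fun j => (Pi.single i 1 : ι → Γ(X, U)) j))

/-- The evaluation pairing of `M^*` and `M`. -/
def dualPairing (M : X.Modules) : BilinHom (dual M) M (structureSheaf X) := evalHom M (structureSheaf X)

theorem IsBasisOn.pair_dualBasis [DecidableEq ι] (hb : IsBasisOn M U b) (i j : ι) :
    (dualPairing M).pair U (hb.dualBasis i) (b j) = if j = i then 1 else 0 := by
  refine (hb.lift_self (N := structureSheaf X) _ j).trans ?_
  rw [Subsingleton.elim (Classical.decEq ι) ‹DecidableEq ι›]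
  exact Pi.single_apply i (1 : Γ(X, U)) j

theorem BilinHom.pair_res {A B : X.Modules} (b : BilinHom A B (structureSheaf X)) (h : V ≤ U) (x : Γ(A, U)) (y : Γ(B, U)) :
    b.pair V (res A h x) (res B h y) = ores h (b.pair U x y) :=
  (b.pair_naturality (homOfLE h) x y).symm

/-- Evaluation on `b` identifies functionals with tuples of functions and takes the dual sections to
the standard basis. -/
theorem IsBasisOn.isBasisOn_dual (hb : IsBasisOn M U b) : IsBasisOn (dual M) U hb.dualBasis := by
  classical
  intro V hV
  have h1 : Function.Bijective (fun (f : Γ(dual M, V)) (i : ι) => (dualPairing M).pair V f (res M hV (b i))) :=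
    localHom_bijective (hb.mono hV) (structureSheaf X)
  rw [← Function.Bijective.of_comp_iff' h1]
  convert Function.bijective_id
  refine funext fun c => funext fun j => ?_
  change (dualPairing M).pair V (∑ i, c i • res (dual M) hV (hb.dualBasis i)) (res M hV (b j)) = c j
  rw [LinearMap.map_sum₂]
  simp only [LinearMap.map_smul₂, BilinHom.pair_res, hb.pair_dualBasis, apply_ite (ores hV), map_one, map_zero, smul_eq_mul,
    mul_ite, mul_one, mul_zero, Finset.sum_ite_eq, Finset.mem_univ, if_true]

end tensor
end
end Higgs
-- Exactness of tensoring with a locally free sheaf; divisibility of injective sheaves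
namespace Higgs
noncomputable section
variable {X : Scheme.{u}}

/-- `M` is locally free of finite rank. -/
def IsLocFree (M : X.Modules) : Prop :=
  ∀ p : X, ∃ (U : X.Opens) (n : ℕ) (b : Fin n → Γ(M, U)), p ∈ U ∧ IsBasisOn M U b

theorem app_sum {ι : Type*} {M N : X.Modules} (f : M ⟶ N) {U : X.Opens} (s : Finset ι) (m : ι → Γ(M, U)) :
    f.app U (∑ i ∈ s, m i) = ∑ i ∈ s, f.app U (m i) := map_sum (appₗ f U) m s

theorem app_smul {M N : X.Modules} (f : M ⟶ N) {U : X.Opens} (r : Γ(X, U)) (m : Γ(M, U)) :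
    f.app U (r • m) = r • f.app U m := map_smul (appₗ f U) r m

theorem tmul_zero {M N : X.Modules} {U : X.Opens} (m : Γ(M, U)) : tmul m (0 : Γ(N, U)) = 0 := map_zero ((tensorMk M N).app U m)

/-- The functor `M ⊗ -`. -/
def tensorLeft (M : X.Modules) : X.Modules ⥤ X.Modules where
  obj N := tensor M N
  map f := tensorMap (𝟙 M) f
  map_id N := tensor_hom_ext fun U m n => tensorMap_tmul _ _ m n
  map_comp f g := tensor_hom_ext fun U m n => by
    refine (tensorMap_tmul _ _ m n).trans ?_
    exact ((congrArg ((tensorMap (𝟙 M) g).app U) (tensorMap_tmul (𝟙 M) f m n)).trans (tensorMap_tmul _ _ _ _)).symm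

theorem tensorLeft_map_tmul (M : X.Modules) {N P : X.Modules} (f : N ⟶ P) {U : X.Opens} (m : Γ(M, U)) (n : Γ(N, U)) :
    ((tensorLeft M).map f).app U (tmul m n) = tmul m (f.app U n) := tensorMap_tmul _ _ m n

instance (M : X.Modules) : (tensorLeft M).Additive where
  map_add {N N'} f g := tensor_hom_ext fun U m n => by
    refine (tensorMap_tmul _ _ m n).trans ?_
    rw [Scheme.Modules.Hom.add_app]
    refine (tmul_add _ _ _).trans ?_
    exact (congrArg₂ (· + ·) (tensorMap_tmul (𝟙 M) f m n) (tensorMap_tmul (𝟙 M) g m n)).symm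

/-- Serves to lift the finitely many coordinates of a section over one common neighbourhood. -/
theorem exists_common_nhd {ι : Type*} [Finite ι] {U : X.Opens} (p : X) (hp : p ∈ U)
    (Q : ι → X.Opens → Prop) (hQ : ∀ i V W, W ≤ V → Q i V → Q i W) (h : ∀ i, ∃ V ≤ U, p ∈ V ∧ Q i V) :
    ∃ V ≤ U, p ∈ V ∧ ∀ i, Q i V := by
  choose V hV hpV hQV using h
  refine ⟨U ⊓ ⨅ i, V i, inf_le_left, ⟨hp, ?_⟩, fun i => hQ i _ _ (inf_le_right.trans (iInf_le V i)) (hQV i)⟩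
  have : (p : X) ∈ ((⨅ i, V i : X.Opens) : Set X) := by
    rw [TopologicalSpace.Opens.coe_iInf, Set.mem_iInter]
    exact hpV
  exact this

/-- Where `M` has a basis of length `n`, tensoring with `M` is the `n`-fold product on sections, and
coordinates lift one at a time. -/
theorem IsLocFree.map_exact {M : X.Modules} (hM : IsLocFree M) (S : ShortComplex X.Modules) (hS : S.Exact) :
    (S.map (tensorLeft M)).Exact := by
  refine exact_of_locally _ fun U y hy p hp => ?_
  obtain ⟨W, n, b, hpW, hb⟩ := hM p
  replace hb := hb.mono (inf_le_right : U ⊓ W ≤ W)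
  set b' := fun i => res M (inf_le_right : U ⊓ W ≤ W) (b i) with hb'
  obtain ⟨x, hx⟩ := (hb.tensor_bijective S.X₂).2 (res (tensor M S.X₂) inf_le_left y)
  have hx' (i : Fin n) : S.g.app (U ⊓ W) (x i) = 0 := by
    have h0 : (∑ i, tmul (b' i) (S.g.app (U ⊓ W) (x i))) = ∑ i, tmul (b' i) (0 : Γ(S.X₃, U ⊓ W)) := by
      have h1 : ((tensorLeft M).map S.g).app (U ⊓ W) (res (tensor M S.X₂) inf_le_left y) = 0 := by
        refine (app_res ((tensorLeft M).map S.g) (inf_le_left : U ⊓ W ≤ U) y).trans ?_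
        exact (congrArg _ hy).trans (map_zero _)
      rw [← hx] at h1
      simp only [tmul_zero, Finset.sum_const_zero]
      refine Eq.trans ?_ h1
      refine Eq.trans ?_ (app_sum ((tensorLeft M).map S.g) _ _).symm
      exact Finset.sum_congr rfl fun i _ => (tensorLeft_map_tmul M S.g _ _).symm
    exact congrFun ((hb.tensor_bijective S.X₃).1 h0) i
  obtain ⟨V, hV, hpV, hz⟩ := exists_common_nhd (U := U ⊓ W) p ⟨hp, hpW⟩
    (fun i V => ∃ (h : V ≤ U ⊓ W), ∃ z, S.f.app V z = res S.X₂ h (x i))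
    (fun i V V' h ⟨hV, z, hz⟩ => ⟨h.trans hV, res S.X₁ h z, by rw [app_res, hz, res_res]⟩)
    (fun i => by
      obtain ⟨V, hV, hp, z, hz⟩ := locally_of_exact hS (x i) (hx' i) p ⟨hp, hpW⟩
      exact ⟨V, hV, hp, hV, z, hz⟩)
  choose _ z hz using hz
  refine ⟨V, hV.trans inf_le_left, hpV, ∑ i, tmul (res M hV (b' i)) (z i), ?_⟩
  refine Eq.trans ?_ (res_res _ inf_le_left hV y)
  refine (app_sum ((tensorLeft M).map S.f) _ _).trans ?_
  refine Eq.trans ?_ (congrArg (res (tensor M S.X₂) hV) hx)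
  rw [map_sum]
  refine Finset.sum_congr rfl fun i _ => ?_
  refine (tensorLeft_map_tmul M S.f _ _).trans ?_
  rw [res_tmul, hz]

theorem IsLocFree.preservesHomology {M : X.Modules} (hM : IsLocFree M) : (tensorLeft M).PreservesHomology :=
  ((tensorLeft M).exact_tfae.out 1 2).1 hM.map_exact

/-- Multiplication by `r` on `j_! 𝒪_U`, before sheafification. -/
def mulFree (U : X.Opens) (r : Γ(X, U)) : (PresheafOfModules.free X.ringCatSheaf.obj).obj (yoneda.obj U) ⟶
    (PresheafOfModules.free X.ringCatSheaf.obj).obj (yoneda.obj U) :=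
  PresheafOfModules.freeYonedaEquiv.symm ((show X.ringCatSheaf.obj.obj (op U) from r) • (show ((PresheafOfModules.free X.ringCatSheaf.obj).obj (yoneda.obj U)).obj (op U) from ModuleCat.freeMk (𝟙 U)))

/-- Over `V ⊆ U` the free presheaf has a single generator, the inclusion `V ⟶ U`, so it suffices to
compare the two linear maps there. -/
theorem mulFree_app {U V : X.Opens} (r : Γ(X, U)) (h : V ≤ U) (x : ((PresheafOfModules.free X.ringCatSheaf.obj).obj (yoneda.obj U)).obj (op V)) :
    (mulFree U r).app (op V) x = (show X.ringCatSheaf.obj.obj (op V) from ores h r) • x := by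
  let _ : Module Γ(X, V) (((PresheafOfModules.free X.ringCatSheaf.obj).obj (yoneda.obj U)).obj (op V)) :=
    inferInstanceAs (Module (X.ringCatSheaf.obj.obj (op V)) _)
  have key : ((mulFree U r).app (op V)).hom = LinearMap.lsmul Γ(X, V) (((PresheafOfModules.free X.ringCatSheaf.obj).obj (yoneda.obj U)).obj (op V)) (ores h r) := by
    refine Finsupp.lhom_ext' (fun i => LinearMap.ext_ring ?_)
    obtain rfl : i = homOfLE h := Subsingleton.elim (α := V ⟶ U) _ _
    have h2 := PresheafOfModules.naturality_apply (mulFree U r) (homOfLE h).op (ModuleCat.freeMk (𝟙 U))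
    have h3 : ((PresheafOfModules.free X.ringCatSheaf.obj).obj (yoneda.obj U)).map (homOfLE h).op (ModuleCat.freeMk (𝟙 U)) =
        Finsupp.single (homOfLE h) (1 : Γ(X, V)) := by
      exact ModuleCat.freeDesc_apply _ _
    have h4 : (mulFree U r).app (op U) (ModuleCat.freeMk (𝟙 U)) = _ := PresheafOfModules.freeYonedaEquiv_symm_app _ U _
    rw [h4] at h2
    refine (congrArg ((mulFree U r).app (op V)) h3).symm.trans (h2.trans ?_)
    refine (PresheafOfModules.map_smul _ _ _ _).trans ?_
    exact congrArg _ h3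
  exact LinearMap.congr_fun key x

/-- Over `V ⊆ U` the free presheaf has sections `𝒪(V)`, on which `r` is a nonzerodivisor; over any
other open set it is zero. -/
theorem mulFree_mono {U : X.Opens} (r : Γ(X, U)) (hr : ∀ V (h : V ≤ U) (x : Γ(X, V)), ores h r * x = 0 → x = 0) : Mono (mulFree U r) := by
  refine PresheafOfModules.mono_of_injective (fun {V} => ?_)
  refine (injective_iff_map_eq_zero ((mulFree U r).app V).hom).2 fun x hx => ?_
  by_cases h : V.unop ≤ U
  · have h1 : (show Γ(X, V.unop) from ores h r) • (show (V.unop ⟶ U) →₀ Γ(X, V.unop) from x) = 0 := (mulFree_app r h x).symm.trans hx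
    refine Finsupp.ext fun i => hr V.unop h _ ?_
    exact congrArg (fun f : (V.unop ⟶ U) →₀ Γ(X, V.unop) => f i) h1
  · exact Finsupp.ext fun i => (h (leOfHom i)).elim

instance : (sheafification X).PreservesMonomorphisms :=
  inferInstanceAs ((PresheafOfModules.sheafification (𝟙 X.ringCatSheaf.obj)).PreservesMonomorphisms)

/-- Multiplication by a nonzerodivisor `r` is a monomorphism of `j_! 𝒪_U`. Extending `y : j_! 𝒪_U ⟶
I` along it divides `y` by `r`. This is the sheaf form of divisibility of injective modules, and it
produces the surjectivity on injectives needed to compute `R𝓗om`. -/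
theorem exists_smul_eq_of_injective (I : X.Modules) [Injective I] {U : X.Opens} (r : Γ(X, U))
    (hr : ∀ V (h : V ≤ U) (x : Γ(X, V)), ores h r * x = 0 → x = 0) (y : Γ(I, U)) : ∃ z, r • z = y := by
  have h0 := mulFree_mono r hr
  let μ : extByZero U ⟶ extByZero U := (sheafification X).map (mulFree U r)
  have : Mono μ := @Functor.map_mono _ _ _ _ (sheafification X) _ _ _ (mulFree U r) h0
  let z := Injective.factorThru ((extByZeroEquiv U I).symm y) μ
  have hz : μ ≫ z = (extByZeroEquiv U I).symm y := Injective.comp_factorThru _ _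
  refine ⟨extByZeroEquiv U I z, ?_⟩
  rw [← (extByZeroEquiv U I).apply_symm_apply y, ← hz]
  have h1 := (sheafificationAdj X).homEquiv_naturality_left (mulFree U r) z
  refine Eq.trans ?_ (congrArg PresheafOfModules.freeYonedaEquiv h1).symm
  rw [PresheafOfModules.freeYonedaEquiv_comp, mulFree, Equiv.apply_symm_apply, map_smul]
  rfl

end
end Higgs
-- Right derived functors from a two-term resolution of functors
namespace Higgs
noncomputable section
section
variable {C D : Type*} [Category* C] [Category* D] [Abelian C] [Abelian D]

/-- `H⁰(K) ≅ K⁰` for a complex with vanishing differentials in degree zero. -/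
def homologyZeroIso (K : CochainComplex D ℤ) (h : K.d (-1) 0 = 0) (h' : K.d 0 1 = 0) : K.homology 0 ≅ K.X 0 :=
  haveI := K.isIso_iCycles 0 1 (by simp) h'
  haveI := K.isIso_homologyπ (-1) 0 (by simp) h
  (asIso (K.homologyπ 0)).symm ≪≫ asIso (K.iCycles 0)

theorem homologyZeroIso_naturality {K L : CochainComplex D ℤ} (f : K ⟶ L) (h : K.d (-1) 0 = 0) (h' : K.d 0 1 = 0)
    (g : L.d (-1) 0 = 0) (g' : L.d 0 1 = 0) :
    HomologicalComplex.homologyMap f 0 ≫ (homologyZeroIso L g g').hom = (homologyZeroIso K h h').hom ≫ f.f 0 := by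
  have := K.isIso_iCycles 0 1 (by simp) h'
  have := K.isIso_homologyπ (-1) 0 (by simp) h
  have := L.isIso_iCycles 0 1 (by simp) g'
  have := L.isIso_homologyπ (-1) 0 (by simp) g
  rw [← cancel_epi (K.homologyπ 0)]
  simp [homologyZeroIso]

variable [HasDerivedCategory C] [HasDerivedCategory D] [EnoughInjectives C]

/-- A total right derived functor is computed by an injective resolution. -/
theorem exists_resolution (T : C ⥤ D) [T.Additive] (G : C) :
    ∃ (L : CochainComplex C ℤ) (i : (CochainComplex.singleFunctor C 0).obj G ⟶ L), (∀ n, Injective (L.X n)) ∧ QuasiIso i ∧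
      ∀ n, Nonempty ((DerivedCategory.Plus.homologyFunctor D n).obj
        (T.rightDerivedFunctorPlus.obj ((DerivedCategory.Plus.singleFunctor C 0).obj G)) ≅
          ((T.mapHomologicalComplex (.up ℤ)).obj L).homology n) := by
  obtain ⟨L, _, i, hi⟩ := CochainComplex.Plus.exists_quasiIso_injective
    ⟨(CochainComplex.singleFunctor C 0).obj G, 0, inferInstance⟩ 0
  have : QuasiIso i.hom := hi
  let L' := (InjectiveObject.ι C).mapCochainComplexPlus.obj L
  refine ⟨L'.obj, i.hom, fun n => inferInstanceAs (Injective ((InjectiveObject.ι C).obj (L.obj.X n))), hi, fun n => ⟨?_⟩⟩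
  -- `G` becomes isomorphic in the derived category to a complex of injectives, on which the unit of
  -- the derived functor is invertible.
  let e : (DerivedCategory.Plus.singleFunctor C 0).obj G ≅ DerivedCategory.Plus.Qh.obj ((HomotopyCategory.Plus.quotient C).obj L') :=
    DerivedCategory.Plus.ι.preimageIso (((DerivedCategory.singleFunctorIsoCompQ C 0).app G) ≪≫ asIso (DerivedCategory.Q.map i.hom) ≪≫
      ((DerivedCategory.quotientCompQhIso C).app L'.obj).symm)
  exact (DerivedCategory.Plus.homologyFunctor D n).mapIso (T.rightDerivedFunctorPlus.mapIso e ≪≫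
      (asIso (T.rightDerivedFunctorPlusUnit.app ((HomotopyCategory.Plus.quotient C).obj L'))).symm) ≪≫
    (DerivedCategory.homologyFunctor D n).mapIso ((DerivedCategory.quotientCompQhIso D).app ((T.mapHomologicalComplex (.up ℤ)).obj L'.obj)) ≪≫
    (DerivedCategory.homologyFunctorFactors D n).app ((T.mapHomologicalComplex (.up ℤ)).obj L'.obj)

end

section
variable {C D : Type*} [Category* C] [Category* D] [Abelian C] [Abelian D] (T : C ⥤ D) [T.Additive]

theorem mapHomologicalComplex_single_d (G : C) (i j : ℤ) :
    ((T.mapHomologicalComplex (.up ℤ)).obj ((CochainComplex.singleFunctor C 0).obj G)).d i j = 0 := T.map_zero _ _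

/-- `H⁰` of an additive functor applied to a complex concentrated in degree zero. -/
def homologyMapSingleIso (G : C) : ((T.mapHomologicalComplex (.up ℤ)).obj ((CochainComplex.singleFunctor C 0).obj G)).homology 0 ≅ T.obj G :=
  homologyZeroIso _ (mapHomologicalComplex_single_d T G _ _) (mapHomologicalComplex_single_d T G _ _) ≪≫ T.mapIso (HomologicalComplex.singleObjXSelf (.up ℤ) 0 G)

theorem homologyMapSingleIso_naturality {T T' : C ⥤ D} [T.Additive] [T'.Additive] (β : T ⟶ T') (G : C) :
    HomologicalComplex.homologyMap ((NatTrans.mapHomologicalComplex β (.up ℤ)).app ((CochainComplex.singleFunctor C 0).obj G)) 0 ≫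
      (homologyMapSingleIso T' G).hom = (homologyMapSingleIso T G).hom ≫ β.app G := by
  refine (Category.assoc _ _ _).symm.trans ((congrArg (· ≫ (T'.mapIso (HomologicalComplex.singleObjXSelf (.up ℤ) 0 G)).hom)
    (homologyZeroIso_naturality _ (mapHomologicalComplex_single_d T G _ _) (mapHomologicalComplex_single_d T G _ _) _ _)).trans ?_)
  refine (Category.assoc _ _ _).trans (.trans ?_ (Category.assoc _ _ _).symm)
  exact congrArg _ (β.naturality _).symm

theorem isZero_homology_map_single (G : C) (n : ℤ) (hn : n ≠ 0) :
    IsZero (((T.mapHomologicalComplex (.up ℤ)).obj ((CochainComplex.singleFunctor C 0).obj G)).homology n) := by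
  have : IsZero (((T.mapHomologicalComplex (.up ℤ)).obj ((CochainComplex.singleFunctor C 0).obj G)).X n) :=
    T.map_isZero (HomologicalComplex.isZero_single_obj_X _ _ _ _ hn)
  exact (HomologicalComplex.exactAt_iff_isZero_homology _ _).1 (ShortComplex.exact_of_isZero_X₂ _ this)

variable [HasDerivedCategory C] [HasDerivedCategory D] [EnoughInjectives C]

/-- If `0 → T → T₀ → T₁ → 0` is exact on injectives, `T₀` and `T₁` are exact and `T₀ G → T₁ G` is a monomorphism,
then `RT(G)` is concentrated in degree one, where its cohomology is the cokernel of `T₀ G → T₁ G`. -/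
theorem homology_of_resolution {T T₀ T₁ : C ⥤ D} [T.Additive] [T₀.Additive] [T₁.Additive]
    [T₀.PreservesHomology] [T₁.PreservesHomology] (α : T ⟶ T₀) (β : T₀ ⟶ T₁) (w : ∀ I, α.app I ≫ β.app I = 0)
    (h : ∀ I [Injective I], (ShortComplex.mk (α.app I) (β.app I) (w I)).ShortExact) (G : C) [Mono (β.app G)] :
    (∀ n : ℤ, n ≠ 1 → IsZero ((DerivedCategory.Plus.homologyFunctor D n).obj
        (T.rightDerivedFunctorPlus.obj ((DerivedCategory.Plus.singleFunctor C 0).obj G)))) ∧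
    Nonempty ((DerivedCategory.Plus.homologyFunctor D 1).obj
        (T.rightDerivedFunctorPlus.obj ((DerivedCategory.Plus.singleFunctor C 0).obj G)) ≅ cokernel (β.app G)) := by
  obtain ⟨L, i, hL, hi, e⟩ := exists_resolution T G
  let S : ShortComplex (CochainComplex D ℤ) :=
    ShortComplex.mk ((NatTrans.mapHomologicalComplex α (.up ℤ)).app L) ((NatTrans.mapHomologicalComplex β (.up ℤ)).app L)
      (by ext n; exact w _)
  -- The terms of `L` are injective, so the hypothesis applies in each degree.
  have hS : S.ShortExact := HomologicalComplex.shortExact_of_degreewise_shortExact S fun n => h (L.X n)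
  let M := (CochainComplex.singleFunctor C 0).obj G
  -- Exact functors preserve the quasi-isomorphism from `G` to `L`, so `T₀ L` and `T₁ L` have
  -- cohomology only in degree zero, namely `T₀ G` and `T₁ G`.
  let q₀ (n : ℤ) : ((T₀.mapHomologicalComplex (.up ℤ)).obj M).homology n ≅ S.X₂.homology n :=
    asIso (HomologicalComplex.homologyMap ((T₀.mapHomologicalComplex (.up ℤ)).map i) n)
  let q₁ (n : ℤ) : ((T₁.mapHomologicalComplex (.up ℤ)).obj M).homology n ≅ S.X₃.homology n :=
    asIso (HomologicalComplex.homologyMap ((T₁.mapHomologicalComplex (.up ℤ)).map i) n)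
  have z₀ (n : ℤ) (hn : n ≠ 0) : IsZero (S.X₂.homology n) := (isZero_homology_map_single T₀ G n hn).of_iso (q₀ n).symm
  have z₁ (n : ℤ) (hn : n ≠ 0) : IsZero (S.X₃.homology n) := (isZero_homology_map_single T₁ G n hn).of_iso (q₁ n).symm
  have comm : HomologicalComplex.homologyMap S.g 0 ≫ ((q₁ 0).symm ≪≫ homologyMapSingleIso T₁ G).hom =
      ((q₀ 0).symm ≪≫ homologyMapSingleIso T₀ G).hom ≫ β.app G := by
    simp only [Iso.trans_hom, Iso.symm_hom, Category.assoc, ← homologyMapSingleIso_naturality]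
    rw [Iso.eq_inv_comp]
    have : (q₀ 0).hom ≫ HomologicalComplex.homologyMap S.g 0 = HomologicalComplex.homologyMap ((NatTrans.mapHomologicalComplex β (.up ℤ)).app M) 0 ≫ (q₁ 0).hom := by
      simp only [q₀, q₁, asIso_hom, ← HomologicalComplex.homologyMap_comp, S]
      exact congrArg (HomologicalComplex.homologyMap · 0) ((NatTrans.mapHomologicalComplex β (.up ℤ)).naturality i)
    rw [reassoc_of% this]
    simp
    rfl
  have mono_g : Mono (HomologicalComplex.homologyMap S.g 0) := by
    have : Mono (HomologicalComplex.homologyMap S.g 0 ≫ ((q₁ 0).symm ≪≫ homologyMapSingleIso T₁ G).hom) := by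
      rw [comm]; infer_instance
    exact mono_of_mono _ ((q₁ 0).symm ≪≫ homologyMapSingleIso T₁ G).hom
  refine ⟨fun n hn => ?_, ?_⟩
  · refine IsZero.of_iso ?_ (e n).some
    change IsZero (S.X₁.homology n)
    -- The connecting map into `Hⁿ(T L)` starts at `Hⁿ⁻¹(T₁ L)`, which vanishes because `n ≠ 1`.
    have hinj : ∀ m, m + 1 = n → IsZero (S.X₃.homology m) := fun m hm => z₁ m (by lia)
    have ex₁ := hS.homology_exact₁ (n-1) n (by simp)
    have : Mono (HomologicalComplex.homologyMap S.f n) := ex₁.mono_g ((hinj _ (by simp)).eq_of_src _ _)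
    by_cases h0 : n = 0
    · subst h0
      -- In degree zero the target survives, but the map dies after the monomorphism `H⁰(T₀ L) ⟶
      -- H⁰(T₁ L)`. It is thus both zero and mono.
      have : HomologicalComplex.homologyMap S.f 0 = 0 := by
        rw [← cancel_mono (HomologicalComplex.homologyMap S.g 0), ← HomologicalComplex.homologyMap_comp, S.zero]
        simp
      exact IsZero.of_mono_eq_zero _ this
    · exact IsZero.of_mono (HomologicalComplex.homologyMap S.f n) (z₀ n h0)
  · refine ⟨(e 1).some ≪≫ ?_⟩
    change S.X₁.homology 1 ≅ _
    have ex₁ := hS.homology_exact₁ 0 1 (by simp)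
    have ex₃ := hS.homology_exact₃ 0 1 (by simp)
    -- `H¹(T₀ L) = 0`, so the connecting map presents `H¹(T L)` as the cokernel of `H⁰(T₀ L) ⟶ H⁰(T₁
    -- L)`.
    have : Epi (hS.δ 0 1 (by simp)) := ex₁.epi_f ((z₀ 1 (by simp)).eq_of_tgt _ _)
    exact (IsColimit.coconePointUniqueUpToIso (cokernelIsCokernel (HomologicalComplex.homologyMap S.g 0)) ex₃.gIsCokernel).symm ≪≫
      cokernel.mapIso _ _ _ _ comm

end
end
end Higgs
-- The total space of a line bundle is locally an affine line
namespace Higgs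
noncomputable section
variable {X : Scheme.{u}}

section totalSpace
variable {S : Scheme.{u}} {T : Scheme.{u}}

/-- The comparison `g^* π^* ≅ (g ≫ π)^*` is conjugate to the comparison of pushforwards, hence
compatible with the adjunction units. -/
theorem pullbackComp_pullSec (g : T ⟶ X) (π : X ⟶ S) {L : S.Modules} {U : S.Opens} (k : Γ(L, U)) :
    ((Scheme.Modules.pullbackComp g π).hom.app L).app (g ⁻¹ᵁ π ⁻¹ᵁ U) (pullSec g (pullSec π k)) = pullSec (g ≫ π) k := by
  have h := unit_conjugateEquiv ((Scheme.Modules.pullbackPushforwardAdjunction π).comp (Scheme.Modules.pullbackPushforwardAdjunction g))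
    (Scheme.Modules.pullbackPushforwardAdjunction (g ≫ π)) (Scheme.Modules.pullbackComp g π).inv L
  rw [Scheme.Modules.conjugateEquiv_pullbackComp_inv] at h
  have h1 : pullSec g (pullSec π k) = ((Scheme.Modules.pullbackComp g π).inv.app L).app (g ⁻¹ᵁ π ⁻¹ᵁ U) (pullSec (g ≫ π) k) := by
    exact congrArg (fun h => Scheme.Modules.Hom.app h U k) h
  rw [h1]
  exact congrArg (fun h => Scheme.Modules.Hom.app h (g ⁻¹ᵁ π ⁻¹ᵁ U) (pullSec (g ≫ π) k)) ((Scheme.Modules.pullbackComp g π).inv_hom_id_app L)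

/-- Translates the universal property: in the frame `k`, the section attached to a morphism `g` is
the function `g^# t`. -/
theorem res_pullbackComp_pullbackSection (g : T ⟶ X) (π : X ⟶ S) {L : S.Modules} {U : S.Opens} {k : Γ(L, U)}
    {τ : Γ((Scheme.Modules.pullback π).obj L, ⊤)} {t : Γ(X, π ⁻¹ᵁ U)} (ht : res _ le_top τ = t • pullSec π k) :
    res _ (le_top : (g ≫ π) ⁻¹ᵁ U ≤ ⊤) (((Scheme.Modules.pullbackComp g π).hom.app L).app ⊤ (pullbackSection g τ)) =
      (show Γ(T, (g ≫ π) ⁻¹ᵁ U) from g.app (π ⁻¹ᵁ U) t) • pullSec (g ≫ π) k := by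
  refine (app_res ((Scheme.Modules.pullbackComp g π).hom.app L) le_top _).symm.trans ?_
  rw [← pullbackComp_pullSec]
  refine Eq.trans ?_ (app_smul _ _ _)
  refine congrArg _ ?_
  refine Eq.trans ?_ (pullSec_smul g t (pullSec π k))
  rw [← ht]
  exact (pullSec_res g (le_top : π ⁻¹ᵁ U ≤ ⊤) le_top τ).symm

theorem exists_res_eq (M : X.Modules) {W : X.Opens} (hW : W = ⊤) (y : Γ(M, W)) : ∃ x, res M le_top x = y := by
  subst hW; exact ⟨y, res_self _ _ _⟩

theorem res_top_injective (M : X.Modules) {W : X.Opens} (hW : W = ⊤) : Function.Injective (res M (le_top : W ≤ ⊤)) := by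
  subst hW; exact fun x y h => by simpa only [res_self] using h

variable {L : S.Modules} {π : X ⟶ S} {τ : Γ((Scheme.Modules.pullback π).obj L, ⊤)}
variable {U : S.Opens} {k : Γ(L, U)} {t : Γ(X, π ⁻¹ᵁ U)}

theorem IsTotalSpace.hom_ext (hX : IsTotalSpace L π τ) (ht : res _ le_top τ = t • pullSec π k)
    {g g' : T ⟶ X} (h : g ≫ π = g' ≫ π) (hg : ⊤ ≤ g ⁻¹ᵁ π ⁻¹ᵁ U) (hg' : ⊤ ≤ g' ⁻¹ᵁ π ⁻¹ᵁ U)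
    (e : g.appLE (π ⁻¹ᵁ U) ⊤ hg t = g'.appLE (π ⁻¹ᵁ U) ⊤ hg' t) : g = g' := by
  apply (hX T).1
  -- The sections live over base maps that are only propositionally equal; with the base maps as
  -- variables, the equality can be substituted.
  have key (f f' : T ⟶ S) (s : Γ((Scheme.Modules.pullback f).obj L, ⊤)) (s' : Γ((Scheme.Modules.pullback f').obj L, ⊤))
      (hf : f = f') (hU : f ⁻¹ᵁ U = ⊤) (r : Γ(T, ⊤)) (hs : res _ le_top s = ores (le_top : f ⁻¹ᵁ U ≤ ⊤) r • pullSec f k)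
      (hs' : res _ le_top s' = ores (le_top : f' ⁻¹ᵁ U ≤ ⊤) r • pullSec f' k) :
      (⟨f, s⟩ : Σ f : T ⟶ S, Γ((Scheme.Modules.pullback f).obj L, ⊤)) = ⟨f', s'⟩ := by
    subst hf
    rw [res_top_injective _ hU (hs.trans hs'.symm)]
  have app_eq (g : T ⟶ X) (hg) : ores le_top (g.appLE (π ⁻¹ᵁ U) ⊤ hg t) = g.app (π ⁻¹ᵁ U) t := by
    rw [Scheme.Hom.appLE]
    exact (ores_ores _ _ _).trans (ores_self _ _)
  refine key _ _ _ _ h (top_le_iff.1 hg) (g.appLE (π ⁻¹ᵁ U) ⊤ hg t) ?_ ?_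
  · rw [res_pullbackComp_pullbackSection g π ht]
    exact congrArg (· • _) (app_eq g hg).symm
  · rw [res_pullbackComp_pullbackSection g' π ht, e]
    exact congrArg (· • _) (app_eq g' hg').symm

/-- The universal property is applied to the section `r k`. Since `k` is a basis, comparing with
`g^*τ = g^#(t) k` gives `g^#(t) = r`. -/
theorem IsTotalSpace.exists_hom (hX : IsTotalSpace L π τ) (hk : IsBasisOn L U (fun _ : Unit => k)) (ht : res _ le_top τ = t • pullSec π k)
    (f : T ⟶ S) (hf : f ⁻¹ᵁ U = ⊤) (r : Γ(T, ⊤)) :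
    ∃ g : T ⟶ X, g ≫ π = f ∧ ∃ hg : ⊤ ≤ g ⁻¹ᵁ π ⁻¹ᵁ U, g.appLE (π ⁻¹ᵁ U) ⊤ hg t = r := by
  obtain ⟨s, hs⟩ := exists_res_eq _ hf (ores (le_top : f ⁻¹ᵁ U ≤ ⊤) r • pullSec f k)
  obtain ⟨g, hg⟩ := (hX T).2 ⟨f, s⟩
  obtain ⟨rfl, hg⟩ := Sigma.mk.inj hg
  rw [← eq_of_heq hg, res_pullbackComp_pullbackSection g π ht] at hs
  have h1 := ((hk.pullback (g ≫ π)) _ le_rfl).1 (a₁ := fun _ => g.app (π ⁻¹ᵁ U) t) (a₂ := fun _ => ores le_top r) (by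
    refine (Fintype.sum_unique _).trans (.trans ?_ (Fintype.sum_unique _).symm)
    rw [res_self]
    exact hs)
  refine ⟨g, rfl, hf.ge, ?_⟩
  have h2 : ores hf.ge (g.app (π ⁻¹ᵁ U) t) = ores hf.ge (ores le_top r) := congrArg _ (congrFun h1 ())
  exact h2.trans ((ores_ores _ _ _).trans (ores_self _ _))

/-- Over an affine open set on which `L` is generated by `k`, the total space of `L` is the affine line with coordinate `τ / k`. -/
theorem IsTotalSpace.isAffineOpen_preimage (hX : IsTotalSpace L π τ) (hU : IsAffineOpen U) (hk : IsBasisOn L U (fun _ : Unit => k))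
    (ht : res _ le_top τ = t • pullSec π k) :
    IsAffineOpen (π ⁻¹ᵁ U) ∧ Function.Bijective (Polynomial.eval₂RingHom (π.app U).hom t) := by
  let B : CommRingCat.{u} := CommRingCat.of (Polynomial Γ(S, U))
  let c : Γ(S, U) ⟶ B := CommRingCat.ofHom Polynomial.C
  let ψ : B ⟶ Γ(X, π ⁻¹ᵁ U) := CommRingCat.ofHom (Polynomial.eval₂RingHom (π.app U).hom t)
  have hψ : c ≫ ψ = π.app U := CommRingCat.hom_ext (RingHom.ext fun x => Polynomial.eval₂_C _ _)
  obtain ⟨ξ, hξ⟩ : ∃ ξ : B, ξ = (Polynomial.X (R := Γ(S, U))) := ⟨_, rfl⟩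
  have hψX : ψ ξ = t := by rw [hξ]; exact Polynomial.eval₂_X _ _
  -- The candidate inverse: the map from the affine line over `U` whose coordinate is the variable
  -- `ξ`.
  obtain ⟨g, hg, hg', hgt⟩ := hX.exists_hom hk ht (Spec.map c ≫ hU.fromSpec)
    (by rw [Scheme.Hom.comp_preimage, hU.fromSpec_preimage_self]; rfl) ((Scheme.ΓSpecIso B).inv ξ)
  let V := π ⁻¹ᵁ U
  let g' : Spec B ⟶ V := IsOpenImmersion.lift V.ι g (by
    rw [Scheme.Opens.range_ι]
    rintro _ ⟨x, rfl⟩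
    exact hg' (Set.mem_univ x))
  have hg'ι : g' ≫ V.ι = g := IsOpenImmersion.lift_fac _ _ _
  let h : V.toScheme ⟶ Spec B := V.toSpecΓ ≫ Spec.map ψ
  have hh : h ≫ Spec.map c ≫ hU.fromSpec = V.ι ≫ π := by
    simp only [h, Category.assoc]
    rw [← Spec.map_comp_assoc, hψ, Scheme.Opens.toSpecΓ_naturality_assoc, IsAffineOpen.toSpecΓ_fromSpec, morphismRestrict_ι]
  have hhX : h.appTop ((Scheme.ΓSpecIso B).inv ξ) = V.topIso.inv t := by
    rw [← hψX]
    have : (Scheme.ΓSpecIso B).inv ≫ h.appTop = ψ ≫ V.topIso.inv := by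
      rw [Scheme.Hom.comp_appTop, Scheme.Opens.toSpecΓ_appTop, ← Scheme.ΓSpecIso_inv_naturality_assoc, Iso.inv_hom_id_assoc]
    exact ConcreteCategory.congr_hom this ξ
  have hι (e : ⊤ ≤ V.ι ⁻¹ᵁ V) : V.ι.appLE V ⊤ e t = V.topIso.inv t := by
    rw [Scheme.Opens.ι_appLE]; rfl
  -- Both sides lie over `π` and have coordinate `t`, so uniqueness in the universal property
  -- applies.
  have e1 : h ≫ g = V.ι := by
    refine hX.hom_ext ht (by rw [Category.assoc, hg, hh]) (by rw [Scheme.Hom.comp_preimage]; exact h.preimage_mono hg') (by rw [Scheme.Opens.ι_preimage_self]) ?_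
    rw [← Scheme.Hom.appLE_comp_appLE h g V ⊤ ⊤ hg' le_rfl]
    refine (congrArg (h.appLE ⊤ ⊤ le_rfl) hgt).trans ?_
    refine (ConcreteCategory.congr_hom (Scheme.Hom.appLE_eq_app h (U := ⊤)) _).trans (hhX.trans ?_)
    exact (hι _).symm
  have e2 : h ≫ g' = 𝟙 _ := by
    rw [← cancel_mono V.ι, Category.assoc, hg'ι, e1, Category.id_comp]
  -- An endomorphism of `Spec B` is a ring endomorphism `χ` of the polynomial ring, and `χ` fixes
  -- the constants and the variable.
  have e3 : g' ≫ h = 𝟙 _ := by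
    obtain ⟨χ, hχ⟩ := Spec.map_surjective (g' ≫ h)
    have h1 : c ≫ χ = c := by
      apply Spec.map_injective
      rw [Spec.map_comp, hχ, ← cancel_mono hU.fromSpec, Category.assoc, Category.assoc, hh, ← Category.assoc, hg'ι, hg]
    have h2 : χ ξ = ξ := by
      have h3 : g'.appTop (h.appTop ((Scheme.ΓSpecIso B).inv ξ)) = (Scheme.ΓSpecIso B).inv ξ := by
        rw [hhX, ← hgt]
        have key (g₀ : Spec B ⟶ X) (e : g' ≫ V.ι = g₀) (h₀ : ⊤ ≤ g₀ ⁻¹ᵁ V) : g'.appTop (V.topIso.inv t) = g₀.appLE V ⊤ h₀ t := by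
          subst e
          rw [← Scheme.Hom.appLE_comp_appLE g' V.ι V ⊤ ⊤ (by rw [Scheme.Opens.ι_preimage_self]) (le_rfl : (⊤ : (Spec B).Opens) ≤ ⊤), ← hι (by rw [Scheme.Opens.ι_preimage_self])]
          exact (ConcreteCategory.congr_hom (Scheme.Hom.appLE_eq_app g' (U := ⊤)) _).symm
        exact key g hg'ι hg'
      have h4 : (Scheme.ΓSpecIso B).inv ≫ (Spec.map χ).appTop = χ ≫ (Scheme.ΓSpecIso B).inv := by simp
      rw [hχ] at h4
      exact (ConcreteCategory.bijective_of_isIso (Scheme.ΓSpecIso B).inv).1 ((ConcreteCategory.congr_hom h4 ξ).symm.trans h3)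
    have h5 : χ = 𝟙 _ := CommRingCat.hom_ext (Polynomial.ringHom_ext (fun a => ConcreteCategory.congr_hom h1 a) (by rw [hξ] at h2; exact h2))
    rw [← hχ, h5, Spec.map_id]
  have : IsIso h := ⟨g', e2, e3⟩
  have hV : IsAffineOpen V := IsAffine.of_isIso h
  refine ⟨hV, ?_⟩
  have : IsIso V.toSpecΓ := inferInstanceAs (IsIso hV.isoSpec.hom)
  have : IsIso (Spec.map ψ) := IsIso.of_isIso_comp_left V.toSpecΓ _
  exact isIso_SpecMap_iff.1 this
end totalSpace

end
end Higgs
-- The canonical sheaf is locally free of rank one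
namespace Higgs
noncomputable section
variable {X : Scheme.{u}}

/-- Injectivity over all smaller open sets makes the coefficients of local expansions unique, so
each coefficient glues. -/
theorem isBasisOn_of_locally {ι : Type*} [Fintype ι] {N : X.Modules} {U : X.Opens} (b : ι → Γ(N, U))
    (inj : ∀ V (hV : V ≤ U), Function.Injective (fun c : ι → Γ(X, V) => ∑ i, c i • res N hV (b i)))
    (surj : ∀ V (hV : V ≤ U) (y : Γ(N, V)), ∀ p ∈ V, ∃ (W : X.Opens) (hW : W ≤ V), p ∈ W ∧
      ∃ c : ι → Γ(X, W), ∑ i, c i • res N (hW.trans hV) (b i) = res N hW y) : IsBasisOn N U b := by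
  have res_sum {V W W' : X.Opens} (hV : V ≤ U) (hW : W ≤ V) (hW' : W' ≤ W) (y : Γ(N, V)) (c : ι → Γ(X, W))
      (hc : ∑ i, c i • res N (hW.trans hV) (b i) = res N hW y) :
      ∑ i, ores hW' (c i) • res N ((hW'.trans hW).trans hV) (b i) = res N (hW'.trans hW) y := by
    rw [← res_res N hW hW', ← hc, map_sum]
    exact Finset.sum_congr rfl fun j _ => by rw [res_smul, res_res]
  refine fun V hV => ⟨inj V hV, fun y => ?_⟩
  have loc (i : ι) : ∃ t : Γ(X, V), ∀ p ∈ V, ∃ (W : X.Opens) (hW : W ≤ V), p ∈ W ∧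
      ∃ c : ι → Γ(X, W), c i = ores hW t ∧ ∑ j, c j • res N (hW.trans hV) (b j) = res N hW y := by
    refine section_glue (structureSheaf X) (U := V) (fun W hW t => ∃ c : ι → Γ(X, W), c i = t ∧ ∑ j, c j • res N (hW.trans hV) (b j) = res N hW y) ?_ ?_ ?_
    · rintro W hW W' h _ ⟨c, rfl, hc⟩
      exact ⟨fun j => ores h (c j), rfl, res_sum hV hW h y c hc⟩
    · rintro W hW _ _ ⟨c, rfl, hc⟩ ⟨c', rfl, hc'⟩
      rw [inj W (hW.trans hV) (hc.trans hc'.symm)]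
    · intro p hp
      obtain ⟨W, hW, hpW, c, hc⟩ := surj V hV y p hp
      exact ⟨W, hW, hpW, c i, c, rfl, hc⟩
  choose t ht using loc
  refine ⟨t, section_ext _ _ _ fun p hp => ?_⟩
  choose W hW hpW c hc hc' using fun i => ht i p hp
  obtain ⟨W₀, hW₀, hpW₀, c₀, hc₀⟩ := surj V hV y p hp
  -- Each glued coefficient comes with its own local expansion. On a common neighbourhood all of
  -- them are compared with the single expansion `c₀`.
  obtain ⟨W', hW', hpW', h⟩ := exists_common_nhd (U := W₀) p hpW₀ (fun i V' => V' ≤ W i) (fun i V W h h' => h.trans h')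
    (fun i => ⟨W₀ ⊓ W i, inf_le_left, ⟨hpW₀, hpW i⟩, inf_le_right⟩)
  refine ⟨W', hW'.trans hW₀, hpW', ?_⟩
  have hcc := res_sum hV hW₀ hW' y c₀ hc₀
  refine Eq.trans ?_ hcc
  rw [map_sum]
  refine Finset.sum_congr rfl fun j _ => ?_
  rw [res_smul, res_res]
  have h1 := congrFun (inj W' ((hW'.trans hW₀).trans hV) (hcc.trans (res_sum hV (hW j) (h j) y (c j) (hc' j)).symm)) j
  rw [h1, hc j, ores_ores]

/-- A family of sections of a presheaf that is a basis on arbitrarily small open sets gives a basis of the associated sheaf. -/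
theorem isBasisOn_sheafification {ι : Type*} [Fintype ι] (P : X.PresheafOfModules) {N : X.Modules} (f : P ⟶ N.val)
    (fsurj : ∀ {U : X.Opens} (y : Γ(N, U)), ∀ p ∈ U, ∃ (V : X.Opens) (hV : V ≤ U), p ∈ V ∧ ∃ x : P.obj (op V), f.app (op V) x = res _ hV y)
    (finj : ∀ {U : X.Opens} (x : P.obj (op U)), f.app (op U) x = 0 → ∀ p ∈ U, ∃ (V : X.Opens) (hV : V ≤ U), p ∈ V ∧ P.map (homOfLE hV).op x = 0)
    {U : X.Opens} (b : ι → P.obj (op U)) (b' : ι → Γ(N, U)) (hb' : ∀ i, f.app (op U) (b i) = b' i)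
    (H : ∀ V ≤ U, ∀ p ∈ V, ∃ (W : X.Opens) (h : W ≤ U), W ≤ V ∧ p ∈ W ∧
      Function.Bijective (fun c : ι → X.ringCatSheaf.obj.obj (op W) => ∑ i, c i • P.map (homOfLE h).op (b i))) :
    IsBasisOn N U b' := by
  have key {V : X.Opens} (hV : V ≤ U) (c : ι → Γ(X, V)) : f.app (op V) (∑ i, (show X.ringCatSheaf.obj.obj (op V) from c i) • P.map (homOfLE hV).op (b i)) =
      ∑ i, c i • res N hV (b' i) := by
    refine (map_sum (f.app (op V)).hom _ _).trans (Finset.sum_congr rfl fun i _ => ?_)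
    refine (map_smul (f.app (op V)).hom _ _).trans ?_
    rw [← hb']
    exact congrArg (fun x : Γ(N, V) => c i • x) (PresheafOfModules.naturality_apply f (homOfLE hV).op (b i))
  have key' {V W : X.Opens} (hV : V ≤ U) (hW : W ≤ V) (c : ι → Γ(X, V)) : P.map (homOfLE hW).op (∑ i, (show X.ringCatSheaf.obj.obj (op V) from c i) • P.map (homOfLE hV).op (b i)) =
      ∑ i, (show X.ringCatSheaf.obj.obj (op W) from ores hW (c i)) • P.map (homOfLE (hW.trans hV)).op (b i) := by
    refine (map_sum (P.map (homOfLE hW).op).hom _ _).trans (Finset.sum_congr rfl fun i _ => ?_)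
    refine (PresheafOfModules.map_smul _ _ _ _).trans ?_
    refine congrArg _ ?_
    exact (PresheafOfModules.map_comp_apply P (homOfLE hV).op (homOfLE hW).op (b i)).symm
  refine isBasisOn_of_locally b' (fun V hV => ?_) (fun V hV y p hp => ?_)
  · refine (injective_iff_map_eq_zero (Fintype.linearCombination Γ(X, V) (fun i => res N hV (b' i)))).2 fun c hc => funext fun i => ?_
    refine section_ext (structureSheaf X) _ _ fun p hp => ?_
    obtain ⟨W, hW, hpW, h0⟩ := finj _ ((key hV c).trans hc) p hp
    obtain ⟨W', hW'U, hW', hpW', hbij⟩ := H W (hW.trans hV) p hpW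
    refine ⟨W', hW'.trans hW, hpW', ?_⟩
    have h1 := (key' hV (hW'.trans hW) c).symm.trans ((PresheafOfModules.map_comp_apply P (homOfLE hW).op (homOfLE hW').op _).trans ((congrArg _ h0).trans (map_zero (P.map (homOfLE hW').op).hom)))
    have h2 := @hbij.1 (fun i => ores (hW'.trans hW) (c i)) 0 (h1.trans (Finset.sum_eq_zero fun i _ => zero_smul _ _).symm)
    exact (congrFun h2 i).trans (map_zero (ores (hW'.trans hW))).symm
  · obtain ⟨W, hW, hpW, x, hx⟩ := fsurj y p hp
    obtain ⟨W', hW'U, hW', hpW', hbij⟩ := H W (hW.trans hV) p hpW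
    obtain ⟨c, hc⟩ := hbij.2 (P.map (homOfLE hW').op x)
    refine ⟨W', hW'.trans hW, hpW', c, ?_⟩
    refine (key hW'U c).symm.trans ((congrArg (f.app (op W')) hc).trans ?_)
    refine (PresheafOfModules.naturality_apply f (homOfLE hW').op x).trans ?_
    exact (congrArg (res N hW') hx).trans (res_res N hW hW' y)

section algebra
open KaehlerDifferential

/-- The basis of the top exterior power is indexed by the `n`-element subsets of `Fin n`; there is
only one, and its increasing enumeration is the identity. -/
theorem bijective_smul_ιMulti {R M : Type*} [CommRing R] [AddCommGroup M] [Module R M] {n : ℕ} (b : Module.Basis (Fin n) R M) :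
    Function.Bijective (fun c : R => c • exteriorPower.ιMulti R n b) := by
  let s : Set.powersetCard (Fin n) n := ⟨Finset.univ, by simp⟩
  have hs (t : Set.powersetCard (Fin n) n) : t = s := Subtype.ext ((Finset.card_eq_iff_eq_univ _).1 (by simp))
  let _ : Unique (Set.powersetCard (Fin n) n) := ⟨⟨s⟩, hs⟩
  have h := (b.exteriorPower n).equivFun.symm.bijective.comp (Equiv.funUnique (Set.powersetCard (Fin n) n) R).symm.bijective
  have hs' : Set.powersetCard.ofFinEmbEquiv.symm s = OrderEmbedding.id (Fin n) :=
    Set.powersetCard.ofFinEmbEquiv.injective ((Equiv.apply_symm_apply _ _).trans (hs _).symm)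
  convert h using 2 with c
  simp [Module.Basis.equivFun_symm_apply, exteriorPower.ιMulti_family]
  have hd : (default : Set.powersetCard (Fin n) n) = s := hs _
  rw [hd, hs']
  rfl

theorem exists_basis_kaehlerDifferential {A B : CommRingCat.{u}} (f : A ⟶ B) [Nontrivial B] (n : ℕ) (hf : f.hom.IsStandardSmoothOfRelativeDimension n) :
    Nonempty (Module.Basis (Fin n) B (CommRingCat.KaehlerDifferential f)) := by
  let _ := f.hom.toAlgebra
  have : Algebra.IsStandardSmoothOfRelativeDimension n A B := hf
  have : Algebra.IsStandardSmooth A B := Algebra.IsStandardSmoothOfRelativeDimension.isStandardSmooth n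
  have h := Algebra.IsStandardSmoothOfRelativeDimension.rank_kaehlerDifferential (R := A) (S := B) n
  exact ⟨(Module.finBasisOfFinrankEq B (Ω[B⁄A]) (Module.finrank_eq_of_rank_eq h))⟩

/-- Differentials `dx` span, so compatibility with `d` forces `φ` to be the canonical map, and
Kähler differentials localize along it. Applied to the restriction to a basic open set. -/
theorem exists_basis_kaehlerDifferential_of_isLocalization {A B B' : CommRingCat.{u}} (f : A ⟶ B) (f' : A ⟶ B') (g : B ⟶ B') (w : f ≫ g = f') (r : B)
    (hg : letI := g.hom.toAlgebra; IsLocalization.Away r B') {n : ℕ} (b : Module.Basis (Fin n) B (CommRingCat.KaehlerDifferential f))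
    (φ : CommRingCat.KaehlerDifferential f ⟶ (ModuleCat.restrictScalars g.hom).obj (CommRingCat.KaehlerDifferential f'))
    (hφ : ∀ x, φ (CommRingCat.KaehlerDifferential.d x) = CommRingCat.KaehlerDifferential.d (f := f') (g x)) :
    ∃ b' : Module.Basis (Fin n) B' (CommRingCat.KaehlerDifferential f'), ∀ i, b' i = φ (b i) := by
  let _ := f.hom.toAlgebra
  let _ := f'.hom.toAlgebra
  let _ := g.hom.toAlgebra
  have : IsScalarTower A B B' := IsScalarTower.of_algebraMap_eq' (congrArg CommRingCat.Hom.hom w).symm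
  have : IsLocalization (Submonoid.powers r) B' := hg
  let b₀ : Module.Basis (Fin n) B (Ω[B⁄A]) := b
  let φ₀ : Ω[B⁄A] →ₗ[B] Ω[B'⁄A] :=
    { toFun := φ
      map_add' := map_add φ.hom
      map_smul' := map_smul φ.hom }
  let b₁ : Module.Basis (Fin n) B' (Ω[B'⁄A]) := b₀.ofIsLocalizedModule B' (Submonoid.powers r) (KaehlerDifferential.map A A B B')
  refine ⟨b₁, fun i => ?_⟩
  have e : KaehlerDifferential.map A A B B' = φ₀ := by
    refine LinearMap.ext_on_range (KaehlerDifferential.span_range_derivation A B) fun x => ?_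
    rw [KaehlerDifferential.map_D]
    exact (hφ x).symm
  have h : b₁ i = KaehlerDifferential.map A A B B' (b₀ i) := Module.Basis.ofIsLocalizedModule_apply ..
  exact h.trans (congrArg (fun h => h (b₀ i)) e)
end algebra

section
variable {A : CommRingCat.{u}} (f : X ⟶ Spec A)

/-- The spectrum of a field is a point, so the affine chart of the base supplied by smoothness is
the whole base, and its ring of functions is `A`. -/
theorem exists_isStandardSmooth_of_field (hA : IsField A) (n : ℕ) [SmoothOfRelativeDimension n f] (p : X) :
    ∃ V : X.Opens, IsAffineOpen V ∧ p ∈ V ∧ ((constToPresheaf f).app (op V)).hom.IsStandardSmoothOfRelativeDimension n := by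
  obtain ⟨U, hU, V, hV, hp, e, h⟩ := SmoothOfRelativeDimension.exists_isStandardSmoothOfRelativeDimension (n := n) (f := f) p
  let _ := hA.toField
  have : Subsingleton (Spec A) := inferInstanceAs (Subsingleton (PrimeSpectrum A))
  obtain rfl : U = ⊤ := top_le_iff.1 fun q _ => by
    have := e hp
    rwa [Subsingleton.elim q (f p)]
  refine ⟨V, hV, hp, ?_⟩
  have := RingHom.isStandardSmoothOfRelativeDimension_respectsIso (n := n)
  exact this.2 _ (Scheme.ΓSpecIso A).symm.commRingCatIsoToRingEquiv h

/-- On a scheme that is smooth of relative dimension `n` over a field, `Ωⁿ` is locally free of rank one. -/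
theorem exists_generator_canonicalSheaf (hA : IsField A) (n : ℕ) [SmoothOfRelativeDimension n f] (p : X) :
    ∃ (U : X.Opens) (k : Γ(canonicalSheaf f n, U)), p ∈ U ∧ IsBasisOn (canonicalSheaf f n) U (fun _ : Unit => k) := by
  obtain ⟨U, hU, hp, hs⟩ := exists_isStandardSmooth_of_field f hA n p
  have : Nonempty U := ⟨⟨p, hp⟩⟩
  have : Nontrivial Γ(X, U) := inferInstance
  obtain ⟨b⟩ := exists_basis_kaehlerDifferential _ n hs
  let P := extPower (R := X.presheaf) (differentials f) n
  let k₀ : P.obj (op U) := exteriorPower.ιMulti Γ(X, U) n b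
  refine ⟨U, _, hp, isBasisOn_sheafification P ((sheafificationAdj X).unit.app P) (sheafification_unit_locally_surjective P)
    (sheafification_unit_locally_injective P) (fun _ : Unit => k₀) _ (fun _ => rfl) fun V hV q hq => ?_⟩
  -- Basic open sets are small enough, and over them the presheaf is free on the restriction of `k₀`
  -- even before sheafification.
  obtain ⟨r, hr, hqr⟩ := hU.exists_basicOpen_le ⟨q, hq⟩ (hV hq)
  refine ⟨X.basicOpen r, X.basicOpen_le r, hr, hqr, ?_⟩
  obtain ⟨b', hb'⟩ := exists_basis_kaehlerDifferential_of_isLocalization ((constToPresheaf f).app (op U))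
    ((constToPresheaf f).app (op (X.basicOpen r))) (X.presheaf.map (homOfLE (X.basicOpen_le r)).op)
    (((constToPresheaf f).naturality (homOfLE (X.basicOpen_le r)).op).symm.trans (Category.id_comp _)) r (hU.isLocalization_basicOpen r) b
    ((differentials f).map (homOfLE (X.basicOpen_le r)).op) (fun x => PresheafOfModules.DifferentialsConstruction.relativeDifferentials'_map_d _ _ x)
  have h := bijective_smul_ιMulti b'
  have hk : P.map (homOfLE (X.basicOpen_le r)).op k₀ = exteriorPower.ιMulti Γ(X, X.basicOpen r) n b' := by
    refine (extMap_mk (R := X.presheaf) (differentials f) n (homOfLE (X.basicOpen_le r)).op b).trans ?_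
    exact congrArg _ (funext fun i => (hb' i).symm)
  have h2 := h.comp (Equiv.funUnique Unit Γ(X, X.basicOpen r)).bijective
  refine (congrArg Function.Bijective (funext fun c => ?_)).mpr h2
  refine (Fintype.sum_unique (ι := Unit) (M := P.obj (op (X.basicOpen r))) _).trans ?_
  exact congrArg _ hk
end

end
end Higgs
-- Local bases of locally free sheaves of finite type
namespace Higgs
noncomputable section
variable {X : Scheme.{u}}

section overSite
variable {M N : X.Modules} {U : X.Opens}

/-- A morphism of restrictions to the site of open subsets of `U` as a local morphism. -/
def localHomOfOver (f : SheafOfModules.over M U ⟶ SheafOfModules.over N U) : localHom M N U :=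
  ⟨fun V => (f.val.app (op (Over.mk (homOfLE V.2)))).hom, fun V W h m => by
    exact (PresheafOfModules.naturality_apply f.val (Over.homMk (homOfLE h) : Over.mk (homOfLE W.2) ⟶ Over.mk (homOfLE V.2)).op m).symm⟩

/-- A local morphism as a morphism of restrictions to the site of open subsets of `U`. -/
def overOfLocalHom (f : localHom M N U) : SheafOfModules.over M U ⟶ SheafOfModules.over N U where
  val :=
   { app V := show M.val.obj (op V.unop.left) ⟶ N.val.obj (op V.unop.left) from ModuleCat.ofHom (f.1 ⟨V.unop.left, leOfHom V.unop.hom⟩)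
     naturality {V W} i := by
       ext m
       exact (f.2 ⟨V.unop.left, leOfHom V.unop.hom⟩ ⟨W.unop.left, leOfHom W.unop.hom⟩ (leOfHom i.unop.left) m).symm }

/-- The section over `U` underlying a section of the restriction of `M` to `U`. -/
def overSection (s : (SheafOfModules.over M U).sections) : Γ(M, U) := s.val (op (Over.mk (𝟙 U)))

/-- A section over `U` as a section of the restriction of `M` to `U`. -/
def sectionOver (x : Γ(M, U)) : (SheafOfModules.over M U).sections :=
  PresheafOfModules.sectionsMk (fun V => (res M (leOfHom V.unop.hom) x : Γ(M, V.unop.left))) (fun V W i => by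
    exact res_res M (leOfHom V.unop.hom) (leOfHom i.unop.left) x)

theorem sectionOver_overSection (s : (SheafOfModules.over M U).sections) : sectionOver (overSection s) = s := by
  refine PresheafOfModules.sections_ext _ _ fun V => ?_
  exact PresheafOfModules.sections_property s (Over.homMk (V.unop.hom) : V.unop ⟶ Over.mk (𝟙 U)).op

theorem overSection_sectionOver (x : Γ(M, U)) : overSection (sectionOver x) = x := res_self M le_rfl x

theorem overSection_sectionsMap (f : SheafOfModules.over M U ⟶ SheafOfModules.over N U) (s : (SheafOfModules.over M U).sections) :
    overSection (SheafOfModules.sectionsMap f s) = (localHomOfOver f).1 ⟨U, le_rfl⟩ (overSection s) := rfl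

/-- Generating sections amount to an epimorphism from a free sheaf, and morphisms out of a free
sheaf are read off on the generators. -/
theorem localHom_eq_of_epi {I : Type u} (s : I → (SheafOfModules.over M U).sections)
    [Epi ((SheafOfModules.over M U).freeHomEquiv.symm s)] {f g : localHom M N U}
    (h : ∀ i, f.1 ⟨U, le_rfl⟩ (overSection (s i)) = g.1 ⟨U, le_rfl⟩ (overSection (s i))) : f = g := by
  have : overOfLocalHom f = overOfLocalHom g := by
    rw [← cancel_epi ((SheafOfModules.over M U).freeHomEquiv.symm s)]
    rw [SheafOfModules.freeHomEquiv_symm_comp, SheafOfModules.freeHomEquiv_symm_comp]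
    refine congrArg _ (funext fun i => ?_)
    rw [← sectionOver_overSection (SheafOfModules.sectionsMap (overOfLocalHom f) (s i)), ← sectionOver_overSection (SheafOfModules.sectionsMap (overOfLocalHom g) (s i))]
    exact congrArg sectionOver (h i)
  exact congrArg localHomOfOver this

theorem exists_localHom_of_isIso {I : Type u} (s : I → (SheafOfModules.over M U).sections)
    [IsIso ((SheafOfModules.over M U).freeHomEquiv.symm s)] (x : I → Γ(N, U)) :
    ∃ f : localHom M N U, ∀ i, f.1 ⟨U, le_rfl⟩ (overSection (s i)) = x i := by
  let p := (SheafOfModules.over M U).freeHomEquiv.symm s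
  let g := (SheafOfModules.over N U).freeHomEquiv.symm (fun i => sectionOver (x i))
  refine ⟨localHomOfOver (inv p ≫ g), fun i => ?_⟩
  rw [← overSection_sectionsMap, ← overSection_sectionOver (x i)]
  refine congrArg overSection ?_
  have h : p ≫ inv p ≫ g = g := IsIso.hom_inv_id_assoc p g
  rw [SheafOfModules.freeHomEquiv_symm_comp] at h
  exact congrFun ((SheafOfModules.over N U).freeHomEquiv.symm.injective h) i
end overSite

/-- A morphism over `V` into `N` is a morphism over `U` into `j_* j^* N`. Since the hypothesis over
`U` allows every target, it passes to smaller open sets. -/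
theorem localHom_eq_of_le {M N : X.Modules} {U V : X.Opens} (hV : V ≤ U) {I : Type*} (b : I → Γ(M, U))
    (hb : ∀ (N : X.Modules) (f g : localHom M N U), (∀ i, f.1 ⟨U, le_rfl⟩ (b i) = g.1 ⟨U, le_rfl⟩ (b i)) → f = g)
    {f g : localHom M N V} (h : ∀ i, f.1 ⟨V, le_rfl⟩ (res M hV (b i)) = g.1 ⟨V, le_rfl⟩ (res M hV (b i))) : f = g := by
  apply (localHomEquiv _ _ _).injective
  let F (f : localHom M N V) : localHom M (openPush N V) U := ⟨fun W => appₗ (homOpenPush f) W.1, fun W W' h m => (app_res (homOpenPush f) h m).symm⟩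
  have hF (f : localHom M N V) (i : I) : (F f).1 ⟨U, le_rfl⟩ (b i) = (res N (inf_le_right : U ⊓ V ≤ V) (f.1 ⟨V, le_rfl⟩ (res M hV (b i))) : Γ(N, U ⊓ V)) := by
    rw [← localHom_apply_res f le_rfl inf_le_right, res_res]; rfl
  have h2 : F f = F g := hb _ _ _ fun i => by rw [hF, hF, h]
  have h3 : localHomRes M (openPush N V) hV (F f) = localHomRes M (openPush N V) hV (F g) := congrArg _ h2
  have h4 (f : localHom M N V) : f = ⟨fun W => (openPushEval N W.2).comp ((localHomRes M (openPush N V) hV (F f)).1 W), (localHomOfOpenPush (homOpenPush f)).2⟩ :=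
    (localHomOfOpenPush_homOpenPush f).symm
  have h5 : f = g := by
    rw [h4 f, h4 g]
    refine Subtype.ext (funext fun W => ?_)
    exact congrArg (fun (t : localHom M (openPush N V) V) => (openPushEval N W.2).comp (t.1 W)) h3
  rw [h5]

open scoped Classical in
-- For a finite set `s` of indices, combinations of the functionals dual to `b` are determined by
-- their values on `c`. This embeds `Rˢ` linearly into `Rᴶ` for `R = Γ(X, W)`, which bounds the size
-- of `s` by that of `J` because `R` is a nontrivial commutative ring.
theorem finite_of_generators {M : X.Modules} {W : X.Opens} [Nontrivial Γ(X, W)] {I J : Type*} [Finite J] (b : I → Γ(M, W)) (c : J → Γ(M, W))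
    (hb : ∀ a, ∃ φ : localHom M (structureSheaf X) W, ∀ a', φ.1 ⟨W, le_rfl⟩ (b a') = (if a' = a then 1 else 0 : Γ(X, W)))
    (hc : ∀ f g : localHom M (structureSheaf X) W, (∀ a, f.1 ⟨W, le_rfl⟩ (c a) = g.1 ⟨W, le_rfl⟩ (c a)) → f = g) : Finite I := by
  choose φ hφ using hb
  let ψ (a) : Γ(M, W) →ₗ[Γ(X, W)] Γ(X, W) := (φ a).1 ⟨W, le_rfl⟩
  have hψ (a a') : ψ a (b a') = if a' = a then 1 else 0 := hφ a a'
  let _ := Fintype.ofFinite J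
  have key (s : Finset I) : s.card ≤ Fintype.card J := by
    let T : (s → Γ(X, W)) →ₗ[Γ(X, W)] (J → Γ(X, W)) :=
      LinearMap.pi fun a => Fintype.linearCombination Γ(X, W) (fun a' : s => ψ a' (c a))
    have hT : Function.Injective T := by
      intro d d' h
      let f (d : s → Γ(X, W)) : localHom M (structureSheaf X) W := ∑ a, d a • φ a
      have f_apply (d : s → Γ(X, W)) (m : Γ(M, W)) : (show Γ(X, W) from (f d).1 ⟨W, le_rfl⟩ m) = ∑ a, d a * ψ a m := by
        simp only [f, AddSubgroup.val_finsetSum, Finset.sum_apply, LinearMap.sum_apply]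
        refine Finset.sum_congr rfl fun a _ => ?_
        rw [localHom_smul_apply]
        exact congrArg (· * ψ a m) (ores_self le_rfl (d a))
      have h3 : f d = f d' := hc _ _ fun a => by
        refine (f_apply d _).trans (Eq.trans ?_ (f_apply d' _).symm)
        exact congrFun h a
      funext a
      have h4 (d : s → Γ(X, W)) : (show Γ(X, W) from (f d).1 ⟨W, le_rfl⟩ (b a)) = d a := by
        rw [f_apply, Finset.sum_eq_single a]
        · rw [hψ, if_pos rfl, mul_one]
        · intro a' _ h
          rw [hψ, if_neg (fun h' => h (Subtype.ext h'.symm)), mul_zero]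
        · simp
      rw [← h4 d, ← h4 d', h3]
    have := card_le_of_injective Γ(X, W) T hT
    simpa using this
  by_contra hinf
  rw [not_finite_iff_infinite] at hinf
  obtain ⟨s, hs⟩ := Infinite.exists_subset_card_eq I (Fintype.card J + 1)
  have := key s
  omega

/-- A locally free sheaf of finite type has local bases. -/
theorem isLocFree_of_isLocallyFree (E : X.Modules) [SheafOfModules.IsFiniteType.{u} (R := X.ringCatSheaf) E]
    [SheafOfModules.IsLocallyFree.{u} (R := X.ringCatSheaf) E] : IsLocFree E := by
  classical
  intro p
  obtain ⟨q, hq⟩ := SheafOfModules.IsLocallyFree.exists_isLocallyFreeData (M := E)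
  obtain ⟨σ, hσ⟩ := SheafOfModules.IsFiniteType.exists_localGeneratorsData E
  have h1 : (⨆ i, q.X i) = ⊤ := (Opens.coversTop_iff _ _).1 q.coversTop
  have h2 : (⨆ i, σ.X i) = ⊤ := (Opens.coversTop_iff _ _).1 σ.coversTop
  obtain ⟨i, hi⟩ := TopologicalSpace.Opens.mem_iSup.1 (h1.ge (trivial : p ∈ (⊤ : X.Opens)))
  obtain ⟨j, hj⟩ := TopologicalSpace.Opens.mem_iSup.1 (h2.ge (trivial : p ∈ (⊤ : X.Opens)))
  have := hq.isIso i
  have : Finite (σ.generators j).I := (hσ.isFiniteType j).finite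
  -- Local freeness provides bases of possibly infinite index set, and finite type provides finite
  -- generating families, on unrelated covers. Comparison over the intersection `W` shows that the
  -- basis is finite.
  obtain ⟨I, b, hb, hb'⟩ : ∃ (I : Type u) (b : I → Γ(E, q.X i)),
      (∀ (N : X.Modules) (x : I → Γ(N, q.X i)), ∃ f : localHom E N (q.X i), ∀ a, f.1 ⟨_, le_rfl⟩ (b a) = x a) ∧
      (∀ (N : X.Modules) (f g : localHom E N (q.X i)), (∀ a, f.1 ⟨_, le_rfl⟩ (b a) = g.1 ⟨_, le_rfl⟩ (b a)) → f = g) :=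
    ⟨_, fun a => overSection ((q.generators i).s a), fun N x => exists_localHom_of_isIso (q.generators i).s x,
      fun N f g h => localHom_eq_of_epi (q.generators i).s h⟩
  obtain ⟨J, _, c, hc⟩ : ∃ (J : Type u) (_ : Finite J) (c : J → Γ(E, σ.X j)),
      ∀ (N : X.Modules) (f g : localHom E N (σ.X j)), (∀ a, f.1 ⟨_, le_rfl⟩ (c a) = g.1 ⟨_, le_rfl⟩ (c a)) → f = g :=
    ⟨_, this, fun a => overSection ((σ.generators j).s a), fun N f g h => localHom_eq_of_epi (σ.generators j).s h⟩
  let W := q.X i ⊓ σ.X j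
  have : Nonempty W := ⟨⟨p, hi, hj⟩⟩
  have : Nontrivial Γ(X, W) := inferInstance
  have hfin : Finite I := finite_of_generators (W := W) (fun a => res E inf_le_left (b a)) (fun a => res E inf_le_right (c a))
    (fun a => by
      obtain ⟨φ, hφ⟩ := hb (structureSheaf X) (fun a' => (if a' = a then 1 else 0 : Γ(X, q.X i)))
      refine ⟨localHomRes _ _ inf_le_left φ, fun a' => ?_⟩
      refine (localHom_apply_res φ le_rfl inf_le_left (b a')).trans ?_
      rw [hφ]
      exact (apply_ite (ores inf_le_left) _ _ _).trans (by simp))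
    (fun f g h => localHom_eq_of_le inf_le_right c hc h)
  let _ := Fintype.ofFinite I
  refine ⟨q.X i, Fintype.card I, fun a => b ((Fintype.equivFin _).symm a), hi, ?_⟩
  refine IsBasisOn.reindex ?_ (Fintype.equivFin _).symm
  exact isBasisOn_of_universal hb (hb' E)

end
end Higgs
-- Quasi-coherent sheaves over an affine open set
namespace Higgs
noncomputable section
variable {X : Scheme.{u}}

section quasicoherent
variable {V : X.Opens}

/-- Matches the action of `Γ(X, V)` through global functions on its spectrum with the action through
restriction of functions on `X`. -/
theorem restrict_fromSpec_smul (hV : IsAffineOpen V) (F : X.Modules) {U : (Spec Γ(X, V)).Opens} (h : hV.fromSpec ''ᵁ U ≤ V) (r : Γ(X, V)) (x : Γ(F.restrict hV.fromSpec, U)) :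
    r • x = (ores h r • (show Γ(F, hV.fromSpec ''ᵁ U) from x) : Γ(F, hV.fromSpec ''ᵁ U)) := by
  refine (Scheme.Modules.smul_Spec_def r x).trans ?_
  refine congrArg (fun s : Γ(X, hV.fromSpec ''ᵁ U) => (s • (show Γ(F, hV.fromSpec ''ᵁ U) from x) : Γ(F, hV.fromSpec ''ᵁ U))) ?_
  have h1 : (Scheme.ΓSpecIso Γ(X, V)).inv ≫ (Spec Γ(X, V)).presheaf.map U.leTop.op = X.presheaf.map (homOfLE h).op ≫ (hV.fromSpec.appIso U).hom := by
    rw [Scheme.Hom.appIso_hom', Scheme.Hom.map_appLE, Scheme.Hom.appLE, hV.fromSpec_app_self, Category.assoc, ← Functor.map_comp]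
    rfl
  have h2 := ConcreteCategory.congr_hom ((Iso.comp_inv_eq _).2 h1) r
  exact h2

theorem image_fromSpec_top (hV : IsAffineOpen V) : hV.fromSpec ''ᵁ ⊤ = V := by
  rw [Scheme.Hom.image_top_eq_opensRange, hV.opensRange_fromSpec]

/-- On the spectrum a quasi-coherent sheaf is the tilde of its global sections, so restriction to a
basic open set is a localization. -/
theorem isLocalizedModule_restrict (hV : IsAffineOpen V) (F : X.Modules) [SheafOfModules.IsQuasicoherent.{u} (R := X.ringCatSheaf) F] (f : Γ(X, V)) :
    IsLocalizedModule (.powers f) ((modulesSpecToSheaf.obj (F.restrict hV.fromSpec)).obj.map (PrimeSpectrum.basicOpen f).leTop.op).hom := by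
  have : SheafOfModules.IsQuasicoherent.{u} (R := (Spec Γ(X, V)).ringCatSheaf) (F.restrict hV.fromSpec) :=
    Scheme.Modules.isQuasicoherent_restrictFunctor hV.fromSpec F
  exact (isIso_fromTildeΓ_iff_isLocalizing _).1 (Scheme.Modules.isIso_fromTildeΓ_of_isQuasicoherent _) f

/-- The kernel half of `Γ(F, D(f)) = Γ(F, V)_f`; the next lemma is the half about denominators. -/
theorem exists_pow_smul_eq_zero (hV : IsAffineOpen V) (F : X.Modules) [SheafOfModules.IsQuasicoherent.{u} (R := X.ringCatSheaf) F] (f : Γ(X, V)) (x : Γ(F, V)) (hx : res F (X.basicOpen_le f) x = 0) : ∃ n : ℕ, f ^ n • x = 0 := by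
  have hl := isLocalizedModule_restrict hV F f
  have e1 := image_fromSpec_top hV
  have e2 := hV.fromSpec_image_basicOpen f
  let x' : Γ(F.restrict hV.fromSpec, ⊤) := res F e1.le x
  obtain ⟨⟨_, n, rfl⟩, hn⟩ := hl.exists_of_eq (x₁ := x') (x₂ := 0) (by
    rw [map_zero]
    refine (res_res F e1.le (hV.fromSpec.image_mono le_top) x).trans ?_
    rw [← res_res F (X.basicOpen_le f) e2.le]
    exact (congrArg (res F e2.le) hx).trans (map_zero (res F e2.le).hom))
  refine ⟨n, ?_⟩
  have h1 : f ^ n • x' = 0 := hn.trans (smul_zero _)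
  have h2 := (restrict_fromSpec_smul hV F e1.le (f ^ n) x').symm.trans h1
  have h3 : res F e1.le (f ^ n • x) = 0 := (res_smul _ _ _ _).trans h2
  have h4 := congrArg (res F e1.ge) h3
  rwa [res_res, res_self, map_zero] at h4

theorem exists_res_eq_pow_smul (hV : IsAffineOpen V) (F : X.Modules) [SheafOfModules.IsQuasicoherent.{u} (R := X.ringCatSheaf) F] (f : Γ(X, V)) (y : Γ(F, X.basicOpen f)) :
    ∃ (n : ℕ) (x : Γ(F, V)), res F (X.basicOpen_le f) x = ores (X.basicOpen_le f) f ^ n • y := by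
  have hl := isLocalizedModule_restrict hV F f
  have e1 := image_fromSpec_top hV
  have e2 := hV.fromSpec_image_basicOpen f
  let D : (Spec Γ(X, V)).Opens := PrimeSpectrum.basicOpen f
  let y' : Γ(F.restrict hV.fromSpec, D) := res F e2.le y
  obtain ⟨x', n, h1⟩ : ∃ (x' : Γ(F, hV.fromSpec ''ᵁ ⊤)) (n : ℕ), f ^ n • y' = res F (hV.fromSpec.image_mono le_top) x' := by
    obtain ⟨⟨x', ⟨_, n, rfl⟩⟩, hn⟩ := hl.surj y'
    exact ⟨x', n, hn⟩
  refine ⟨n, res F e1.ge x', ?_⟩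
  have h2 := (restrict_fromSpec_smul hV F (e2.le.trans (X.basicOpen_le f)) (f ^ n) y').symm.trans h1
  have h3 := congrArg (res F e2.ge) h2
  rw [res_res] at h3
  rw [res_res, ← h3]
  refine (res_smul F e2.ge _ (res F e2.le y)).trans ?_
  rw [res_res, res_self, ores_ores, map_pow]

end quasicoherent
end
end Higgs
-- Duality pairings, internal homs and transposes
namespace Higgs
noncomputable section
variable {X : Scheme.{u}}

section contract
variable {A B N : X.Modules} {U : X.Opens}

theorem contract_tmul (b : BilinHom A B (structureSheaf X)) (a : Γ(A, U)) (n : Γ(N, U)) {V : X.Opens} (h : V ≤ U) (y : Γ(B, V)) :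
    (toLocalHom ((b.contract N).app U (tmul a n))).1 ⟨V, h⟩ y = b.pair V (res A h a) y • res N h n := by
  exact congrArg (fun f : Γ(sheafHom B N, U) => (toLocalHom f).1 ⟨V, h⟩ y) (tensorDesc_tmul (P := sheafHom B N) _ a n)

theorem contract_sum_tmul {ι : Type*} [Fintype ι] [DecidableEq ι] (b : BilinHom A B (structureSheaf X)) {α : ι → Γ(A, U)} {β : ι → Γ(B, U)}
    (h : ∀ i j, b.pair U (α i) (β j) = if j = i then 1 else 0) (n : ι → Γ(N, U)) (j : ι) :
    (toLocalHom ((b.contract N).app U (∑ i, tmul (α i) (n i)))).1 ⟨U, le_rfl⟩ (β j) = n j := by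
  have h1 : (b.contract N).app U (∑ i, tmul (α i) (n i)) = ∑ i, (b.contract N).app U (tmul (α i) (n i)) := app_sum _ _ _
  rw [h1]
  refine (map_sum (((evalHom B N).app U).flip (β j)) _ _).trans ?_
  have h2 (i : ι) : ((evalHom B N).app U).flip (β j) ((b.contract N).app U (tmul (α i) (n i))) = (if j = i then 1 else 0 : Γ(X, U)) • n i := by
    refine (contract_tmul b (α i) (n i) le_rfl (β j)).trans ?_
    rw [res_self, res_self, h]
  simp only [h2]
  simp

/-- In dual bases both sides become tuples of sections of `N`, and contraction becomes the identity.
-/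
theorem contract_bijective {ι : Type*} [Fintype ι] [DecidableEq ι] (b : BilinHom A B (structureSheaf X)) {α : ι → Γ(A, U)} {β : ι → Γ(B, U)}
    (hα : IsBasisOn A U α) (hβ : IsBasisOn B U β) (h : ∀ i j, b.pair U (α i) (β j) = if j = i then 1 else 0) (N : X.Modules) :
    Function.Bijective ((b.contract N).app U) := by
  have h1 : Function.Bijective (fun (f : Γ(sheafHom B N, U)) (i : ι) => (toLocalHom f).1 ⟨U, le_rfl⟩ (β i)) := localHom_bijective hβ N
  rw [← Function.Bijective.of_comp_iff' h1, ← Function.Bijective.of_comp_iff _ (hα.tensor_bijective N)]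
  convert Function.bijective_id
  exact funext fun n => funext fun j => contract_sum_tmul b h n j

/-- `b` puts `A` and `B` into duality. -/
def IsPerfect (b : BilinHom A B (structureSheaf X)) : Prop :=
  ∀ p : X, ∃ (U : X.Opens) (n : ℕ) (α : Fin n → Γ(A, U)) (β : Fin n → Γ(B, U)), p ∈ U ∧ IsBasisOn A U α ∧ IsBasisOn B U β ∧
    ∀ i j, b.pair U (α i) (β j) = if j = i then 1 else 0

theorem pair_mono {ι : Type*} [DecidableEq ι] {b : BilinHom A B (structureSheaf X)} {α : ι → Γ(A, U)} {β : ι → Γ(B, U)}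
    (h : ∀ i j, b.pair U (α i) (β j) = if j = i then 1 else 0) {V : X.Opens} (hV : V ≤ U) (i j : ι) :
    b.pair V (res A hV (α i)) (res B hV (β j)) = if j = i then 1 else 0 := by
  rw [BilinHom.pair_res, h]
  exact (apply_ite (ores hV) _ _ _).trans (by simp)

theorem IsPerfect.isIso_contract {b : BilinHom A B (structureSheaf X)} (hb : IsPerfect b) (N : X.Modules) : IsIso (b.contract N) := by
  refine isIso_of_locally _ fun p => ?_
  obtain ⟨U, n, α, β, hp, hα, hβ, h⟩ := hb p
  exact ⟨U, hp, fun V hV => contract_bijective b (hα.mono hV) (hβ.mono hV) (pair_mono h hV) N⟩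

theorem isPerfect_dualPairing {M : X.Modules} (hM : IsLocFree M) : IsPerfect (dualPairing M) := by
  intro p
  obtain ⟨U, n, b, hp, hb⟩ := hM p
  exact ⟨U, n, hb.dualBasis, b, hp, hb.isBasisOn_dual, hb, hb.pair_dualBasis⟩

end contract

/-- A bilinear map `M × N → P` as a map `M ⟶ 𝓗om(N, P)`. -/
def BilinHom.curry {M N P : X.Modules} (b : BilinHom M N P) : M ⟶ sheafHom N P :=
  homMk (fun U =>
    { toFun m := toLocalHom.symm ⟨fun V => b.app V.1 (res M V.2 m), fun V W h n => by
        exact (b.naturality (homOfLE h) _ n).trans (congrArg (fun m => b.app W.1 m (res N h n)) (res_res M V.2 h m))⟩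
      map_add' m m' := Subtype.ext (funext fun V => by
        change b.app V.1 (res M V.2 (m + m')) = b.app V.1 (res M V.2 m) + b.app V.1 (res M V.2 m')
        rw [map_add, map_add])
      map_smul' r m := Subtype.ext (funext fun V => by
        change b.app V.1 (res M V.2 (r • m)) = ores V.2 r • b.app V.1 (res M V.2 m)
        rw [res_smul, map_smul]) })
    (fun {U V} i m => Subtype.ext (funext fun W => by
      change b.app W.1 (res M (W.2.trans (leOfHom i)) m) = b.app W.1 (res M W.2 (res M (leOfHom i) m))
      rw [res_res]))

theorem BilinHom.evalHom_curry {M N P : X.Modules} (b : BilinHom M N P) {U : X.Opens} (m : Γ(M, U)) (n : Γ(N, U)) :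
    (evalHom N P).app U (b.curry.app U m) n = b.app U m n :=
  congrArg (fun m => b.app U m n) (res_self M le_rfl m)

/-- A section of the internal hom over `U` also acts over every smaller `V`, but by naturality that
action is evaluation over `V` of the restricted argument. -/
theorem hom_sheafHom_ext {M N P : X.Modules} {f g : M ⟶ sheafHom N P}
    (h : ∀ U m n, (evalHom N P).app U (f.app U m) n = (evalHom N P).app U (g.app U m) n) : f = g := by
  ext U m
  refine localHom_ext fun V hV n => ?_
  have key (f : M ⟶ sheafHom N P) : (toLocalHom (f.app U m)).1 ⟨V, hV⟩ n = (evalHom N P).app V (f.app V (res M hV m)) n :=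
    congrArg (fun y : Γ(sheafHom N P, V) => (toLocalHom y).1 ⟨V, le_rfl⟩ n) (app_res f hV m).symm
  exact (key f).trans ((h V _ n).trans (key g).symm)

/-- A locally free sheaf has a unique transpose for every Higgs field. -/
theorem existsUnique_isTranspose {E K : X.Modules} (hE : IsLocFree E) (φ : E ⟶ tensor E K) :
    ∃! ψ : dual E ⟶ tensor (dual E) K, IsTranspose φ ψ := by
  have := (isPerfect_dualPairing hE).isIso_contract K
  let c := (dualPairing E).contract K
  let b : BilinHom (dual E) E K := ((evalHom (dual E) K).precomp (φ ≫ (dualPairing E).flip.contract K) (𝟙 _)).flip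
  -- `b` sends `(l, e)` to the contraction of `φ e` with `l`. Being a transpose means that `c`
  -- carries `ψ` to the fixed morphism `b.curry`; as `c` is invertible, existence and uniqueness
  -- follow together.
  have key (ψ : dual E ⟶ tensor (dual E) K) : IsTranspose φ ψ ↔ ψ ≫ c = b.curry := by
    refine ⟨fun h => hom_sheafHom_ext fun U l e => ?_, fun h U e l => ?_⟩
    · exact (h U e l).symm.trans (b.evalHom_curry l e).symm
    · exact (b.evalHom_curry l e).symm.trans (congrArg (fun f : dual E ⟶ sheafHom E K => (evalHom E K).app U (f.app U l) e) h).symm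
  refine ⟨b.curry ≫ inv c, (key _).2 (by rw [Category.assoc, IsIso.inv_hom_id, Category.comp_id]), fun ψ hψ => ?_⟩
  rw [← (key ψ).1 hψ, Category.assoc, IsIso.hom_inv_id, Category.comp_id]

section pullbackPairing
variable {S : Scheme.{u}} (π : X ⟶ S) {M' M : S.Modules}

theorem localHomPush_bijective {M : S.Modules} {N : X.Modules} (U : S.Opens) :
    Function.Bijective (localHomPush π : localHom ((Scheme.Modules.pullback π).obj M) N (π ⁻¹ᵁ U) → _) :=
  ⟨localHomPush_injective π, localHomPush_surjective π⟩

theorem localHomPush_smul {M : S.Modules} {N : X.Modules} {U : S.Opens} (r : Γ(S, U))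
    (f : localHom ((Scheme.Modules.pullback π).obj M) N (π ⁻¹ᵁ U)) : localHomPush π (π.app U r • f) = r • localHomPush π f := by
  refine localHom_ext fun V hV m => ?_
  generalize hy : (f.1 ⟨π ⁻¹ᵁ V, π.preimage_mono hV⟩ (pullSec π m) : Γ(N, π ⁻¹ᵁ V)) = y
  have h1 : (localHomPush π (π.app U r • f)).1 ⟨V, hV⟩ m = (ores (π.preimage_mono hV) (π.app U r) • y : Γ(N, π ⁻¹ᵁ V)) := by
    rw [← hy]; rfl
  have h2 : (r • localHomPush π f).1 ⟨V, hV⟩ m = (π.app V (ores hV r) • y : Γ(N, π ⁻¹ᵁ V)) := by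
    rw [← hy]; rfl
  rw [h1, h2, ores_app]

/-- The local morphism `m ↦ π^* b(m', m)`. -/
def pushPair (b : BilinHom M' M (structureSheaf S)) {U : S.Opens} (m' : Γ(M', U)) :
    localHom M ((Scheme.Modules.pushforward π).obj (structureSheaf X)) U :=
  ⟨fun V =>
    { toFun m := (π.app V.1 (b.pair V.1 (res M' V.2 m') m) : Γ(X, π ⁻¹ᵁ V.1))
      map_add' m n := by rw [map_add, map_add]; rfl
      map_smul' r m := by rw [map_smul, smul_eq_mul, map_mul]; rfl }, fun V W h m => by
    change ores (π.preimage_mono h) (π.app V.1 _) = π.app W.1 _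
    rw [ores_app, ← BilinHom.pair_res, res_res]⟩

theorem pushPair_apply (b : BilinHom M' M (structureSheaf S)) {U : S.Opens} (m' : Γ(M', U)) {V : S.Opens} (h : V ≤ U) (m : Γ(M, V)) :
    (pushPair π b m').1 ⟨V, h⟩ m = (π.app V (b.pair V (res M' h m') m) : Γ(X, π ⁻¹ᵁ V)) := rfl

/-- The adjoint `M' ⟶ π_* 𝓗om(π^* M, 𝒪)` of the pullback of a pairing. -/
def pullbackPairingAdjoint (b : BilinHom M' M (structureSheaf S)) :
    M' ⟶ (Scheme.Modules.pushforward π).obj (sheafHom ((Scheme.Modules.pullback π).obj M) (structureSheaf X)) :=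
  homMk (fun U =>
    -- By the local adjunction the functional `m ↦ π^* b(m', m)` on `M` extends uniquely to a
    -- functional on the pullback of `M`.
    { toFun m' := toLocalHom.symm ((Equiv.ofBijective _ (localHomPush_bijective π U)).symm (pushPair π b m'))
      map_add' m n := by
        apply (localHomPush_bijective π U).1
        refine ((Equiv.ofBijective _ (localHomPush_bijective π U)).apply_symm_apply _).trans ?_
        refine Eq.trans ?_ (congrArg₂ (· + ·) ((Equiv.ofBijective _ (localHomPush_bijective π U)).apply_symm_apply (pushPair π b m))
          ((Equiv.ofBijective _ (localHomPush_bijective π U)).apply_symm_apply (pushPair π b n))).symm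
        refine localHom_ext fun V hV x => ?_
        refine (pushPair_apply π b _ hV x).trans ?_
        rw [map_add, LinearMap.map_add₂, map_add]
        rfl
      map_smul' r m := by
        apply (localHomPush_bijective π U).1
        refine ((Equiv.ofBijective _ (localHomPush_bijective π U)).apply_symm_apply _).trans ?_
        have h1 : r • pushPair π b m = _ := congrArg (r • ·) ((Equiv.ofBijective _ (localHomPush_bijective π U)).apply_symm_apply (pushPair π b m)).symm
        have h2 : pushPair π b (r • m) = r • pushPair π b m := by
          refine localHom_ext fun V hV x => ?_
          refine (pushPair_apply π b _ hV x).trans ?_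
          rw [res_smul, LinearMap.map_smul₂, smul_eq_mul, map_mul]
          rfl
        refine (h2.trans h1).trans ?_
        exact (localHomPush_smul π r _).symm })
    (fun {U V} i m => by
      apply (localHomPush_bijective π V).1
      refine Eq.trans ?_ ((Equiv.ofBijective _ (localHomPush_bijective π V)).apply_symm_apply _).symm
      have h1 := congrArg (localHomRes _ _ (leOfHom i)) ((Equiv.ofBijective _ (localHomPush_bijective π U)).apply_symm_apply (pushPair π b m))
      refine Eq.trans ?_ (h1.trans ?_)
      · rfl
      · refine localHom_ext fun W hW x => ?_
        exact congrArg (fun y => (π.app W (b.pair W y x) : Γ(X, π ⁻¹ᵁ W))) (res_res M' (leOfHom i) hW m).symm)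

/-- The pullback of a pairing. -/
def pullbackPairing (b : BilinHom M' M (structureSheaf S)) :
    BilinHom ((Scheme.Modules.pullback π).obj M') ((Scheme.Modules.pullback π).obj M) (structureSheaf X) :=
  (dualPairing _).precomp (((Scheme.Modules.pullbackPushforwardAdjunction π).homEquiv _ _).symm (pullbackPairingAdjoint π b)) (𝟙 _)

theorem adjoint_pullSec {M : S.Modules} {N : X.Modules} (g : M ⟶ (Scheme.Modules.pushforward π).obj N) {U : S.Opens} (m : Γ(M, U)) :
    (((Scheme.Modules.pullbackPushforwardAdjunction π).homEquiv _ _).symm g).app (π ⁻¹ᵁ U) (pullSec π m) = g.app U m := by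
  have hG : pullbackUnit π M ≫ (Scheme.Modules.pushforward π).map (((Scheme.Modules.pullbackPushforwardAdjunction π).homEquiv _ _).symm g) = g := by
    rw [pullbackUnit, ← Adjunction.homEquiv_unit, Equiv.apply_symm_apply]
  exact congrArg (fun h => Scheme.Modules.Hom.app h U m) hG

/-- Ensures that dual bases pull back to dual bases. -/
theorem pullbackPairing_pullSec (b : BilinHom M' M (structureSheaf S)) {U : S.Opens} (m' : Γ(M', U)) (m : Γ(M, U)) :
    (pullbackPairing π b).pair (π ⁻¹ᵁ U) (pullSec π m') (pullSec π m) = π.app U (b.pair U m' m) := by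
  have h1 := adjoint_pullSec π (pullbackPairingAdjoint π b) m'
  refine (congrArg (fun f => (dualPairing _).pair (π ⁻¹ᵁ U) f (pullSec π m)) h1).trans ?_
  have h2 := (Equiv.ofBijective _ (localHomPush_bijective π U)).apply_symm_apply (pushPair π b m')
  have h3 := congrArg (fun f : localHom M ((Scheme.Modules.pushforward π).obj (structureSheaf X)) U => f.1 ⟨U, le_rfl⟩ m) h2
  refine Eq.trans h3 ?_
  rw [pushPair_apply, res_self]

end pullbackPairing
end
end Higgs
-- Linear algebra of the characteristic matrix
namespace Higgs
noncomputable section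
variable {X : Scheme.{u}}

section algebra
variable {R B ι : Type*} [CommRing R] [CommRing B] [Fintype ι] [DecidableEq ι] {g : R →+* B} {t : B} (a : Matrix ι ι R)

/-- Through `B ≅ R[T]` the determinant is, up to sign, the characteristic polynomial of `a`; it is
monic, hence regular over any commutative ring. -/
theorem det_sub_mul_eq_zero (hg : Function.Bijective (Polynomial.eval₂RingHom g t)) {x : B}
    (hx : (a.map g - Matrix.scalar ι t).det * x = 0) : x = 0 := by
  obtain ⟨q, rfl⟩ := hg.2 x
  have h1 : Polynomial.eval₂RingHom g t a.charpoly = (-1) ^ Fintype.card ι * (a.map g - Matrix.scalar ι t).det := by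
    rw [← Matrix.det_neg, neg_sub, Matrix.charpoly, RingHom.map_det]
    congr 1
    ext i j
    by_cases h : i = j
    · subst h; simp
    · simp [h]
  have h2 : Polynomial.eval₂RingHom g t (a.charpoly * q) = 0 := by
    rw [map_mul, h1, mul_assoc, hx, mul_zero]
  have h3 : a.charpoly * q = 0 := hg.1 (h2.trans (map_zero _).symm)
  rw [(a.charpoly_monic.mul_right_eq_zero_iff).1 h3, map_zero]

/-- Division with remainder by the characteristic matrix `P`: modulo the image of `Pᵀ`,
multiplication by `t` acts on constant vectors as `aᵀ`, so every vector over `B` is a constant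
vector plus some `Pᵀ d`. For a relation among the `m i` the constant remainder is again a relation,
hence zero. -/
theorem exists_transpose_mulVec_of_sum_smul_eq_zero (hg : Function.Surjective (Polynomial.eval₂RingHom g t)) {M : Type*} [AddCommGroup M] [Module B M] (m : ι → M)
    (hm : ∀ i, ∑ j, (a.map g - Matrix.scalar ι t) i j • m j = 0) (hinj : ∀ r : ι → R, ∑ i, g (r i) • m i = 0 → r = 0)
    (c : ι → B) (hc : ∑ i, c i • m i = 0) : ∃ d : ι → B, c = (a.map g - Matrix.scalar ι t).transpose.mulVec d := by
  set P := a.map g - Matrix.scalar ι t with hP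
  let Q : AddSubgroup (ι → B) :=
    { carrier := {c | ∃ (r : ι → R) (d : ι → B), c = (fun i => g (r i)) + P.transpose.mulVec d}
      zero_mem' := ⟨0, 0, by ext; simp⟩
      add_mem' := by
        rintro _ _ ⟨r, d, rfl⟩ ⟨r', d', rfl⟩
        exact ⟨r + r', d + d', by rw [Matrix.mulVec_add]; ext; simp; ring⟩
      neg_mem' := by
        rintro _ ⟨r, d, rfl⟩
        exact ⟨-r, -d, by rw [Matrix.mulVec_neg]; ext; simp; ring⟩ }
  have hR (r : R) (c) (hc : c ∈ Q) : g r • c ∈ Q := by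
    obtain ⟨r', d, rfl⟩ := hc
    exact ⟨r • r', g r • d, by rw [Matrix.mulVec_smul, smul_add]; ext; simp⟩
  have ht (c) (hc : c ∈ Q) : t • c ∈ Q := by
    obtain ⟨r, d, rfl⟩ := hc
    -- From `t r = aᵀ r - Pᵀ r` for a constant vector `r`.
    refine ⟨a.transpose.mulVec r, t • d - (fun i => g (r i)), ?_⟩
    have h1 : P.transpose.mulVec (fun i => g (r i)) = (fun i => g (a.transpose.mulVec r i)) - t • (fun i => g (r i)) := by
      rw [hP, Matrix.transpose_sub, Matrix.sub_mulVec]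
      ext i
      simp [Matrix.mulVec, dotProduct, Matrix.diagonal_transpose]
    rw [Matrix.mulVec_sub, h1, Matrix.mulVec_smul, smul_add]
    abel
  have hpoly (q : Polynomial R) : ∀ c ∈ Q, (Polynomial.eval₂RingHom g t q) • c ∈ Q := by
    induction q using Polynomial.induction_on' with
    | add p q hp hq => intro c hc; rw [map_add, add_smul]; exact Q.add_mem (hp c hc) (hq c hc)
    | monomial n r =>
      intro c hc
      rw [Polynomial.coe_eval₂RingHom, Polynomial.eval₂_monomial, mul_smul]
      refine hR _ _ ?_
      induction n with
      | zero => simpa using hc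
      | succ n ih => rw [pow_succ', mul_smul]; exact ht _ ih
  have htop (c : ι → B) : c ∈ Q := by
    rw [pi_eq_sum_univ' c]
    refine Q.sum_mem fun i _ => ?_
    obtain ⟨q, hq⟩ := hg (c i)
    rw [← hq]
    refine hpoly q _ ⟨Pi.single i 1, 0, ?_⟩
    ext j
    simp [Pi.single_apply, eq_comm, apply_ite g]
  obtain ⟨r, d, rfl⟩ := htop c
  refine ⟨d, ?_⟩
  have h1 : ∑ i, P.transpose.mulVec d i • m i = 0 := by
    simp only [Matrix.mulVec, dotProduct, Matrix.transpose_apply, Finset.sum_smul]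
    rw [Finset.sum_comm]
    refine Finset.sum_eq_zero fun j _ => ?_
    simp only [mul_comm _ (d j), mul_smul, ← Finset.smul_sum, hm, smul_zero]
  have h2 : r = 0 := by
    refine hinj r ?_
    simpa only [Pi.add_apply, add_smul, Finset.sum_add_distrib, h1, add_zero] using hc
  rw [h2]
  ext
  simp
end algebra

/-! ### Natural transformations between hom and tensor functors -/

section transformations
variable {A A' A'' F : X.Modules}

/-- Precomposition with `ε`. -/
def sheafHomPrecomp (ε : A ⟶ F) : sheafHomFunctor F ⟶ sheafHomFunctor A where
  app N := ((evalHom F N).precomp (𝟙 _) ε).curry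
  naturality N N' g := hom_sheafHom_ext fun U f x => by
    refine (BilinHom.evalHom_curry ((evalHom F N').precomp (𝟙 _) ε) ((sheafHomMap F g).app U f) x).trans ?_
    exact congrArg (g.app U) (BilinHom.evalHom_curry ((evalHom F N).precomp (𝟙 _) ε) f x).symm

/-- The contraction `A' ⊗ N ⟶ 𝓗om(A, N)` is natural in `N`. -/
def contractTrans (b : BilinHom A' A (structureSheaf X)) : tensorLeft A' ⟶ sheafHomFunctor A where
  app N := b.contract N
  naturality N N' g := tensor_hom_ext fun U a n => localHom_ext fun V hV x => by
    have h1 : ((tensorLeft A').map g ≫ b.contract N').app U ((tensorMk A' N).app U a n) = (b.contract N').app U (tmul a (g.app U n)) :=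
      congrArg ((b.contract N').app U) (tensorLeft_map_tmul A' g a n)
    have h2 : ((b.contract N ≫ (sheafHomFunctor A).map g).app U ((tensorMk A' N).app U a n) : localHom A N' U).1 ⟨V, hV⟩ x =
      g.app V ((toLocalHom ((b.contract N).app U (tmul a n))).1 ⟨V, hV⟩ x) := rfl
    refine (congrArg (fun f : localHom A N' U => f.1 ⟨V, hV⟩ x) h1).trans (Eq.trans ?_ h2.symm)
    refine (contract_tmul b a (g.app U n) hV x).trans ?_
    rw [contract_tmul b a n hV x, app_smul, app_res]

/-- `h ⊗ N` is natural in `N`. -/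
def tensorTrans (h : A' ⟶ A'') : tensorLeft A' ⟶ tensorLeft A'' where
  app N := tensorMap h (𝟙 N)
  naturality N N' g := tensor_hom_ext fun U a n => by
    have h1 := congrArg ((tensorMap h (𝟙 N')).app U) (tensorLeft_map_tmul A' g a n)
    have h2 := congrArg (((tensorLeft A'').map g).app U) (tensorMap_tmul h (𝟙 N) a n)
    refine h1.trans ((tensorMap_tmul h (𝟙 N') _ _).trans (Eq.trans ?_ h2.symm))
    exact (tensorLeft_map_tmul A'' g _ _).symm

/-- The composition of the precomposition with `ε` and the isomorphism `𝓗om(A, N) ≅ A' ⊗ N`. -/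
def dualPrecomp (b : BilinHom A' A (structureSheaf X)) [∀ N, IsIso (b.contract N)] (ε : A ⟶ F) : sheafHomFunctor F ⟶ tensorLeft A' :=
  have : ∀ N, IsIso ((contractTrans b).app N) := fun N => inferInstanceAs (IsIso (b.contract N))
  have := NatIso.isIso_of_isIso_app (contractTrans b)
  sheafHomPrecomp ε ≫ inv (contractTrans b)

theorem dualPrecomp_contract (b : BilinHom A' A (structureSheaf X)) [∀ N, IsIso (b.contract N)] (ε : A ⟶ F) (N : X.Modules) :
    (dualPrecomp b ε).app N ≫ b.contract N = (sheafHomPrecomp ε).app N := by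
  have : ∀ N, IsIso ((contractTrans b).app N) := fun N => inferInstanceAs (IsIso (b.contract N))
  have := NatIso.isIso_of_isIso_app (contractTrans b)
  have h : dualPrecomp b ε ≫ contractTrans b = sheafHomPrecomp ε := by
    rw [dualPrecomp, Category.assoc, IsIso.inv_hom_id, Category.comp_id]
  exact congrArg (fun t => NatTrans.app t N) h

end transformations
end
end Higgs
-- Local presentations and the sequence `0 → 𝓗om(F, N) → A' ⊗ N → (A' ⊗ L) ⊗ N`
namespace Higgs
noncomputable section
variable {X : Scheme.{u}}

section presentation
variable {A A' L F : X.Modules}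

/-- On `V` the maps `ε : A ⟶ F` and `h : A' ⟶ A' ⊗ L` are given by a presentation of `F` by the transpose of the matrix `P`, and by `P`,
in a basis `a` of `A`, the dual basis `α` of `A'` and a generator `l` of `L`. -/
structure IsLocalPresentation (b : BilinHom A' A (structureSheaf X)) (ε : A ⟶ F) (h : A' ⟶ tensor A' L) (V : X.Opens) {n : ℕ}
    (α : Fin n → Γ(A', V)) (a : Fin n → Γ(A, V)) (l : Γ(L, V)) (P : Matrix (Fin n) (Fin n) Γ(X, V)) : Prop where
  basis_dual : IsBasisOn A' V α
  basis : IsBasisOn A V a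
  generator : IsBasisOn L V (fun _ : Unit => l)
  pair (i j) : b.pair V (α i) (a j) = if j = i then 1 else 0
  app_dual (i) : h.app V (α i) = ∑ j, P j i • tmul (α j) l
  relation (i) : ∑ j, P i j • ε.app V (a j) = 0
  det_mul (W) (hW : W ≤ V) (x : Γ(X, W)) : ores hW P.det * x = 0 → x = 0
  kernel (W) (hW : W ≤ V) (c : Fin n → Γ(X, W)) : ∑ i, c i • res F hW (ε.app V (a i)) = 0 →
    ∀ p ∈ W, ∃ (W' : X.Opens) (h : W' ≤ W), p ∈ W' ∧ ∃ d : Fin n → Γ(X, W'), ∀ i, ores h (c i) = ∑ j, d j * ores (h.trans hW) (P j i)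
  surjective (W) (hW : W ≤ V) (y : Γ(F, W)) : ∀ p ∈ W, ∃ (W' : X.Opens) (h : W' ≤ W), p ∈ W' ∧ ∃ x, ε.app W' x = res F h y

variable {b : BilinHom A' A (structureSheaf X)} {ε : A ⟶ F} {h : A' ⟶ tensor A' L} {V : X.Opens} {n : ℕ}
    {α : Fin n → Γ(A', V)} {a : Fin n → Γ(A, V)} {l : Γ(L, V)} {P : Matrix (Fin n) (Fin n) Γ(X, V)}

namespace IsLocalPresentation

theorem mono (H : IsLocalPresentation b ε h V α a l P) {W : X.Opens} (hW : W ≤ V) :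
    IsLocalPresentation b ε h W (fun i => res A' hW (α i)) (fun i => res A hW (a i)) (res L hW l) (P.map (ores hW)) where
  basis_dual := H.basis_dual.mono hW
  basis := H.basis.mono hW
  generator := H.generator.mono hW
  pair := pair_mono H.pair hW
  app_dual i := by
    rw [app_res, H.app_dual, map_sum]
    exact Finset.sum_congr rfl fun j _ => by rw [res_smul, res_tmul]; rfl
  relation i := by
    have h1 := congrArg (res F hW) (H.relation i)
    rw [map_zero, map_sum] at h1
    refine Eq.trans (Finset.sum_congr rfl fun j _ => ?_) h1
    rw [res_smul, app_res]; rfl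
  det_mul W' hW' x hx := by
    refine H.det_mul W' (hW'.trans hW) x ?_
    rw [← hx, ← ores_ores hW hW', RingHom.map_det]; rfl
  kernel W' hW' c hc p hp := by
    simp only [app_res, res_res] at hc
    obtain ⟨W'', h, hp, d, hd⟩ := H.kernel W' (hW'.trans hW) c hc p hp
    refine ⟨W'', h, hp, d, fun i => (hd i).trans (Finset.sum_congr rfl fun j _ => ?_)⟩
    rw [Matrix.map_apply, ores_ores]
  surjective W' hW' y := H.surjective W' (hW'.trans hW) y

/-- In the chosen frames the map is the matrix `P` acting on coordinate vectors with entries in `N`.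
-/
theorem app_sum_tmul (H : IsLocalPresentation b ε h V α a l P) {N : X.Modules} (x : Fin n → Γ(N, V)) :
    (tensorMap h (𝟙 N)).app V (∑ i, tmul (α i) (x i)) = ∑ j, tmul (tmul (α j) l) (∑ i, P j i • x i) := by
  refine (app_sum _ _ _).trans ?_
  have h1 (i) : (tensorMap h (𝟙 N)).app V (tmul (α i) (x i)) = ∑ j, P j i • tmul (tmul (α j) l) (x i) := by
    refine (tensorMap_tmul h (𝟙 N) (α i) (x i)).trans ?_
    refine (congrArg (fun y : Γ(tensor A' L, V) => tmul y (x i)) (H.app_dual i)).trans ?_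
    rw [sum_tmul]
    exact Finset.sum_congr rfl fun j _ => smul_tmul _ _ _
  refine (Finset.sum_congr rfl fun i _ => h1 i).trans ?_
  rw [Finset.sum_comm]
  refine Finset.sum_congr rfl fun j _ => ?_
  rw [tmul_sum]
  exact Finset.sum_congr rfl fun i _ => (tmul_smul _ _ _).symm

theorem app_sum_tmul_eq_zero_iff (H : IsLocalPresentation b ε h V α a l P) {N : X.Modules} (x : Fin n → Γ(N, V)) :
    (tensorMap h (𝟙 N)).app V (∑ i, tmul (α i) (x i)) = 0 ↔ ∀ j, ∑ i, P j i • x i = 0 := by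
  rw [H.app_sum_tmul]
  refine ⟨fun h0 => ?_, fun h0 => ?_⟩
  · have := @((H.generator.tensor H.basis_dual).tensor_bijective N).1 (fun j => ∑ i, P j i • x i) 0
      (h0.trans (Finset.sum_eq_zero fun i _ => tmul_zero _).symm)
    exact congrFun this
  · exact Finset.sum_eq_zero fun j _ => by rw [h0, tmul_zero]

/-- Cramer's rule: multiply the system by the adjugate of `P`. -/
theorem smul_det_eq_zero {N : X.Modules} {x : Fin n → Γ(N, V)} (hx : ∀ j, ∑ i, P j i • x i = 0) (i : Fin n) : P.det • x i = 0 := by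
  have h1 : ∑ j, P.adjugate i j • ∑ k, P j k • x k = 0 := Finset.sum_eq_zero fun j _ => by rw [hx, smul_zero]
  simp only [Finset.smul_sum, smul_smul] at h1
  rw [Finset.sum_comm] at h1
  simp only [← Finset.sum_smul, ← Matrix.mul_apply, Matrix.adjugate_mul, Matrix.smul_apply, Matrix.one_apply, smul_eq_mul,
    mul_ite, mul_one, mul_zero, ite_smul, zero_smul, Finset.sum_ite_eq, Finset.mem_univ, if_true] at h1
  exact h1

/-- By Cramer's rule `det P` kills the coordinates of a kernel section. Writing these in the frame
`g` reduces to functions, where `det P` is regular. -/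
theorem app_injective (H : IsLocalPresentation b ε h V α a l P) {G : X.Modules} {g : Γ(G, V)} (hg : IsBasisOn G V (fun _ : Unit => g)) :
    Function.Injective ((tensorMap h (𝟙 G)).app V) := by
  refine (injective_iff_map_eq_zero (appₗ (tensorMap h (𝟙 G)) V)).2 fun y hy => ?_
  obtain ⟨x, rfl⟩ := (H.basis_dual.tensor_bijective G).2 y
  have h1 := (H.app_sum_tmul_eq_zero_iff x).1 hy
  refine Finset.sum_eq_zero fun i _ => ?_
  have h2 := smul_det_eq_zero h1 i
  have h3 : x i = 0 := by
    rw [← hg.sum_coord le_rfl (x i)] at h2 ⊢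
    refine Finset.sum_eq_zero fun j _ => ?_
    have h4 := congrArg (hg.coord le_rfl j) h2
    rw [map_smul, hg.coord_sum le_rfl, map_zero, smul_eq_mul] at h4
    rw [H.det_mul V le_rfl (hg.coord le_rfl j (x i)) (by rw [ores_self]; exact h4), zero_smul]
  rw [h3, tmul_zero]

/-- An injective sheaf is divisible by the regular function `det P`: if `det P • z = x`, then the
adjugate of `P` applied to `z` solves the system with right-hand side `x`. -/
theorem app_surjective (H : IsLocalPresentation b ε h V α a l P) (I : X.Modules) [Injective I] :
    Function.Surjective ((tensorMap h (𝟙 I)).app V) := by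
  intro y
  obtain ⟨x, rfl⟩ := ((H.generator.tensor H.basis_dual).tensor_bijective I).2 y
  choose z hz using fun i => exists_smul_eq_of_injective I P.det H.det_mul (x i)
  refine ⟨∑ i, tmul (α i) (∑ k, P.adjugate i k • z k), (H.app_sum_tmul _).trans ?_⟩
  refine Finset.sum_congr rfl fun j _ => congrArg _ ?_
  simp only [Finset.smul_sum, smul_smul]
  rw [Finset.sum_comm]
  simp only [← Finset.sum_smul, ← Matrix.mul_apply, Matrix.mul_adjugate, Matrix.smul_apply, Matrix.one_apply, smul_eq_mul,
    mul_ite, mul_one, mul_zero, ite_smul, zero_smul, Finset.sum_ite_eq, Finset.mem_univ, if_true]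
  exact hz j

/-- The coordinates of the image of `f` are its values on the generators of `F`. This is checked
after contraction, which is injective. -/
theorem dualPrecomp_app (H : IsLocalPresentation b ε h V α a l P) [∀ N, IsIso (b.contract N)] {N : X.Modules} (f : Γ(sheafHom F N, V)) :
    ((dualPrecomp b ε).app N).app V f = ∑ i, tmul (α i) ((toLocalHom f).1 ⟨V, le_rfl⟩ (ε.app V (a i))) := by
  apply (contract_bijective b H.basis_dual H.basis H.pair N).1
  apply (localHom_bijective H.basis N).1
  funext j
  refine Eq.trans ?_ (contract_sum_tmul b H.pair (fun i => (toLocalHom f).1 ⟨V, le_rfl⟩ (ε.app V (a i))) j).symm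
  have h1 := congrArg (fun t : sheafHom F N ⟶ sheafHom A N => (toLocalHom (t.app V f)).1 ⟨V, le_rfl⟩ (a j)) (dualPrecomp_contract b ε N)
  exact h1

theorem sum_smul_apply_eq_zero (H : IsLocalPresentation b ε h V α a l P) {N : X.Modules} (f : localHom F N V) (j : Fin n) :
    ∑ i, P j i • f.1 ⟨V, le_rfl⟩ (ε.app V (a i)) = 0 := by
  rw [← map_zero (f.1 ⟨V, le_rfl⟩), ← H.relation j, map_sum]
  exact Finset.sum_congr rfl fun i _ => (map_smul _ _ _).symm

/-- The morphism on `A` with values `x` on the basis kills the kernel of `ε`, because sections of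
that kernel are locally combinations of the rows of `P`, and these rows annihilate `x`. -/
theorem exists_localHom (H : IsLocalPresentation b ε h V α a l P) [Epi ε] {N : X.Modules} (x : Fin n → Γ(N, V))
    (hx : ∀ j, ∑ i, P j i • x i = 0) : ∃ f : localHom F N V, ∀ i, f.1 ⟨V, le_rfl⟩ (ε.app V (a i)) = x i := by
  have key {W : X.Opens} (hW : W ≤ V) (y : Γ(A, W)) (hy : ε.app W y = 0) : (H.basis.lift x).1 ⟨W, hW⟩ y = 0 := by
    rw [H.basis.lift_apply]
    have h1 : ∑ i, H.basis.coord hW i y • res F hW (ε.app V (a i)) = 0 := by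
      refine Eq.trans ?_ hy
      conv_rhs => rw [← H.basis.sum_coord hW y]
      refine Eq.trans ?_ (app_sum _ _ _).symm
      exact Finset.sum_congr rfl fun i _ => by rw [app_smul, app_res]
    refine section_ext _ _ _ fun p hp => ?_
    obtain ⟨W', h', hp', d, hd⟩ := H.kernel W hW _ h1 p hp
    refine ⟨W', h', hp', ?_⟩
    rw [map_zero, map_sum]
    simp only [res_smul, hd, res_res, Finset.sum_smul]
    rw [Finset.sum_comm]
    refine Finset.sum_eq_zero fun j _ => ?_
    have h2 := congrArg (res N (h'.trans hW)) (hx j)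
    rw [map_zero, map_sum] at h2
    simp only [res_smul] at h2
    simp only [mul_smul, ← Finset.smul_sum]
    rw [h2, smul_zero]
  -- As a global morphism into `j_* j^* N` it can be descended along the epimorphism `ε` and then
  -- restricted back to `V`.
  let g := homOpenPush (H.basis.lift x)
  have hg : kernel.ι ε ≫ g = 0 := by
    ext W y
    refine key inf_le_right _ ?_
    exact (app_res ε (inf_le_left : W ⊓ V ≤ W) ((kernel.ι ε).app W y)).trans ((congrArg _ (kernel_ι_app ε y)).trans (map_zero _))
  let S := ShortComplex.mk (kernel.ι ε) ε (kernel.condition ε)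
  have hS : S.Exact := S.exact_of_f_is_kernel (kernelIsKernel ε)
  have : Epi S.g := inferInstanceAs (Epi ε)
  obtain ⟨f, hf⟩ : ∃ f : F ⟶ openPush N V, ε ≫ f = g := ⟨hS.desc g hg, hS.g_desc g hg⟩
  refine ⟨localHomOfOpenPush f, fun i => ?_⟩
  rw [localHomOfOpenPush_apply]
  have h1 : f.app V (ε.app V (a i)) = g.app V (a i) := congrArg (fun t => Scheme.Modules.Hom.app t V (a i)) hf
  rw [h1]
  refine Eq.trans ?_ (H.basis.lift_self x i)
  exact congrArg (fun t : localHom A N V => t.1 ⟨V, le_rfl⟩ (a i)) (localHomOfOpenPush_homOpenPush (H.basis.lift x))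

end IsLocalPresentation

variable (b ε h) in
/-- `ε` and `h` have local presentations. -/
def HasLocalPresentations : Prop :=
  ∀ p : X, ∃ (V : X.Opens) (n : ℕ) (α : Fin n → Γ(A', V)) (a : Fin n → Γ(A, V)) (l : Γ(L, V)) (P : Matrix (Fin n) (Fin n) Γ(X, V)),
    p ∈ V ∧ IsLocalPresentation b ε h V α a l P

namespace HasLocalPresentations
variable (H : HasLocalPresentations b ε h)

theorem isPerfect (H : HasLocalPresentations b ε h) : IsPerfect b := fun p => by
  obtain ⟨V, n, α, a, l, P, hp, hV⟩ := H p
  exact ⟨V, n, α, a, hp, hV.basis_dual, hV.basis, hV.pair⟩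

theorem epi (H : HasLocalPresentations b ε h) : Epi ε := by
  refine epi_of_locally_surjective ε fun U y p hp => ?_
  obtain ⟨V, n, α, a, l, P, hpV, hV⟩ := H p
  obtain ⟨W, hW, hpW, x, hx⟩ := hV.surjective (U ⊓ V) inf_le_right (res F inf_le_left y) p ⟨hp, hpV⟩
  exact ⟨W, hW.trans inf_le_left, hpW, x, by rw [hx, res_res]⟩

theorem mono_tensorMap (H : HasLocalPresentations b ε h) {G : X.Modules} (hG : ∀ p : X, ∃ (U : X.Opens) (g : Γ(G, U)), p ∈ U ∧ IsBasisOn G U (fun _ : Unit => g)) :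
    Mono (tensorMap h (𝟙 G)) := by
  refine mono_of_injective _ fun U => ?_
  refine (injective_iff_map_eq_zero (appₗ (tensorMap h (𝟙 G)) U)).2 fun y hy => section_ext _ _ _ fun p hp => ?_
  obtain ⟨V, n, α, a, l, P, hpV, hV⟩ := H p
  obtain ⟨V', g, hpV', hg⟩ := hG p
  refine ⟨U ⊓ V ⊓ V', inf_le_left.trans inf_le_left, ⟨⟨hp, hpV⟩, hpV'⟩, ?_⟩
  refine (hV.mono (W := U ⊓ V ⊓ V') (inf_le_left.trans inf_le_right)).app_injective (hg.mono inf_le_right) ?_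
  rw [map_zero, app_res]
  exact (congrArg _ hy).trans ((map_zero _).trans (map_zero (appₗ (tensorMap h (𝟙 G)) _)).symm)

theorem epi_tensorMap (H : HasLocalPresentations b ε h) (I : X.Modules) [Injective I] : Epi (tensorMap h (𝟙 I)) := by
  refine epi_of_locally_surjective _ fun U y p hp => ?_
  obtain ⟨V, n, α, a, l, P, hpV, hV⟩ := H p
  exact ⟨U ⊓ V, inf_le_left, ⟨hp, hpV⟩, (hV.mono (inf_le_right : U ⊓ V ≤ V)).app_surjective I _⟩

theorem zero (H : HasLocalPresentations b ε h) [∀ N, IsIso (b.contract N)] (N : X.Modules) :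
    (dualPrecomp b ε).app N ≫ (tensorTrans h).app N = 0 := by
  ext U f
  refine section_ext _ _ _ fun p hp => ?_
  obtain ⟨V, n, α, a, l, P, hpV, hV⟩ := H p
  have hW := hV.mono (inf_le_right : U ⊓ V ≤ V)
  refine ⟨U ⊓ V, inf_le_left, ⟨hp, hpV⟩, ?_⟩
  refine (app_res ((dualPrecomp b ε).app N ≫ (tensorTrans h).app N) inf_le_left f).symm.trans ?_
  refine (congrArg ((tensorMap h (𝟙 N)).app (U ⊓ V)) (hW.dualPrecomp_app (res (sheafHom F N) inf_le_left f))).trans ?_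
  refine Eq.trans ?_ (map_zero (res (tensor (tensor A' L) N) (inf_le_left : U ⊓ V ≤ U)).hom).symm
  exact (hW.app_sum_tmul_eq_zero_iff _).2 fun j => hW.sum_smul_apply_eq_zero (toLocalHom (res (sheafHom F N) inf_le_left f)) j

/-- Local surjectivity of `ε` makes precomposition with it injective, and this precomposition
factors through the map in question. -/
theorem mono_dualPrecomp (H : HasLocalPresentations b ε h) [∀ N, IsIso (b.contract N)] (N : X.Modules) : Mono ((dualPrecomp b ε).app N) := by
  have := H.epi
  have h1 : Mono ((sheafHomPrecomp ε).app N) := by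
    refine mono_of_injective _ fun U f g e => ?_
    refine localHom_ext fun V hV y => section_ext _ _ _ fun p hp => ?_
    obtain ⟨W, hW, hpW, x, hx⟩ := locally_surjective_of_epi ε y p hp
    refine ⟨W, hW, hpW, ?_⟩
    rw [← localHom_apply_res f hV hW, ← localHom_apply_res g hV hW, ← hx]
    exact congrArg (fun t : Γ(sheafHom A N, U) => (toLocalHom t).1 ⟨W, hW.trans hV⟩ x) e
  have h2 : Mono ((dualPrecomp b ε).app N ≫ b.contract N) := (dualPrecomp_contract b ε N).symm ▸ h1
  exact @mono_of_mono _ _ _ _ _ _ _ h2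

/-- The coordinates of a section killed by `h ⊗ N` form a solution of the system with matrix `P`,
which is exactly what defines a local morphism from `F`. -/
theorem exact (H : HasLocalPresentations b ε h) [∀ N, IsIso (b.contract N)] (N : X.Modules) :
    (ShortComplex.mk ((dualPrecomp b ε).app N) ((tensorTrans h).app N) (H.zero N)).Exact := by
  have := H.epi
  refine exact_of_locally _ fun U y hy p hp => ?_
  obtain ⟨V, n, α, a, l, P, hpV, hV⟩ := H p
  have hW := hV.mono (inf_le_right : U ⊓ V ≤ V)
  obtain ⟨x, hx⟩ := (hW.basis_dual.tensor_bijective N).2 (res (tensor A' N) inf_le_left y)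
  have h0 : (tensorMap h (𝟙 N)).app (U ⊓ V) (res (tensor A' N) inf_le_left y) = 0 := by
    exact (app_res (tensorMap h (𝟙 N)) (inf_le_left : U ⊓ V ≤ U) y).trans ((congrArg _ hy).trans (map_zero _))
  rw [← hx] at h0
  obtain ⟨f, hf⟩ := hW.exists_localHom x ((hW.app_sum_tmul_eq_zero_iff x).1 h0)
  refine ⟨U ⊓ V, inf_le_left, ⟨hp, hpV⟩, toLocalHom.symm f, ?_⟩
  refine (hW.dualPrecomp_app (toLocalHom.symm f)).trans (Eq.trans ?_ hx)
  exact Finset.sum_congr rfl fun i _ => congrArg _ (hf i)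

end HasLocalPresentations
end presentation
end
end Higgs
-- The cohomology sheaves of `R𝓗om(F, G)`
namespace Higgs
noncomputable section

section
variable {C : Type*} [Category* C] [Abelian C] [HasDerivedCategory C]

/-- An object of `D⁺(C)` with cohomology only in degree one is a shift of its cohomology. -/
theorem nonempty_shift_iso_singleFunctor (Y : DerivedCategory.Plus C)
    (h : ∀ n : ℤ, n ≠ 1 → IsZero ((DerivedCategory.Plus.homologyFunctor C n).obj Y)) :
    Nonempty (Y⟦(1 : ℤ)⟧ ≅ (DerivedCategory.Plus.singleFunctor C 0).obj ((DerivedCategory.Plus.homologyFunctor C 1).obj Y)) := by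
  let Y' : DerivedCategory C := DerivedCategory.Plus.ι.obj Y
  have hGE : Y'.IsGE 1 := (DerivedCategory.isGE_iff _ _).2 fun i hi => h i hi.ne
  have hLE : Y'.IsLE 1 := (DerivedCategory.isLE_iff _ _).2 fun i hi => h i hi.ne'
  obtain ⟨A, ⟨e⟩⟩ := DerivedCategory.exists_iso_singleFunctor_obj_of_isGE_of_isLE Y' 1
  let e' : Y ≅ (DerivedCategory.Plus.singleFunctor C 1).obj A := DerivedCategory.Plus.ι.preimageIso e
  let i : (DerivedCategory.Plus.homologyFunctor C 1).obj Y ≅ A :=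
    (DerivedCategory.homologyFunctor C 1).mapIso (e ≪≫ (DerivedCategory.singleFunctorIsoCompQ C 1).app A) ≪≫
      (DerivedCategory.homologyFunctorFactors C 1).app _ ≪≫ (HomologicalComplex.homologyFunctorSingleIso C (.up ℤ) 1).app A
  exact ⟨(shiftFunctor _ (1 : ℤ)).mapIso e' ≪≫ ((DerivedCategory.Plus.singleFunctors C).shiftIso 1 0 1 (by simp)).app A ≪≫
    (DerivedCategory.Plus.singleFunctor C 0).mapIso i.symm⟩
end

variable {X : Scheme.{u}}

/-- The symmetry of the tensor product. -/
def tensorSwapIso (M N : X.Modules) : tensor M N ≅ tensor N M := ⟨tensorSwap M N, tensorSwap N M, tensorSwap_swap M N, tensorSwap_swap N M⟩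

/-- After exchanging the factors this is the functor `G ⊗ -`, which is exact for locally free `G`
and so preserves cokernels. -/
theorem nonempty_cokernel_tensorMap_iso {M N G : X.Modules} (h : M ⟶ N) (hG : IsLocFree G) :
    Nonempty (cokernel (tensorMap h (𝟙 G)) ≅ tensor (cokernel h) G) := by
  have := hG.preservesHomology
  have : PreservesFiniteColimits (tensorLeft G) := (tensorLeft G).preservesFiniteColimits_of_preservesHomology
  have w : tensorMap h (𝟙 G) ≫ (tensorSwapIso N G).hom = (tensorSwapIso M G).hom ≫ (tensorLeft G).map h :=
    tensor_hom_ext fun U m g => by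
      have h1 := congrArg ((tensorSwap N G).app U) (tensorMap_tmul h (𝟙 G) m g)
      have h2 := congrArg (((tensorLeft G).map h).app U) (tensorSwap_tmul m g)
      refine h1.trans ((tensorSwap_tmul _ _).trans (Eq.trans ?_ h2.symm))
      exact (tensorLeft_map_tmul G h g m).symm
  exact ⟨cokernel.mapIso _ _ (tensorSwapIso M G) (tensorSwapIso N G) w ≪≫ (PreservesCokernel.iso (tensorLeft G) h).symm ≪≫ tensorSwapIso G (cokernel h)⟩

theorem isLocFree_of_isBasisOn {M : X.Modules} (hM : ∀ p : X, ∃ (U : X.Opens) (m : Γ(M, U)), p ∈ U ∧ IsBasisOn M U (fun _ : Unit => m)) :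
    IsLocFree M := fun p => by
  obtain ⟨U, m, hp, hm⟩ := hM p
  exact ⟨U, 1, fun _ => m, hp, hm.reindex (Equiv.equivPUnit (Fin 1))⟩

/-- The functors `A' ⊗ -` and `(A' ⊗ L) ⊗ -` are exact and resolve `𝓗om(F, -)` on injectives, so the
general computation of derived functors applies. -/
theorem HasLocalPresentations.homology_sheafRHom {A A' L F : X.Modules} {b : BilinHom A' A (structureSheaf X)} {ε : A ⟶ F} {h : A' ⟶ tensor A' L}
    (H : HasLocalPresentations b ε h) {G : X.Modules} (hG : ∀ p : X, ∃ (U : X.Opens) (g : Γ(G, U)), p ∈ U ∧ IsBasisOn G U (fun _ : Unit => g))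
    [HasDerivedCategory X.Modules] :
    (∀ n : ℤ, n ≠ 1 → IsZero (sheafExt n F G)) ∧ Nonempty (sheafExt 1 F G ≅ tensor (cokernel h) G) := by
  have hb (N : X.Modules) : IsIso (b.contract N) := H.isPerfect.isIso_contract N
  have : (tensorLeft A').PreservesHomology := IsLocFree.preservesHomology fun p => by
    obtain ⟨V, n, α, a, l, P, hp, hV⟩ := H p
    exact ⟨V, n, α, hp, hV.basis_dual⟩
  have : (tensorLeft (tensor A' L)).PreservesHomology := IsLocFree.preservesHomology fun p => by
    obtain ⟨V, n, α, a, l, P, hp, hV⟩ := H p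
    exact ⟨V, n, _, hp, hV.generator.tensor hV.basis_dual⟩
  have : Mono ((tensorTrans h).app G) := H.mono_tensorMap hG
  obtain ⟨h1, ⟨e⟩⟩ := homology_of_resolution (dualPrecomp b ε) (tensorTrans h) H.zero (fun I _ =>
    { exact := H.exact I
      mono_f := H.mono_dualPrecomp I
      epi_g := H.epi_tensorMap I }) G
  obtain ⟨e'⟩ := nonempty_cokernel_tensorMap_iso h (isLocFree_of_isBasisOn hG)
  exact ⟨h1, ⟨e ≪≫ e'⟩⟩

end
end Higgs
-- Regular functions on affine open sets; matrices of the Higgs field, its transpose and the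
-- tautological section
namespace Higgs
noncomputable section
variable {X : Scheme.{u}}

section affine
variable {V : X.Opens}

instance : SheafOfModules.IsQuasicoherent.{u} (R := X.ringCatSheaf) (structureSheaf X) :=
  (SheafOfModules.isQuasicoherent.{u} X.ringCatSheaf).prop_of_iso
    (show SheafOfModules.free (R := X.ringCatSheaf) PUnit.{u + 1} ≅ SheafOfModules.unit X.ringCatSheaf from coproductUniqueIso _)
    (inferInstanceAs (SheafOfModules.IsQuasicoherent.{u} (SheafOfModules.free (R := X.ringCatSheaf) PUnit.{u + 1})))

theorem isUnit_ores_basicOpen (f : Γ(X, V)) : IsUnit (ores (X.basicOpen_le f) f) :=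
  RingedSpace.isUnit_res_basicOpen _ f

/-- Extra powers of `f` do no harm, so the sum of the individual exponents serves for all members.
-/
theorem exists_res_eq_pow_smul_family (hV : IsAffineOpen V) (F : X.Modules) [SheafOfModules.IsQuasicoherent.{u} (R := X.ringCatSheaf) F] (f : Γ(X, V))
    {ι : Type*} [Fintype ι] (y : ι → Γ(F, X.basicOpen f)) :
    ∃ (n : ℕ) (x : ι → Γ(F, V)), ∀ i, res F (X.basicOpen_le f) (x i) = ores (X.basicOpen_le f) f ^ n • y i := by
  choose n x h using fun i => exists_res_eq_pow_smul hV F f (y i)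
  refine ⟨∑ i, n i, fun i => f ^ (∑ i, n i - n i) • x i, fun i => ?_⟩
  rw [res_smul, h, smul_smul, map_pow, ← pow_add, Nat.sub_add_cancel (Finset.single_le_sum (f := n) (fun _ _ => Nat.zero_le _) (Finset.mem_univ i))]

/-- Regularity passes to a basic open set by clearing denominators, and basic open sets of `V` cover
`W`. -/
theorem ores_mul_eq_zero (hV : IsAffineOpen V) {r : Γ(X, V)} (hr : ∀ x, r * x = 0 → x = 0) {W : X.Opens} (hW : W ≤ V) (x : Γ(X, W))
    (hx : ores hW r * x = 0) : x = 0 := by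
  refine section_ext (structureSheaf X) x 0 fun p hp => ?_
  obtain ⟨f, hf, hpf⟩ := hV.exists_basicOpen_le ⟨p, hp⟩ (hW hp)
  refine ⟨X.basicOpen f, hf, hpf, ?_⟩
  have hx' : ores (X.basicOpen_le f) r * ores hf x = 0 := by
    rw [← ores_ores hW hf, ← map_mul, hx, map_zero]
  refine Eq.trans (b := (0 : Γ(X, X.basicOpen f))) ?_ (map_zero (ores hf)).symm
  change ores hf x = 0
  generalize ores hf x = y at hx'
  obtain ⟨n, z, hz⟩ : ∃ (n : ℕ) (z : Γ(X, V)), ores (X.basicOpen_le f) z = ores (X.basicOpen_le f) f ^ n * y :=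
    exists_res_eq_pow_smul hV (structureSheaf X) f y
  obtain ⟨m, hm⟩ := exists_pow_smul_eq_zero hV (structureSheaf X) f (r * z : Γ(X, V)) (by
    change ores (X.basicOpen_le f) (r * z) = 0
    rw [map_mul, hz, mul_left_comm, hx', mul_zero])
  replace hm : f ^ m * (r * z) = 0 := hm
  have h1 := hr (f ^ m * z) (by rw [mul_left_comm]; exact hm)
  have h2 := congrArg (ores (X.basicOpen_le f)) h1
  rw [map_mul, hz, map_pow, map_zero, ← mul_assoc, ← pow_add] at h2
  exact (((isUnit_ores_basicOpen f).pow _).mul_right_eq_zero).1 h2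
end affine

section
variable {S : Scheme.{u}} (π : X ⟶ S)

theorem pullback_map_pullSec {M N : S.Modules} (f : M ⟶ N) {U : S.Opens} (m : Γ(M, U)) :
    ((Scheme.Modules.pullback π).map f).app (π ⁻¹ᵁ U) (pullSec π m) = pullSec π (f.app U m) :=
  congrArg (fun t => Scheme.Modules.Hom.app t U m) ((Scheme.Modules.pullbackPushforwardAdjunction π).unit.naturality f).symm

theorem pullSec_sum {M : S.Modules} {U : S.Opens} {ι : Type*} (s : Finset ι) (m : ι → Γ(M, U)) :
    pullSec π (∑ i ∈ s, m i) = ∑ i ∈ s, pullSec π (m i) :=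
  map_sum (unitₗ π M U) m s

theorem pullbackTensor_pullSec (M N : S.Modules) {U : S.Opens} (m : Γ(M, U)) (n : Γ(N, U)) :
    (pullbackTensor π M N).app (π ⁻¹ᵁ U) (pullSec π (tmul m n)) = tmul (pullSec π m) (pullSec π n) :=
  (adjoint_pullSec π _ (tmul m n)).trans (tensorDesc_tmul _ m n)

theorem projectionMap_tmul (M : X.Modules) (N : S.Modules) {U : S.Opens} (m : Γ(M, π ⁻¹ᵁ U)) (n : Γ(N, U)) :
    (projectionMap π M N).app U (tmul (show Γ((Scheme.Modules.pushforward π).obj M, U) from m) n) = tmul m (pullSec π n) :=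
  tensorDesc_tmul (M := (Scheme.Modules.pushforward π).obj M) (P := (Scheme.Modules.pushforward π).obj (tensor M ((Scheme.Modules.pullback π).obj N))) _ m n

variable {K E : S.Modules} {F : X.Modules} {U : S.Opens} {n : ℕ} {b : Fin n → Γ(E, U)} {k : Γ(K, U)} {A : Matrix (Fin n) (Fin n) Γ(S, U)}

/-- The coefficients of `ψ` on the dual basis are found by testing the transpose identity on `b s`
and the `i`-th dual vector, where it reads `A s i • k = c s • k`. -/
theorem IsTranspose.app_dualBasis {φ : E ⟶ tensor E K} {ψ : dual E ⟶ tensor (dual E) K} (h : IsTranspose φ ψ) (hb : IsBasisOn E U b)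
    (hk : IsBasisOn K U (fun _ : Unit => k)) (hφ : ∀ i, φ.app U (b i) = ∑ j, A i j • tmul (b j) k) (i : Fin n) :
    ψ.app U (hb.dualBasis i) = ∑ j, A j i • tmul (hb.dualBasis j) k := by
  obtain ⟨c, hc⟩ := ((hk.tensor hb.isBasisOn_dual) U le_rfl).2 (ψ.app U (hb.dualBasis i))
  simp only [res_self] at hc
  rw [← hc]
  refine Finset.sum_congr rfl fun s _ => congrArg (· • tmul (hb.dualBasis s) k) ?_
  have h1 := h U (b s) (hb.dualBasis i)
  rw [← hc, hφ] at h1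
  simp only [← tmul_smul] at h1
  have h2 := contract_sum_tmul (dualPairing E) hb.pair_dualBasis (fun j => c j • k) s
  have h3 := contract_sum_tmul (dualPairing E).flip (fun i j => (hb.pair_dualBasis j i).trans (by simp only [eq_comm])) (fun j => A s j • k) i
  have h4 : A s i • k = c s • k := h3.symm.trans (h1.trans h2)
  have h5 := @(hk U le_rfl).1 (fun _ => c s) (fun _ => A s i) (by simpa [res_self] using h4.symm)
  exact congrFun h5 ()

variable {τ : Γ((Scheme.Modules.pullback π).obj K, ⊤)} {t : Γ(X, π ⁻¹ᵁ U)}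

theorem higgsDiff_pullSec {M : S.Modules} (ψ : M ⟶ tensor M K) (ht : res _ le_top τ = t • pullSec π k) {m : Fin n → Γ(M, U)}
    (hψ : ∀ i, ψ.app U (m i) = ∑ j, A j i • tmul (m j) k) (i : Fin n) :
    (higgsDiff π τ ψ).app (π ⁻¹ᵁ U) (pullSec π (m i)) =
      ∑ j, (A.map (π.app U).hom - Matrix.scalar (Fin n) t) j i • tmul (pullSec π (m j)) (pullSec π k) := by
  have h1 : (pullbackHiggs π ψ).app (π ⁻¹ᵁ U) (pullSec π (m i)) = ∑ j, π.app U (A j i) • tmul (pullSec π (m j)) (pullSec π k) := by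
    refine (congrArg ((pullbackTensor π M K).app (π ⁻¹ᵁ U)) (pullback_map_pullSec π ψ (m i))).trans ?_
    rw [hψ, pullSec_sum]
    refine (app_sum _ _ _).trans (Finset.sum_congr rfl fun j _ => ?_)
    rw [pullSec_smul, app_smul, pullbackTensor_pullSec]
  have h2 : (tensorSection _ τ).app (π ⁻¹ᵁ U) (pullSec π (m i)) = ∑ j, (Matrix.scalar (Fin n) t) j i • tmul (pullSec π (m j)) (pullSec π k) := by
    rw [tensorSection_app, ht, tmul_smul, Finset.sum_eq_single i]
    · simp
    · intro j _ hj; simp [hj]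
    · simp
  refine (congrArg₂ (· - ·) h1 h2).trans ?_
  rw [← Finset.sum_sub_distrib]
  exact Finset.sum_congr rfl fun j _ => (sub_smul _ _ _).symm

/-- In `F ⊗ π^*K` the tautological section gives `t m_i ⊗ k` and the Higgs field gives `∑ A_ij m_j ⊗
k`; the generator `k` can be cancelled. -/
theorem IsSpectral.relation {φ : E ⟶ tensor E K} {e : (Scheme.Modules.pushforward π).obj F ≅ E} (he : IsSpectral π τ φ e)
    (ht : res _ le_top τ = t • pullSec π k) (hk : IsBasisOn K U (fun _ : Unit => k)) (hφ : ∀ i, φ.app U (b i) = ∑ j, A i j • tmul (b j) k)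
    (m : Fin n → Γ(F, π ⁻¹ᵁ U)) (hm : ∀ i, m i = e.inv.app U (b i)) (i : Fin n) :
    ∑ j, (A.map (π.app U).hom - Matrix.scalar (Fin n) t) i j • m j = 0 := by
  have h1 : (tensorSection F τ).app (π ⁻¹ᵁ U) (m i) = (projectionMap π F K).app U ((tensorMap e.inv (𝟙 K)).app U (φ.app U (e.hom.app U (m i)))) :=
    congrArg (fun h => Scheme.Modules.Hom.app h U (m i)) he
  have h2 : e.hom.app U (m i) = b i := by
    rw [hm]
    exact congrArg (fun h => Scheme.Modules.Hom.app h U (b i)) e.inv_hom_id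
  have h3 : (projectionMap π F K).app U ((tensorMap e.inv (𝟙 K)).app U (φ.app U (b i))) = tmul (∑ j, π.app U (A i j) • m j) (pullSec π k) := by
    rw [hφ, sum_tmul]
    refine (congrArg ((projectionMap π F K).app U) (app_sum _ _ _)).trans ((app_sum _ _ _).trans (Finset.sum_congr rfl fun j _ => ?_))
    refine (congrArg ((projectionMap π F K).app U) ((app_smul _ _ _).trans (congrArg _ (tensorMap_tmul e.inv (𝟙 K) (b j) k)))).trans ?_
    refine (app_smul _ _ _).trans ?_
    rw [smul_tmul, hm j]
    exact congrArg (fun x : Γ(tensor F ((Scheme.Modules.pullback π).obj K), π ⁻¹ᵁ U) => π.app U (A i j) • x) (projectionMap_tmul π F K _ k)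
  rw [h2, h3, tensorSection_app, ht, tmul_smul, ← smul_tmul] at h1
  have h4 := ((hk.pullback π).tmul_bijective F).1 h1
  simp only [Matrix.sub_apply, sub_smul, Finset.sum_sub_distrib]
  rw [sub_eq_zero]
  refine Eq.trans h4.symm ?_
  rw [Finset.sum_eq_single i]
  · simp
  · intro j _ hj; simp [hj.symm]
  · simp

end
end
end Higgs
-- Local presentations of the spectral sheaf
namespace Higgs
noncomputable section
variable {X : Scheme.{u}}

section affine
variable {V : X.Opens} {F : X.Modules} [SheafOfModules.IsQuasicoherent.{u} (R := X.ringCatSheaf) F]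

/-- A finite presentation of the module of sections over an affine open set is a presentation on all smaller open sets. -/
theorem exists_relation_of_affine (hV : IsAffineOpen V) {n : ℕ} (m : Fin n → Γ(F, V)) (P : Matrix (Fin n) (Fin n) Γ(X, V))
    (H : ∀ c : Fin n → Γ(X, V), ∑ i, c i • m i = 0 → ∃ d : Fin n → Γ(X, V), c = P.transpose.mulVec d)
    {W : X.Opens} (hW : W ≤ V) (c : Fin n → Γ(X, W)) (hc : ∑ i, c i • res F hW (m i) = 0) (p : X) (hp : p ∈ W) :
    ∃ (W' : X.Opens) (h : W' ≤ W), p ∈ W' ∧ ∃ d : Fin n → Γ(X, W'), ∀ i, ores h (c i) = ∑ j, d j * ores (h.trans hW) (P j i) := by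
  obtain ⟨f, hf, hpf⟩ := hV.exists_basicOpen_le ⟨p, hp⟩ (hW hp)
  refine ⟨X.basicOpen f, hf, hpf, ?_⟩
  obtain ⟨N, c', hc'⟩ : ∃ (N : ℕ) (c' : Fin n → Γ(X, V)), ∀ i, ores (X.basicOpen_le f) (c' i) = ores (X.basicOpen_le f) f ^ N * ores hf (c i) :=
    exists_res_eq_pow_smul_family hV (structureSheaf X) f (fun i => ores hf (c i))
  -- The numerators `c'` satisfy the relation only over the basic open set; a further power of `f`
  -- makes it hold over `V`, where `H` applies.
  obtain ⟨M, hM⟩ := exists_pow_smul_eq_zero hV F f (∑ i, c' i • m i) (by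
    have h1 := congrArg (fun x => ores (X.basicOpen_le f) f ^ N • res F hf x) hc
    simp only [map_zero, smul_zero, map_sum, res_smul, res_res, Finset.smul_sum, smul_smul] at h1
    rw [map_sum, ← h1]
    exact Finset.sum_congr rfl fun i _ => by rw [res_smul, hc'])
  simp only [Finset.smul_sum, smul_smul] at hM
  obtain ⟨d, hd⟩ := H _ hM
  obtain ⟨v, hv⟩ := (isUnit_ores_basicOpen f).exists_left_inv
  -- `v` inverts `f` on the basic open set; `N` powers come from clearing denominators and `M` from
  -- killing the error.
  refine ⟨fun j => v ^ (M + N) * ores (X.basicOpen_le f) (d j), fun i => ?_⟩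
  have h2 := congrArg (ores (X.basicOpen_le f)) (congrFun hd i)
  rw [map_mul, map_pow, hc', ← mul_assoc, ← pow_add] at h2
  calc ores hf (c i) = v ^ (M + N) * (ores (X.basicOpen_le f) f ^ (M + N) * ores hf (c i)) := by
        rw [← mul_assoc, ← mul_pow, hv, one_pow, one_mul]
    _ = _ := by
        rw [h2, Matrix.mulVec, dotProduct, map_sum, Finset.mul_sum]
        exact Finset.sum_congr rfl fun j _ => by rw [map_mul, Matrix.transpose_apply]; ring

/-- Up to a power of `f`, which is invertible on `D(f)`, a section over `D(f)` extends to `V`, where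
it has a preimage. -/
theorem exists_preimage_of_affine (hV : IsAffineOpen V) {A : X.Modules} (ε : A ⟶ F) (H : Function.Surjective (ε.app V))
    {W : X.Opens} (hW : W ≤ V) (y : Γ(F, W)) (p : X) (hp : p ∈ W) :
    ∃ (W' : X.Opens) (h : W' ≤ W), p ∈ W' ∧ ∃ x, ε.app W' x = res F h y := by
  obtain ⟨f, hf, hpf⟩ := hV.exists_basicOpen_le ⟨p, hp⟩ (hW hp)
  refine ⟨X.basicOpen f, hf, hpf, ?_⟩
  obtain ⟨N, z, hz⟩ := exists_res_eq_pow_smul hV F f (res F hf y)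
  obtain ⟨x, rfl⟩ := H z
  obtain ⟨v, hv⟩ := (isUnit_ores_basicOpen f).exists_left_inv
  refine ⟨v ^ N • res A (X.basicOpen_le f) x, ?_⟩
  rw [app_smul, app_res, hz, smul_smul, ← mul_pow, hv, one_pow, one_smul]
end affine

section
variable {S : Scheme.{u}} {π : X ⟶ S} {K E : S.Modules} {τ : Γ((Scheme.Modules.pullback π).obj K, ⊤)}

/-- Around every point there is an affine open set with a basis of `E` and a generator of `K`. -/
theorem exists_affine_basis (hE : IsLocFree E) (hK : ∀ p : S, ∃ (U : S.Opens) (k : Γ(K, U)), p ∈ U ∧ IsBasisOn K U (fun _ : Unit => k)) (p : S) :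
    ∃ (U : S.Opens) (n : ℕ) (b : Fin n → Γ(E, U)) (k : Γ(K, U)), IsAffineOpen U ∧ p ∈ U ∧ IsBasisOn E U b ∧ IsBasisOn K U (fun _ : Unit => k) := by
  obtain ⟨U₁, n, b, hp₁, hb⟩ := hE p
  obtain ⟨U₂, k, hp₂, hk⟩ := hK p
  obtain ⟨U, hU, hpU, hle⟩ := TopologicalSpace.Opens.isBasis_iff_nbhd.1 S.isBasis_affineOpens (show p ∈ U₁ ⊓ U₂ from ⟨hp₁, hp₂⟩)
  exact ⟨U, n, _, _, hU, hpU, hb.mono (hle.trans inf_le_left), hk.mono (hle.trans inf_le_right)⟩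

/-- The sections of a spectral sheaf over a preimage have no relations over the base. -/
theorem eq_zero_of_sum_app_smul_eq_zero {F : X.Modules} (e : (Scheme.Modules.pushforward π).obj F ≅ E) {U : S.Opens} {n : ℕ} {b : Fin n → Γ(E, U)}
    (hb : IsBasisOn E U b) (m : Fin n → Γ(F, π ⁻¹ᵁ U)) (hm : ∀ i, m i = e.inv.app U (b i)) (r : Fin n → Γ(S, U))
    (hr : ∑ i, π.app U (r i) • m i = 0) : r = 0 := by
  have h1 : e.inv.app U (∑ i, r i • b i) = 0 := by
    refine (app_sum _ _ _).trans ((Finset.sum_congr rfl fun i _ => ?_).trans hr)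
    rw [hm]
    exact app_smul e.inv _ _
  have h2 : ∑ i, r i • b i = 0 :=
    (congrArg (fun h => Scheme.Modules.Hom.app h U (∑ i, r i • b i)) e.inv_hom_id).symm.trans
      ((congrArg (e.hom.app U) h1).trans (map_zero (e.hom.app U).hom))
  exact @(hb U le_rfl).1 r 0 (by simpa [res_self] using h2)

/-- The spectral sheaf and its dual have local presentations by the characteristic matrix of the Higgs field. -/
theorem hasLocalPresentations (hX : IsTotalSpace K π τ) (hE : IsLocFree E)
    (hK : ∀ p : S, ∃ (U : S.Opens) (k : Γ(K, U)), p ∈ U ∧ IsBasisOn K U (fun _ : Unit => k)) {φ : E ⟶ tensor E K}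
    {F : X.Modules} [SheafOfModules.IsQuasicoherent.{u} (R := X.ringCatSheaf) F] {e : (Scheme.Modules.pushforward π).obj F ≅ E}
    (he : IsSpectral π τ φ e) {ψ : dual E ⟶ tensor (dual E) K} (hψ : IsTranspose φ ψ) :
    HasLocalPresentations (pullbackPairing π (dualPairing E)) (((Scheme.Modules.pullbackPushforwardAdjunction π).homEquiv _ _).symm e.inv)
      (higgsDiff π τ ψ) := by
  intro p
  obtain ⟨U, n, b, k, hU, hp, hb, hk⟩ := exists_affine_basis hE hK (π p)
  -- The fibre coordinate `τ / k` on the preimage of `U`.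
  obtain ⟨t, ht⟩ : ∃ t : Γ(X, π ⁻¹ᵁ U), res _ le_top τ = t • pullSec π k := by
    obtain ⟨c, hc⟩ := (hk.pullback π _ le_rfl).2 (res _ le_top τ)
    exact ⟨c (), hc.symm.trans ((Fintype.sum_unique _).trans (by rw [res_self]))⟩
  have hA (i : Fin n) : ∃ c : Fin n → Γ(S, U), φ.app U (b i) = ∑ j, c j • tmul (b j) k := by
    obtain ⟨c, hc⟩ := ((hk.tensor hb) U le_rfl).2 (φ.app U (b i))
    simp only [res_self] at hc
    exact ⟨c, hc.symm⟩
  obtain ⟨A, hA⟩ : ∃ A : Matrix (Fin n) (Fin n) Γ(S, U), ∀ i, φ.app U (b i) = ∑ j, A i j • tmul (b j) k := ⟨_, (Classical.axiomOfChoice hA).choose_spec⟩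
  obtain ⟨hV, hg⟩ := hX.isAffineOpen_preimage hU hk ht
  obtain ⟨ε, hε₀⟩ : ∃ ε, ε = ((Scheme.Modules.pullbackPushforwardAdjunction π).homEquiv _ _).symm e.inv := ⟨_, rfl⟩
  have hε (x : Γ(E, U)) : ε.app (π ⁻¹ᵁ U) (pullSec π x) = e.inv.app U x := hε₀ ▸ adjoint_pullSec π e.inv x
  rw [← hε₀]
  obtain ⟨m, hm⟩ : ∃ m : Fin n → Γ(F, π ⁻¹ᵁ U), ∀ i, m i = ε.app (π ⁻¹ᵁ U) (pullSec π (b i)) := ⟨_, fun _ => rfl⟩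
  have hm' (i : Fin n) : m i = e.inv.app U (b i) := (hm i).trans (hε _)
  have hrel := he.relation π ht hk hA m hm'
  have hinj := eq_zero_of_sum_app_smul_eq_zero e hb m hm'
  have hker := exists_transpose_mulVec_of_sum_smul_eq_zero A hg.2 m hrel hinj
  -- Every section of `F` over the preimage of `U` is already a section of `E` over `U`, so its
  -- pullback maps onto it.
  have hsurj : Function.Surjective (ε.app (π ⁻¹ᵁ U)) := fun z =>
    ⟨pullSec π (e.hom.app U z), (hε _).trans (congrArg (fun h => Scheme.Modules.Hom.app h U z) e.hom_inv_id)⟩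
  have hdual := higgsDiff_pullSec π ψ ht (hψ.app_dualBasis hb hk hA)
  have hpair (i j : Fin n) : (pullbackPairing π (dualPairing E)).pair (π ⁻¹ᵁ U) (pullSec π (hb.dualBasis i)) (pullSec π (b j)) =
      if j = i then 1 else 0 := by
    refine (pullbackPairing_pullSec _ _ _ _).trans ?_
    rw [hb.pair_dualBasis, apply_ite (π.app U), map_one, map_zero]
  simp only [hm] at hrel hker
  exact ⟨π ⁻¹ᵁ U, n, fun i => pullSec π (hb.dualBasis i), fun i => pullSec π (b i), pullSec π k,
    A.map (π.app U).hom - Matrix.scalar (Fin n) t, hp,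
    { basis_dual := hb.isBasisOn_dual.pullback π
      basis := hb.pullback π
      generator := hk.pullback π
      pair := hpair
      app_dual := hdual
      relation := hrel
      det_mul := fun W hW x => ores_mul_eq_zero hV (fun x hx => det_sub_mul_eq_zero A hg hx) hW x
      kernel := fun W hW c hc p hp => exists_relation_of_affine hV _ _ hker hW c hc p hp
      surjective := fun W hW y p hp => exists_preimage_of_affine hV ε hsurj hW y p hp }⟩
end

end
end Higgs

/-! ### The theorem -/

theorem mainTheorem7 {S : Scheme.{0}} (s : S ⟶ Spec (.of ℂ)) [SmoothOfRelativeDimension 2 s]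
    (hs : Higgs.IsProjective s)
    {X : Scheme.{0}} (π : X ⟶ S)
    (τ : Γ((Scheme.Modules.pullback π).obj (Higgs.canonicalSheaf s 2), ⊤))
    (hX : Higgs.IsTotalSpace (Higgs.canonicalSheaf s 2) π τ)
    (E : S.Modules) [SheafOfModules.IsFiniteType E] [SheafOfModules.IsLocallyFree E]
    (φ : E ⟶ Higgs.tensor E (Higgs.canonicalSheaf s 2))
    (F : X.Modules) [SheafOfModules.IsQuasicoherent F]
    (e : (Scheme.Modules.pushforward π).obj F ≅ E) (he : Higgs.IsSpectral π τ φ e)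
    [HasDerivedCategory X.Modules] :
    Nonempty
      ((Higgs.sheafRHom F
          ((Scheme.Modules.pullback π).obj (Higgs.dual (Higgs.canonicalSheaf s 2))))⟦(1 : ℤ)⟧ ≅
        (DerivedCategory.Plus.singleFunctor X.Modules 0).obj
          (Higgs.sheafExt 1 F
            ((Scheme.Modules.pullback π).obj (Higgs.dual (Higgs.canonicalSheaf s 2))))) ∧
    (∃! ψ : Higgs.dual E ⟶ Higgs.tensor (Higgs.dual E) (Higgs.canonicalSheaf s 2),
      Higgs.IsTranspose φ ψ) ∧
    ∀ ψ : Higgs.dual E ⟶ Higgs.tensor (Higgs.dual E) (Higgs.canonicalSheaf s 2),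
      Higgs.IsTranspose φ ψ →
      Nonempty
        (Higgs.sheafExt 1 F
            ((Scheme.Modules.pullback π).obj (Higgs.dual (Higgs.canonicalSheaf s 2))) ≅
          Higgs.tensor (cokernel (Higgs.higgsDiff π τ ψ))
            ((Scheme.Modules.pullback π).obj (Higgs.dual (Higgs.canonicalSheaf s 2)))) := by
  have hA : IsField (CommRingCat.of ℂ) := Field.toIsField ℂ
  have hK := Higgs.exists_generator_canonicalSheaf s hA 2
  have hE := Higgs.isLocFree_of_isLocallyFree E
  -- The coefficient sheaf is a line bundle: its local generators are pulled back from those dual to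
  -- generators of the canonical sheaf.
  have hG (p : X) : ∃ (U : X.Opens) (g : Γ((Scheme.Modules.pullback π).obj (Higgs.dual (Higgs.canonicalSheaf s 2)), U)),
      p ∈ U ∧ Higgs.IsBasisOn _ U (fun _ : Unit => g) := by
    obtain ⟨U, k, hp, hk⟩ := hK (π p)
    exact ⟨π ⁻¹ᵁ U, _, hp, hk.isBasisOn_dual.pullback π⟩
  have hψ := Higgs.existsUnique_isTranspose hE φ
  have key (ψ : Higgs.dual E ⟶ Higgs.tensor (Higgs.dual E) (Higgs.canonicalSheaf s 2)) (h : Higgs.IsTranspose φ ψ) :=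
    (Higgs.hasLocalPresentations hX hE hK he h).homology_sheafRHom hG
  -- Vanishing of the other cohomology sheaves does not mention `ψ`, so any one transpose proves it.
  obtain ⟨ψ, h, -⟩ := id hψ
  exact ⟨Higgs.nonempty_shift_iso_singleFunctor _ (key ψ h).1, hψ, fun ψ h => (key ψ h).2⟩
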